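/- **Theorem (Local Marchenko–Pastur law).** There is an absolute constant $C_1>0$ such that the following holds for every constant $C_0\ge C_1$. Let $0<y<1$, $a=(1-\sqrt y)^2$, $b=(1+\sqrt y)^2$ and $$\rho_{MP,y}(x)=\frac{1}{2\pi xy}\sqrt{(b-x)(x-a)}\,\mathbf 1_{[a,b]}(x).$$ Consider a sequence of dimensions $(p,n)$ with $p\to\infty$ and $p/n\to y$, and numbers $0<\delta<1/2$ which may depend on the index of the sequence and satisfy $p/n-y=o(\delta^2)$ (this is automatic if $\delta$ is constant). For each member of the sequence let $x_{ij}$, $1\le i\le p$, $1\le j\le n$, be independent (not necessarily identically distributed) real random variables with mean $0$ and variance $1$, such that almost surely $|x_{ij}|\le K$ for all $i,j$, where the deterministic numbers $K$ (which may also depend on the index) satisfy $$K=o\!\left(p^{1/C_0}\,\delta^2\,\log^{-1}p\right).$$ Let $Y=(y_{ij})$ be the $p\times n$ matrix with entries $y_{ij}=x_{ij}/\sqrt{\sum_{l=1}^n x_{il}^2}$ (with $y_{ij}=0$ if the denominator vanishes), let $W=YY^T$ be the sample correlation matrix, and let $N_I$ be the number of eigenvalues of $W$ in $I$, counted with multiplicity.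 Then, with overwhelming probability, simultaneously for all intervals $I\subset[a/2,2b]$ of length $|I|\ge \dfrac{K^2\log^7p}{\delta^9p}$, $$\left|N_I-p\int_I\rho_{MP,y}(x)\,dx\right|\le\delta\,p\,|I|.$$ Here events hold with overwhelming probability if, for every constant $A>0$, the probabilities of their complements are $O_A(n^{-A})$ along the sequence. -/

import Mathlib

open MeasureTheory ProbabilityTheory Filter Asymptotics Topology

noncomputable section

/-- The row-normalised data matrix `Y`, with entries `x i j / ‖x i‖`, where `‖x i‖` is the
Euclidean norm of the `i`-th row. -/
def normalizedRows {p n : ℕ} (x : Matrix (Fin p) (Fin n) ℝ) : Matrix (Fin p) (Fin n) ℝ :=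
  Matrix.of fun i j => x i j / √(∑ l, x i l ^ 2)

/-- The sample correlation matrix `W = Y Yᵀ`. -/
def sampleCorrelation {p n : ℕ} (x : Matrix (Fin p) (Fin n) ℝ) : Matrix (Fin p) (Fin p) ℝ :=
  normalizedRows x * (normalizedRows x).transpose

theorem sampleCorrelation_isHermitian {p n : ℕ} (x : Matrix (Fin p) (Fin n) ℝ) :
    (sampleCorrelation x).IsHermitian := by
  have h := Matrix.isHermitian_mul_conjTranspose_self (normalizedRows x)
  rwa [Matrix.conjTranspose_eq_transpose_of_trivial] at h

/-- `N_I`: the number of eigenvalues of the sample correlation matrix in `I`, counted with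
multiplicity. -/
def eigenvalueCount {p n : ℕ} (x : Matrix (Fin p) (Fin n) ℝ) (I : Set ℝ) : ℕ :=
  Nat.card {i : Fin p // (sampleCorrelation_isHermitian x).eigenvalues i ∈ I}

/-- The lower edge `a = (1 - √y)²` of the Marchenko-Pastur law. -/
def mpLower (y : ℝ) : ℝ := (1 - √y) ^ 2

/-- The upper edge `b = (1 + √y)²` of the Marchenko-Pastur law. -/
def mpUpper (y : ℝ) : ℝ := (1 + √y) ^ 2

/-- The Marchenko-Pastur density with ratio `y`. -/
def mpDensity (y : ℝ) : ℝ → ℝ :=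
  (Set.Icc (mpLower y) (mpUpper y)).indicator fun x =>
    1 / (2 * Real.pi * x * y) * √((mpUpper y - x) * (x - mpLower y))

/-- The events `E k` hold with overwhelming probability with respect to the size `n k`: for every
`A > 0` the probability of the complement is `O(n ^ (-A))`, with a constant depending on `A`. -/
def WithOverwhelmingProbability (n : ℕ → ℕ) {Ω : ℕ → Type*} [∀ k, MeasurableSpace (Ω k)]
    (μ : ∀ k, Measure (Ω k)) (E : ∀ k, Set (Ω k)) : Prop :=
  ∀ A : ℝ, 0 < A → (fun k => (μ k).real (E k)ᶜ) =O[atTop] fun k => (n k : ℝ) ^ (-A)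

end

/-!
Let `Y` be the row-normalised data matrix, with rows `y_i`, and let `m(z) = n⁻¹ tr (YᵀY - z)⁻¹`. Up
to the `n - p` additional zero eigenvalues of `YᵀY`, the imaginary part of `m(E + iη)` is the
spectral density of `W = YYᵀ` smoothed at scale `η`. It is enough to compare it with the
Marchenko–Pastur density at the single scale `η = K² log⁵ p / (δ⁷ p)`, uniformly in `E`.

**Self-consistent equation.** Removing row `i` from `Y` is a rank-one perturbation of `YᵀY`, so the
Sherman–Morrison formula gives the exact identity `1 + z m = n⁻¹ ∑ (1 - 1 / (1 + q_i))`, where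
`q_i = y_iᵀ (Y_(i)ᵀ Y_(i) - z)⁻¹ y_i` and `Y_(i)` is `Y` without row `i`
(`one_add_mul_companionTransform`). Each row of `Y` is a function of the corresponding data row
alone, so `Y_(i)` is independent of the data row `x_i`, and `q_i = x_iᵀ (…)⁻¹ x_i / ‖x_i‖²`. A
Hanson–Wright inequality with the scale `K ‖B‖_F + K² ‖B‖` (`measureReal_quadForm_le`) shows that
the numerator is close to the trace of the resolvent and the denominator close to `n`. With
`‖B‖_F² = Im tr / η` (the Ward identity) this gives `|q_i - m| ≲ T K (n η)^(-1/2) (1 + |m|)`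
outside an event of probability `O(e^(-T))` (`norm_rowForm_sub_companionTransform_le`). The
normalisation of the rows costs nothing beyond the concentration of their lengths.

**Stability.** The identity bounds `m` (`norm_companionTransform_le_of_rowForm`), so that
`|q_i - m| ≤ ε` with a small `ε`. It also shows that `|1 + m|` avoids a fixed value
(`not_mem_gap`). Since `|1 + m|` is continuous in the height of `z` and at least `1/2` at height
`2`, it stays above this value down to height `η`. Hence `m` solves the quadratic equation
`z m² + (z + 1 - p/n) m + 1 = 0` up to `O(ε)`. Its two roots at `z = E` are complex conjugate in
the bulk and real outside it, so the condition `Im m ≥ 0` alone determines `Im m`, and no root has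
to be selected (`abs_im_sub_mpDensity_le`). At the spectral edges the roots merge, and an error
`ε` in the equation becomes `√ε` in the root. This is why `p/n - y` is required to be small compared
with `δ²`.

**Counting.** The number of eigenvalues in an interval differs from the integral of the smoothed
density by at most the sum over the eigenvalues of `η / (|u| + η)`, with `u` the distance to either
endpoint. This weight is in turn bounded by its own average against the Poisson kernel, so these
sums are controlled by the same estimate of the density, at the cost of one logarithm
(`abs_card_sub_integral_le`).

The probabilistic estimate is needed at polynomially many points only, because the resolvents are
Lipschitz continuous in `z` with a polynomial constant (`rowForm_close_of_gridConcentrated`), and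
`T` of order `log p` makes the union bound smaller than any power of `p`.
-/

set_option linter.unusedSectionVars false

/-! ### Bounded laws and exponential moments of linear forms -/

/-- A law on `ℝ` with mean `0` and variance `1` which is supported in `[-K, K]`. -/
structure IsBoundedStandard (ν : Measure ℝ) (K : ℝ) : Prop where
  isProb : IsProbabilityMeasure ν
  bound : ∀ᵐ t ∂ν, |t| ≤ K
  mean : ∫ t, t ∂ν = 0
  second : ∫ t, t ^ 2 ∂ν = 1

theorem IsBoundedStandard.integrable {ν : Measure ℝ} {K : ℝ} (h : IsBoundedStandard ν K)
    {f : ℝ → ℝ} (hf : Continuous f) : Integrable f ν := by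
  have := h.isProb
  obtain ⟨C, hC⟩ := isCompact_Icc.exists_bound_of_continuousOn (s := Set.Icc (-K) K) hf.continuousOn
  refine Integrable.of_bound hf.aestronglyMeasurable C ?_
  filter_upwards [h.bound] with t ht using hC t (abs_le.1 ht)

theorem IsBoundedStandard.one_le {ν : Measure ℝ} {K : ℝ} (h : IsBoundedStandard ν K) :
    1 ≤ K ^ 2 := by
  have := h.isProb
  have h1 : ∫ t, t ^ 2 ∂ν ≤ ∫ _, K ^ 2 ∂ν := by
    refine integral_mono_ae (h.integrable (by fun_prop)) (integrable_const _) ?_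
    filter_upwards [h.bound] with t ht
    exact sq_le_sq' (abs_le.1 ht).1 (abs_le.1 ht).2
  simpa [h.second] using h1

/-- Hoeffding's lemma. -/
theorem IsBoundedStandard.integral_exp_le {ν : Measure ℝ} {K : ℝ} (h : IsBoundedStandard ν K)
    (s : ℝ) : ∫ t, Real.exp (t * s) ∂ν ≤ Real.exp (K ^ 2 / 2 * s ^ 2) := by
  have := h.isProb
  have h1 := hasSubgaussianMGF_of_mem_Icc_of_integral_eq_zero (μ := ν) (X := id) (a := -K) (b := K)
    aemeasurable_id (by filter_upwards [h.bound] with t ht using abs_le.1 ht) h.mean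
  have h2 := h1.mgf_le s
  simp only [mgf, id] at h2
  calc _ = ∫ t, Real.exp (s * t) ∂ν := by simp_rw [mul_comm]
    _ ≤ _ := h2
    _ = _ := by
      congr 1
      have : (((‖K - -K‖₊ / 2) ^ 2 : NNReal) : ℝ) = K ^ 2 := by
        push_cast
        rw [Real.norm_eq_abs, show K - -K = 2 * K by ring, abs_mul]
        rw [div_pow, mul_pow, sq_abs]; norm_num
      rw [this]; ring

section Product

variable {ι : Type*} [Fintype ι] [DecidableEq ι] {ν : ι → Measure ℝ} {K : ℝ}

theorem ae_pi_abs_le (h : ∀ i, IsBoundedStandard (ν i) K) :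
    ∀ᵐ x ∂(Measure.pi ν), ∀ i, |x i| ≤ K := by
  have := fun i => (h i).isProb
  exact ae_all_iff.2 fun i => (Measure.tendsto_eval_ae_ae (μ := ν) (i := i)).eventually (h i).bound

theorem integrable_pi_of_continuous (h : ∀ i, IsBoundedStandard (ν i) K) {f : (ι → ℝ) → ℝ}
    (hf : Continuous f) : Integrable f (Measure.pi ν) := by
  have := fun i => (h i).isProb
  obtain ⟨C, hC⟩ := (isCompact_univ_pi fun _ : ι => isCompact_Icc (a := -K) (b := K)).exists_bound_of_continuousOn
    hf.continuousOn
  refine Integrable.of_bound hf.aestronglyMeasurable C ?_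
  filter_upwards [ae_pi_abs_le h] with x hx
  exact hC x fun i _ => abs_le.1 (hx i)

/-- Hoeffding's lemma for a linear form in the coordinates of `T` whose coefficients are
functions of the other coordinates. -/
theorem integral_exp_linear_le (h : ∀ i, IsBoundedStandard (ν i) K) (T : Finset ι)
    (c : (ι → ℝ) → ι → ℝ) (hc : Continuous c)
    (hdep : ∀ x x', (∀ i ∉ T, x i = x' i) → c x = c x') :
    ∫ x, Real.exp (∑ i ∈ T, x i * c x i) ∂(Measure.pi ν) ≤
      ∫ x, Real.exp (K ^ 2 / 2 * ∑ i ∈ T, c x i ^ 2) ∂(Measure.pi ν) := by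
  have := fun i => (h i).isProb
  let e := MeasurableEquiv.piEquivPiSubtypeProd (fun _ : ι => ℝ) (· ∈ T)
  have he : MeasurePreserving e (Measure.pi ν)
    ((Measure.pi fun i : {i // i ∈ T} => ν i).prod (Measure.pi fun i : {i // i ∉ T} => ν i)) :=
    by convert measurePreserving_piEquivPiSubtypeProd ν (· ∈ T)
  have key : ∀ f : (ι → ℝ) → ℝ, Continuous f → ∫ x, f x ∂(Measure.pi ν) =
      ∫ w, ∫ u, f (e.symm (u, w)) ∂(Measure.pi fun i : {i // i ∈ T} => ν i)
        ∂(Measure.pi fun i : {i // i ∉ T} => ν i) ∧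
      Integrable (fun w => ∫ u, f (e.symm (u, w)) ∂(Measure.pi fun i : {i // i ∈ T} => ν i))
        (Measure.pi fun i : {i // i ∉ T} => ν i) := by
    intro f hf
    have hi := (he.symm e).integrable_comp_emb e.symm.measurableEmbedding (g := f)
    have hi' := hi.2 (integrable_pi_of_continuous h hf)
    refine ⟨?_, hi'.integral_prod_right⟩
    rw [← (he.symm e).integral_comp e.symm.measurableEmbedding]
    exact integral_prod_symm _ hi'
  have hu : ∀ u w (i : {i // i ∈ T}), e.symm (u, w) i = u i := by
    intro u w i
    simp [e, MeasurableEquiv.piEquivPiSubtypeProd, Equiv.piEquivPiSubtypeProd, i.2]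
  have hw : ∀ u w u', c (e.symm (u, w)) = c (e.symm (u', w)) := by
    intro u w u'
    refine hdep _ _ fun i hi => ?_
    simp [e, MeasurableEquiv.piEquivPiSubtypeProd, Equiv.piEquivPiSubtypeProd, hi]
  obtain ⟨k1, k2⟩ := key (fun x => Real.exp (∑ i ∈ T, x i * c x i)) (by fun_prop)
  obtain ⟨k3, k4⟩ := key (fun x => Real.exp (K ^ 2 / 2 * ∑ i ∈ T, c x i ^ 2)) (by fun_prop)
  rw [k1, k3]
  refine integral_mono k2 k4 fun w => ?_
  have e1 : ∀ u, Real.exp (∑ i ∈ T, e.symm (u, w) i * c (e.symm (u, w)) i) =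
      ∏ i : {i // i ∈ T}, Real.exp (u i * c (e.symm (0, w)) i) := by
    intro u
    rw [← Finset.sum_coe_sort T, Real.exp_sum]
    refine Finset.prod_congr rfl fun i _ => ?_
    rw [hu, hw u w 0]
  have e2 : ∀ u, Real.exp (K ^ 2 / 2 * ∑ i ∈ T, c (e.symm (u, w)) i ^ 2) =
      ∏ i : {i // i ∈ T}, Real.exp (K ^ 2 / 2 * c (e.symm (0, w)) i ^ 2) := by
    intro u
    rw [hw u w 0, Finset.mul_sum, ← Finset.sum_coe_sort T, Real.exp_sum]
  simp only [e1, e2]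
  rw [integral_const, probReal_univ, one_smul,
    integral_fintype_prod_eq_prod (μ := fun i : {i // i ∈ T} => ν i)
      (f := fun (i : {i // i ∈ T}) t => Real.exp (t * c (e.symm (0, w)) i))]
  exact Finset.prod_le_prod (fun i _ => integral_nonneg fun t => (Real.exp_pos _).le)
    fun i _ => (h i).integral_exp_le _

end Product

/-! ### Decoupling of off-diagonal forms -/

section Decoupling

variable {ι : Type*} [Fintype ι] [DecidableEq ι]

/-- The vector which agrees with `x` on `S` and vanishes elsewhere. -/
def cutoff (S : Finset ι) (x : ι → ℝ) : ι → ℝ := fun i => if i ∈ S then x i else 0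

/-- The off-diagonal part of the quadratic form of `B`. -/
def offDiagForm (B : Matrix ι ι ℝ) (x : ι → ℝ) : ℝ :=
  ∑ i, ∑ j, if i = j then 0 else B i j * x i * x j

/-- The squared Euclidean norm of `B x`. -/
def sqNormMulVec (B : Matrix ι ι ℝ) (x : ι → ℝ) : ℝ := ∑ i, (B.mulVec x i) ^ 2

@[fun_prop]
theorem continuous_cutoff (S : Finset ι) : Continuous (cutoff S) := by
  refine continuous_pi fun i => ?_
  unfold cutoff
  split_ifs <;> fun_prop

@[fun_prop]
theorem continuous_offDiagForm (B : Matrix ι ι ℝ) : Continuous (offDiagForm B) := by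
  unfold offDiagForm
  refine continuous_finsetSum _ fun i _ => continuous_finsetSum _ fun j _ => ?_
  split_ifs <;> fun_prop

@[fun_prop]
theorem continuous_sqNormMulVec (B : Matrix ι ι ℝ) : Continuous (sqNormMulVec B) := by
  unfold sqNormMulVec Matrix.mulVec dotProduct
  fun_prop

/-- Exactly a quarter of all sets contain `i` but not `j`. -/
theorem four_mul_sum_mem_notMem {i j : ι} (hij : i ≠ j) :
    4 * ∑ T : Finset ι, (if i ∈ T ∧ j ∉ T then (1 : ℝ) else 0) = Fintype.card (Finset ι) := by
  let tog : ι → Finset ι ≃ Finset ι := fun k =>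
    (symmDiff_right_involutive ({k} : Finset ι)).toPerm
  have hm : ∀ k l (T : Finset ι), l ∈ tog k T ↔ (if l = k then l ∉ T else l ∈ T) := by
    intro k l T
    simp only [tog, Function.Involutive.coe_toPerm, Finset.mem_symmDiff, Finset.mem_singleton]
    split_ifs with hl <;> simp [hl]
  have s1 := (tog i).sum_comp (fun T : Finset ι => if i ∈ T ∧ j ∉ T then (1 : ℝ) else 0)
  have s2 := (tog j).sum_comp (fun T : Finset ι => if i ∈ T ∧ j ∉ T then (1 : ℝ) else 0)
  have s3 := ((tog i).sum_comp
    (fun T : Finset ι => if i ∈ tog j T ∧ j ∉ tog j T then (1 : ℝ) else 0)).trans s2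
  calc _ = ∑ T : Finset ι, ((if i ∈ T ∧ j ∉ T then (1 : ℝ) else 0)
        + (if i ∈ tog i T ∧ j ∉ tog i T then (1 : ℝ) else 0)
        + (if i ∈ tog j T ∧ j ∉ tog j T then (1 : ℝ) else 0)
        + (if i ∈ tog j (tog i T) ∧ j ∉ tog j (tog i T) then (1 : ℝ) else 0)) := by
        simp only [Finset.sum_add_distrib]
        rw [s1, s2, s3]; ring
    _ = ∑ T : Finset ι, 1 := by
        refine Finset.sum_congr rfl fun T _ => ?_
        simp only [hm, hij, hij.symm, if_true, if_false]
        by_cases a : i ∈ T <;> by_cases b : j ∈ T <;> simp [a, b]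
    _ = _ := by simp

/-- The off-diagonal form as an average of bilinear forms in `(x_i)_{i ∈ T}` and
`(x_j)_{j ∉ T}`. The factor `4` is the inverse of the proportion of sets `T` which contain `i`
but not `j`. -/
theorem offDiagForm_eq_average (B : Matrix ι ι ℝ) (x : ι → ℝ) :
    offDiagForm B x = ∑ T : Finset ι, (Fintype.card (Finset ι) : ℝ)⁻¹ *
      (4 * ∑ i, ∑ j, if i ∈ T ∧ j ∉ T then B i j * x i * x j else 0) := by
  have hN : (Fintype.card (Finset ι) : ℝ) ≠ 0 := by simp
  rw [← Finset.mul_sum, eq_inv_mul_iff_mul_eq₀ hN, ← Finset.mul_sum, Finset.sum_comm,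
    offDiagForm, Finset.mul_sum, Finset.mul_sum]
  refine Finset.sum_congr rfl fun i _ => ?_
  rw [Finset.sum_comm, Finset.mul_sum, Finset.mul_sum]
  refine Finset.sum_congr rfl fun j _ => ?_
  by_cases hij : i = j
  · subst hij
    simp
  · rw [← four_mul_sum_mem_notMem hij, if_neg hij, mul_assoc, Finset.sum_mul]
    congr 1
    refine Finset.sum_congr rfl fun T _ => ?_
    split_ifs <;> ring

variable {ν : ι → Measure ℝ} {K : ℝ}

/-- **Decoupling.** The exponential moments of an off-diagonal form are controlled by those of
the squared norms `‖B x_U‖²`. The off-diagonal form is an average over sets `T` of bilinear forms in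
the two independent halves `(x_i)_{i ∈ T}` and `(x_j)_{j ∉ T}`, and Hoeffding's lemma integrates
the first half out. -/
theorem integral_exp_offDiagForm_cutoff_le (h : ∀ i, IsBoundedStandard (ν i) K)
    (B : Matrix ι ι ℝ) (l M : ℝ) (S : Finset ι)
    (hM : ∀ U : Finset ι,
      ∫ x, Real.exp (8 * l ^ 2 * K ^ 2 * sqNormMulVec B (cutoff U x)) ∂(Measure.pi ν) ≤ M) :
    ∫ x, Real.exp (l * offDiagForm B (cutoff S x)) ∂(Measure.pi ν) ≤ M := by
  set N : ℝ := (Fintype.card (Finset ι) : ℝ) with hN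
  have hN0 : 0 < N := by rw [hN]; exact_mod_cast Fintype.card_pos
  let Q : Finset ι → (ι → ℝ) → ℝ := fun T x =>
    ∑ i ∈ T ∩ S, x i * (4 * l * B.mulVec (cutoff (S \ T) x) i)
  have hQ : ∀ x, l * offDiagForm B (cutoff S x) = ∑ T, N⁻¹ * Q T x := by
    intro x
    rw [offDiagForm_eq_average, Finset.mul_sum]
    refine Finset.sum_congr rfl fun T _ => ?_
    rw [mul_left_comm]
    congr 1
    simp only [Q]
    rw [show T ∩ S = Finset.univ.filter (fun i => i ∈ T ∧ i ∈ S) by ext; simp, Finset.sum_filter,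
      ← mul_assoc, Finset.mul_sum]
    refine Finset.sum_congr rfl fun i _ => ?_
    by_cases hi : i ∈ T ∧ i ∈ S
    · rw [if_pos hi, Matrix.mulVec, dotProduct, Finset.mul_sum, Finset.mul_sum, Finset.mul_sum]
      refine Finset.sum_congr rfl fun j _ => ?_
      by_cases hj : j ∈ T <;> by_cases hj' : j ∈ S <;> simp [cutoff, hi.1, hi.2, hj, hj']
      ring
    · rw [if_neg hi]
      convert mul_zero _
      refine Finset.sum_eq_zero fun j _ => ?_
      by_cases hiT : i ∈ T
      · have : i ∉ S := fun hS => hi ⟨hiT, hS⟩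
        simp [cutoff, this]
      · simp [hiT]
  have hcont : ∀ T, Continuous (Q T) := by
    intro T
    simp only [Q, Matrix.mulVec, dotProduct]
    fun_prop
  have hT : ∀ T, ∫ x, Real.exp (Q T x) ∂(Measure.pi ν) ≤ M := by
    intro T
    refine (integral_exp_linear_le h (T ∩ S)
      (fun x i => 4 * l * B.mulVec (cutoff (S \ T) x) i) ?_ ?_).trans
      (le_trans (integral_mono (integrable_pi_of_continuous h ?_)
        (integrable_pi_of_continuous h ?_) fun x => ?_) (hM (S \ T)))
    · simp only [Matrix.mulVec, dotProduct]
      fun_prop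
    · intro x x' hx
      have : cutoff (S \ T) x = cutoff (S \ T) x' := by
        funext j
        unfold cutoff
        split_ifs with hj
        · exact hx j (by simp at hj ⊢; tauto)
        · rfl
      rw [this]
    · simp only [Matrix.mulVec, dotProduct]
      fun_prop
    · fun_prop
    · refine Real.exp_le_exp.2 ?_
      simp only [sqNormMulVec, mul_pow, ← Finset.mul_sum]
      have : ∑ i ∈ T ∩ S, B.mulVec (cutoff (S \ T) x) i ^ 2 ≤
          ∑ i, B.mulVec (cutoff (S \ T) x) i ^ 2 :=
        Finset.sum_le_sum_of_subset_of_nonneg (Finset.subset_univ _) fun _ _ _ => sq_nonneg _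
      nlinarith [mul_le_mul_of_nonneg_left this (mul_nonneg (sq_nonneg l) (sq_nonneg K))]
  have hle : ∀ x, Real.exp (l * offDiagForm B (cutoff S x)) ≤ ∑ T, N⁻¹ * Real.exp (Q T x) := by
    intro x
    rw [hQ]
    have := convexOn_exp.map_sum_le (t := Finset.univ) (w := fun _ : Finset ι => N⁻¹)
      (p := fun T => Q T x) (fun _ _ => by positivity)
      (by simp [hN]) (fun _ _ => Set.mem_univ _)
    simpa using this
  calc _ ≤ ∫ x, ∑ T, N⁻¹ * Real.exp (Q T x) ∂(Measure.pi ν) :=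
        integral_mono (integrable_pi_of_continuous h (by fun_prop))
          (integrable_pi_of_continuous h (by fun_prop)) hle
    _ = ∑ T, N⁻¹ * ∫ x, Real.exp (Q T x) ∂(Measure.pi ν) := by
        rw [integral_finsetSum _ fun T _ => integrable_pi_of_continuous h (by fun_prop)]
        simp_rw [integral_const_mul]
    _ ≤ ∑ _T : Finset ι, N⁻¹ * M := by gcongr with T _; exact hT T
    _ = M := by
        simp only [Finset.sum_const, Finset.card_univ, nsmul_eq_mul, ← hN]
        field_simp

end Decoupling

/-! ### Concentration of quadratic forms -/

section QuadraticForms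

variable {ι : Type*} [Fintype ι] [DecidableEq ι] {ν : ι → Measure ℝ} {K : ℝ}

theorem dotProduct_mulVec_eq_diag_add_offDiagForm (B : Matrix ι ι ℝ) (x : ι → ℝ) :
    x ⬝ᵥ B.mulVec x = ∑ i, B i i * x i ^ 2 + offDiagForm B x := by
  rw [offDiagForm, ← Finset.sum_add_distrib]
  simp only [dotProduct, Matrix.mulVec]
  refine Finset.sum_congr rfl fun i _ => ?_
  rw [← Finset.add_sum_erase _ _ (Finset.mem_univ i),
    ← Finset.add_sum_erase (a := i) _ (fun j => if i = j then 0 else B i j * x i * x j) (Finset.mem_univ i),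
    mul_add, Finset.mul_sum]
  simp only [if_true, zero_add]
  congr 1
  · ring
  · refine Finset.sum_congr rfl fun j hj => ?_
    rw [if_neg (Finset.ne_of_mem_erase hj).symm]
    ring

theorem integral_exp_sum_pi_le (h : ∀ i, IsBoundedStandard (ν i) K) (g : ι → ℝ → ℝ) (b : ι → ℝ)
    (hb : ∀ i, ∫ t, Real.exp (g i t) ∂(ν i) ≤ Real.exp (b i)) :
    ∫ x, Real.exp (∑ i, g i (x i)) ∂(Measure.pi ν) ≤ Real.exp (∑ i, b i) := by
  have := fun i => (h i).isProb
  simp_rw [Real.exp_sum]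
  rw [integral_fintype_prod_eq_prod (f := fun i t => Real.exp (g i t))]
  exact Finset.prod_le_prod (fun i _ => integral_nonneg fun t => (Real.exp_pos _).le)
    fun i _ => hb i

/-- Exponential moments of a nonnegative diagonal form. -/
theorem integral_exp_diag_cutoff_le (h : ∀ i, IsBoundedStandard (ν i) K) (S : Finset ι)
    (b : ι → ℝ) (t : ℝ) (hb : ∀ i, 0 ≤ t * b i) (hb' : ∀ i, t * b i * K ^ 2 ≤ 1) :
    ∫ x, Real.exp (t * ∑ i, b i * cutoff S x i ^ 2) ∂(Measure.pi ν) ≤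
      Real.exp (2 * t * ∑ i, b i) := by
  simp_rw [Finset.mul_sum]
  refine integral_exp_sum_pi_le h (fun i s => t * (b i * (if i ∈ S then s else 0) ^ 2)) _ fun i => ?_
  have := (h i).isProb
  by_cases hi : i ∈ S
  · simp only [hi, if_true]
    have h1 : ∫ s, Real.exp (t * (b i * s ^ 2)) ∂(ν i) ≤ ∫ s, (1 + 2 * (t * b i) * s ^ 2) ∂(ν i) := by
      refine integral_mono_ae ((h i).integrable (by fun_prop)) ((h i).integrable (by fun_prop)) ?_
      filter_upwards [(h i).bound] with s hs
      have hs2 : s ^ 2 ≤ K ^ 2 := sq_le_sq' (abs_le.1 hs).1 (abs_le.1 hs).2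
      have h0 : 0 ≤ t * b i * s ^ 2 := mul_nonneg (hb i) (sq_nonneg s)
      have h1 : t * b i * s ^ 2 ≤ 1 :=
        (mul_le_mul_of_nonneg_left hs2 (hb i)).trans (hb' i)
      have h3 := (abs_le.1 (Real.abs_exp_sub_one_sub_id_le (x := t * b i * s ^ 2)
        (by rw [abs_of_nonneg h0]; exact h1))).2
      rw [show t * (b i * s ^ 2) = t * b i * s ^ 2 by ring]
      nlinarith
    rw [integral_add (integrable_const _) ((h i).integrable (by fun_prop)), integral_const_mul,
      (h i).second] at h1
    simp only [integral_const, probReal_univ, smul_eq_mul, mul_one] at h1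
    refine h1.trans ?_
    have := Real.add_one_le_exp (2 * t * b i)
    linarith
  · simp only [hi, if_false]
    simp only [ne_eq, OfNat.ofNat_ne_zero, not_false_eq_true, zero_pow, mul_zero, Real.exp_zero,
      integral_const, probReal_univ, smul_eq_mul, mul_one]
    rw [Real.one_le_exp_iff]
    nlinarith [hb i]

/-- Exponential moments of the off-diagonal part of a positive semidefinite form, with the
off-diagonal variance proxy `K² β tr B`. By decoupling they are bounded by exponential moments of
`‖B x_U‖² ≤ β ⟨x_U, B x_U⟩`, whose off-diagonal part enters with a smaller exponent, so that the
largest such moment `M` over all cutoffs satisfies `M ≤ (D + M) / 2`. -/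
theorem integral_exp_offDiagForm_posSemidef_le (h : ∀ i, IsBoundedStandard (ν i) K)
    (hK : 0 < K) (B : Matrix ι ι ℝ) {β : ℝ} (hβ : 0 < β)
    (hB : ∀ v, sqNormMulVec B v ≤ β * (v ⬝ᵥ B.mulVec v)) {l : ℝ} (hl : 0 ≤ l)
    (hl' : l * (16 * K ^ 2 * β) ≤ 1) (S : Finset ι) :
    ∫ x, Real.exp (l * offDiagForm B (cutoff S x)) ∂(Measure.pi ν) ≤
      Real.exp (32 * l ^ 2 * K ^ 2 * β * B.trace) := by
  have := fun i => (h i).isProb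
  have hdiag : ∀ i, B i i ^ 2 ≤ β * B i i := by
    intro i
    have h1 := hB (Pi.single i 1)
    simp only [sqNormMulVec, Matrix.mulVec_single_one, single_dotProduct, one_mul, Matrix.col_apply] at h1
    exact (Finset.single_le_sum (f := fun k => B k i ^ 2) (fun _ _ => sq_nonneg _)
      (Finset.mem_univ i)).trans h1
  have hd0 : ∀ i, 0 ≤ B i i := fun i => by
    by_contra hneg
    nlinarith [hdiag i, sq_nonneg (B i i), not_le.1 hneg]
  have hd1 : ∀ i, B i i ≤ β := fun i => by
    by_contra hneg
    nlinarith [hdiag i, hd0 i, not_le.1 hneg]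
  -- the factor by which one round of decoupling contracts the exponent `l`
  set θ : ℝ := 16 * l * K ^ 2 * β with hθ
  have hθ0 : 0 ≤ θ := by positivity
  have hθ1 : θ ≤ 1 := by rw [hθ]; linarith
  set D : ℝ := Real.exp (32 * l ^ 2 * K ^ 2 * β * B.trace) with hD
  have hD1 : 1 ≤ D := by
    rw [hD, Real.one_le_exp_iff]
    have : 0 ≤ B.trace := Finset.sum_nonneg fun i _ => hd0 i
    positivity
  let Φ : Finset ι → ℝ := fun U =>
    ∫ x, Real.exp (l * offDiagForm B (cutoff U x)) ∂(Measure.pi ν)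
  obtain ⟨U₀, -, hU₀⟩ := Finset.exists_max_image (Finset.univ : Finset (Finset ι)) Φ
    Finset.univ_nonempty
  set M : ℝ := max 1 (Φ U₀) with hMdef
  have hΦM : ∀ U, Φ U ≤ M := fun U => (hU₀ U (Finset.mem_univ U)).trans (le_max_right _ _)
  have hM1 : 1 ≤ M := le_max_left _ _
  have step : ∀ U : Finset ι,
      ∫ x, Real.exp (8 * l ^ 2 * K ^ 2 * sqNormMulVec B (cutoff U x)) ∂(Measure.pi ν) ≤
        (D + M) / 2 := by
    intro U
    have hd : ∫ x, Real.exp (l * θ * ∑ i, B i i * cutoff U x i ^ 2) ∂(Measure.pi ν) ≤ D := by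
      refine (integral_exp_diag_cutoff_le h U (fun i => B i i) (l * θ)
        (fun i => mul_nonneg (mul_nonneg hl hθ0) (hd0 i)) fun i => ?_).trans ?_
      · have h1 : l * θ * B i i * K ^ 2 ≤ l * 1 * β * K ^ 2 := by
          gcongr
          · exact hd0 i
          · exact hd1 i
        have : 0 ≤ l * K ^ 2 * β := by positivity
        nlinarith
      · rw [hD]
        refine le_of_eq ?_
        congr 1
        rw [hθ, Matrix.trace]
        simp only [Matrix.diag]
        ring
    calc _ ≤ ∫ x, (Real.exp (l * θ * ∑ i, B i i * cutoff U x i ^ 2) +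
            (θ * Real.exp (l * offDiagForm B (cutoff U x)) + (1 - θ))) / 2 ∂(Measure.pi ν) := by
          refine integral_mono (integrable_pi_of_continuous h (by fun_prop))
            (integrable_pi_of_continuous h (by fun_prop)) fun x => ?_
          set d := ∑ i, B i i * cutoff U x i ^ 2 with hdd
          set o := offDiagForm B (cutoff U x) with ho
          have h1 : 8 * l ^ 2 * K ^ 2 * sqNormMulVec B (cutoff U x) ≤
              l * θ * d / 2 + θ * (l * o) / 2 := by
            have h2 := hB (cutoff U x)
            rw [dotProduct_mulVec_eq_diag_add_offDiagForm] at h2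
            have := mul_le_mul_of_nonneg_left h2 (show 0 ≤ 8 * l ^ 2 * K ^ 2 by positivity)
            rw [hθ]
            linarith
          have h3 : Real.exp (θ * (l * o)) ≤ θ * Real.exp (l * o) + (1 - θ) := by
            have := convexOn_exp.2 (Set.mem_univ (l * o)) (Set.mem_univ 0) hθ0
              (sub_nonneg.2 hθ1) (by ring)
            simpa using this
          have h4 : Real.exp (l * θ * d / 2 + θ * (l * o) / 2) ≤
              (Real.exp (l * θ * d) + Real.exp (θ * (l * o))) / 2 := by
            have := convexOn_exp.2 (Set.mem_univ (l * θ * d)) (Set.mem_univ (θ * (l * o)))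
              (show (0 : ℝ) ≤ 1 / 2 by norm_num) (show (0 : ℝ) ≤ 1 / 2 by norm_num) (by norm_num)
            simp only [smul_eq_mul] at this
            calc _ = Real.exp (1 / 2 * (l * θ * d) + 1 / 2 * (θ * (l * o))) := by ring_nf
              _ ≤ _ := this
              _ = _ := by ring
          exact (Real.exp_le_exp.2 h1).trans (h4.trans (by linarith))
      _ = (∫ x, Real.exp (l * θ * ∑ i, B i i * cutoff U x i ^ 2) ∂(Measure.pi ν) +
            (θ * Φ U + (1 - θ))) / 2 := by
          rw [integral_div, integral_add (integrable_pi_of_continuous h (by fun_prop))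
            (integrable_pi_of_continuous h (by fun_prop)),
            integral_add (integrable_pi_of_continuous h (by fun_prop)) (integrable_const _),
            integral_const_mul]
          simp [Φ]
      _ ≤ (D + M) / 2 := by
          have : θ * Φ U ≤ θ * M := mul_le_mul_of_nonneg_left (hΦM U) hθ0
          nlinarith
  have hfin : Φ U₀ ≤ (D + M) / 2 := integral_exp_offDiagForm_cutoff_le h B l _ U₀ step
  have hMD : M ≤ D := by
    rcases max_choice 1 (Φ U₀) with h1 | h1
    · rw [hMdef, h1]; exact hD1
    · have : M = Φ U₀ := by rw [hMdef, h1]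
      linarith
  exact (hΦM S).trans hMD

/-- The squared Frobenius norm of a real matrix. -/
def frobSq (B : Matrix ι ι ℝ) : ℝ := ∑ i, ∑ j, B i j ^ 2

theorem frobSq_nonneg (B : Matrix ι ι ℝ) : 0 ≤ frobSq B :=
  Finset.sum_nonneg fun _ _ => Finset.sum_nonneg fun _ _ => sq_nonneg _

theorem trace_mul_self_of_isSymm {B : Matrix ι ι ℝ} (hs : B.IsSymm) : (B * B).trace = frobSq B := by
  simp only [Matrix.trace, Matrix.diag, Matrix.mul_apply, frobSq]
  refine Finset.sum_congr rfl fun i _ => Finset.sum_congr rfl fun j _ => ?_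
  rw [hs.apply i j, sq]

theorem dotProduct_mul_self_mulVec {B : Matrix ι ι ℝ} (hs : B.IsSymm) (v : ι → ℝ) :
    v ⬝ᵥ (B * B).mulVec v = sqNormMulVec B v := by
  rw [← Matrix.mulVec_mulVec, Matrix.dotProduct_mulVec, ← Matrix.mulVec_transpose, hs.eq]
  simp [dotProduct, sqNormMulVec, sq]

/-- Exponential moments of the off-diagonal part of a symmetric form: decoupling, followed by the
bound for the positive semidefinite form of `B²`. -/
theorem integral_exp_offDiagForm_le (h : ∀ i, IsBoundedStandard (ν i) K)
    (hK : 0 < K) {B : Matrix ι ι ℝ} (hs : B.IsSymm) {β : ℝ} (hβ : 0 < β)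
    (hB : ∀ v, sqNormMulVec B v ≤ β ^ 2 * ∑ i, v i ^ 2) {l : ℝ}
    (hl : |l| * (16 * K ^ 2 * β) ≤ 1) :
    ∫ x, Real.exp (l * offDiagForm B x) ∂(Measure.pi ν) ≤
      Real.exp (32 * l ^ 2 * K ^ 2 * frobSq B) := by
  have := fun i => (h i).isProb
  have hcut : ∀ x : ι → ℝ, cutoff Finset.univ x = x := fun x => by funext i; simp [cutoff]
  have key := integral_exp_offDiagForm_cutoff_le h B l (Real.exp (32 * l ^ 2 * K ^ 2 * frobSq B))
    Finset.univ
  simp only [hcut] at key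
  refine key fun U => ?_
  set m : ℝ := 8 * l ^ 2 * K ^ 2 with hm
  have hm0 : 0 ≤ m := by positivity
  have hl2 : l ^ 2 * (16 * K ^ 2 * β) ^ 2 ≤ 1 := by
    have h1 : (|l| * (16 * K ^ 2 * β)) ^ 2 ≤ 1 := pow_le_one₀ (by positivity) hl
    rwa [mul_pow, sq_abs] at h1
  have hm1 : 2 * m * (16 * K ^ 2 * β ^ 2) ≤ 1 := by rw [hm]; nlinarith
  have hC : ∀ v, sqNormMulVec (B * B) v ≤ β ^ 2 * (v ⬝ᵥ (B * B).mulVec v) := by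
    intro v
    rw [dotProduct_mul_self_mulVec hs]
    have := hB (B.mulVec v)
    simp only [sqNormMulVec, Matrix.mulVec_mulVec] at this ⊢
    exact this
  have hdiag0 : ∀ i, 0 ≤ (B * B) i i := by
    intro i
    rw [Matrix.mul_apply]
    exact Finset.sum_nonneg fun j _ => by rw [hs.apply j i]; exact mul_self_nonneg _
  have hdiag1 : ∀ i, (B * B) i i ≤ β ^ 2 := by
    intro i
    have h1 := hB (Pi.single i 1)
    simp only [sqNormMulVec, Matrix.mulVec_single_one, Matrix.col_apply] at h1
    rw [Matrix.mul_apply]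
    calc _ = ∑ j, B j i ^ 2 := Finset.sum_congr rfl fun j _ => by rw [hs.apply j i, sq]
      _ ≤ _ := h1
      _ = β ^ 2 := by
        rw [Finset.sum_eq_single i]
        · simp
        · intro j _ hj; simp [hj]
        · simp
  have ho := integral_exp_offDiagForm_posSemidef_le h hK (B * B) (β := β ^ 2) (by positivity) hC
    (l := 2 * m) (by positivity) hm1 U
  have hd := integral_exp_diag_cutoff_le h U (fun i => (B * B) i i) (2 * m)
    (fun i => mul_nonneg (by positivity) (hdiag0 i)) (fun i => by
      have : 2 * m * (B * B) i i * K ^ 2 ≤ 2 * m * β ^ 2 * K ^ 2 := by gcongr; exact hdiag1 i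
      nlinarith [show 0 ≤ 2 * m * β ^ 2 * K ^ 2 by positivity])
  have htr : ∑ i, (B * B) i i = frobSq B := trace_mul_self_of_isSymm hs
  rw [trace_mul_self_of_isSymm hs] at ho
  rw [htr] at hd
  have hF := frobSq_nonneg B
  have e1 : Real.exp (32 * (2 * m) ^ 2 * K ^ 2 * β ^ 2 * frobSq B) ≤
      Real.exp (4 * m * frobSq B) := by
    refine Real.exp_le_exp.2 (mul_le_mul_of_nonneg_right ?_ hF)
    nlinarith
  have e2 : Real.exp (2 * (2 * m) * frobSq B) = Real.exp (4 * m * frobSq B) := by ring_nf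
  have e3 : Real.exp (4 * m * frobSq B) = Real.exp (32 * l ^ 2 * K ^ 2 * frobSq B) := by
    rw [hm]; ring_nf
  calc _ ≤ ∫ x, (Real.exp (2 * m * ∑ i, (B * B) i i * cutoff U x i ^ 2) +
          Real.exp (2 * m * offDiagForm (B * B) (cutoff U x))) / 2 ∂(Measure.pi ν) := by
        refine integral_mono (integrable_pi_of_continuous h (by fun_prop))
          (integrable_pi_of_continuous h (by fun_prop)) fun x => ?_
        rw [← dotProduct_mul_self_mulVec hs, dotProduct_mulVec_eq_diag_add_offDiagForm]
        set d := ∑ i, (B * B) i i * cutoff U x i ^ 2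
        set o := offDiagForm (B * B) (cutoff U x)
        have := convexOn_exp.2 (Set.mem_univ (2 * m * d)) (Set.mem_univ (2 * m * o))
          (show (0 : ℝ) ≤ 1 / 2 by norm_num) (show (0 : ℝ) ≤ 1 / 2 by norm_num) (by norm_num)
        simp only [smul_eq_mul] at this
        calc _ = Real.exp (1 / 2 * (2 * m * d) + 1 / 2 * (2 * m * o)) := by ring_nf
          _ ≤ _ := this
          _ = _ := by ring
    _ = (∫ x, Real.exp (2 * m * ∑ i, (B * B) i i * cutoff U x i ^ 2) ∂(Measure.pi ν) +
          ∫ x, Real.exp (2 * m * offDiagForm (B * B) (cutoff U x)) ∂(Measure.pi ν)) / 2 := by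
        rw [integral_div, integral_add (integrable_pi_of_continuous h (by fun_prop))
            (integrable_pi_of_continuous h (by fun_prop))]
    _ ≤ _ := by linarith

/-- Exponential moments of a centred diagonal form; its variance proxy is `K² ∑ b_i²`, since
`E (t² - 1)² ≤ K²`. -/
theorem integral_exp_centered_diag_le (h : ∀ i, IsBoundedStandard (ν i) K)
    (b : ι → ℝ) (l : ℝ) (hb : ∀ i, |l * b i| * K ^ 2 ≤ 1) :
    ∫ x, Real.exp (l * ∑ i, b i * (x i ^ 2 - 1)) ∂(Measure.pi ν) ≤
      Real.exp (l ^ 2 * K ^ 2 * ∑ i, b i ^ 2) := by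
  simp_rw [Finset.mul_sum]
  refine integral_exp_sum_pi_le h (fun i s => l * (b i * (s ^ 2 - 1))) _ fun i => ?_
  have := (h i).isProb
  have hK1 := (h i).one_le
  have h1 : ∫ s, Real.exp (l * (b i * (s ^ 2 - 1))) ∂(ν i) ≤
      ∫ s, (1 - l * b i + (l * b i) ^ 2 +
        (l * b i + (l * b i) ^ 2 * (K ^ 2 - 2)) * s ^ 2) ∂(ν i) := by
    refine integral_mono_ae ((h i).integrable (by fun_prop)) ((h i).integrable (by fun_prop)) ?_
    filter_upwards [(h i).bound] with s hs
    have hs2 : s ^ 2 ≤ K ^ 2 := sq_le_sq' (abs_le.1 hs).1 (abs_le.1 hs).2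
    have hs3 : |s ^ 2 - 1| ≤ K ^ 2 := abs_le.2 ⟨by nlinarith [sq_nonneg s], by linarith⟩
    set u := l * (b i * (s ^ 2 - 1)) with hu
    have hu1 : |u| ≤ 1 := by
      rw [hu, ← mul_assoc, abs_mul]
      exact (mul_le_mul_of_nonneg_left hs3 (abs_nonneg _)).trans (hb i)
    have h3 := (abs_le.1 (Real.abs_exp_sub_one_sub_id_le hu1)).2
    have h4 : u ^ 2 ≤ (l * b i) ^ 2 * (1 + (K ^ 2 - 2) * s ^ 2) := by
      rw [hu, ← mul_assoc, mul_pow]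
      refine mul_le_mul_of_nonneg_left ?_ (sq_nonneg _)
      nlinarith [sq_nonneg s]
    have h5 : u = l * b i * s ^ 2 - l * b i := by rw [hu]; ring
    linarith
  rw [integral_add (integrable_const _) ((h i).integrable (by fun_prop)), integral_const_mul,
    (h i).second] at h1
  simp only [integral_const, probReal_univ, smul_eq_mul, mul_one] at h1
  refine h1.trans ?_
  have := Real.add_one_le_exp (l ^ 2 * K ^ 2 * b i ^ 2)
  nlinarith [sq_nonneg (l * b i)]

/-- Exponential moments of a centred quadratic form. The diagonal and the off-diagonal part are
separated by convexity of the exponential, which doubles the exponent. -/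
theorem integral_exp_quadForm_le (h : ∀ i, IsBoundedStandard (ν i) K)
    (hK : 0 < K) {B : Matrix ι ι ℝ} (hs : B.IsSymm) {β : ℝ} (hβ : 0 < β)
    (hB : ∀ v, sqNormMulVec B v ≤ β ^ 2 * ∑ i, v i ^ 2) {l : ℝ}
    (hl : |l| * (32 * K ^ 2 * β) ≤ 1) :
    ∫ x, Real.exp (l * (x ⬝ᵥ B.mulVec x - B.trace)) ∂(Measure.pi ν) ≤
      Real.exp (128 * l ^ 2 * K ^ 2 * frobSq B) := by
  have hdiag : ∀ i, |B i i| ≤ β := by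
    intro i
    have h1 := hB (Pi.single i 1)
    simp only [sqNormMulVec, Matrix.mulVec_single_one, Matrix.col_apply] at h1
    refine abs_le_of_sq_le_sq ?_ hβ.le
    refine (Finset.single_le_sum (f := fun k => B k i ^ 2) (fun _ _ => sq_nonneg _)
      (Finset.mem_univ i)).trans (h1.trans (le_of_eq ?_))
    rw [Finset.sum_eq_single i]
    · simp
    · intro j _ hj; simp [hj]
    · simp
  have hl2 : |2 * l| * (16 * K ^ 2 * β) ≤ 1 := by rw [abs_mul, abs_two]; linarith
  have ho := integral_exp_offDiagForm_le h hK hs hβ hB hl2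
  have hd := integral_exp_centered_diag_le h (fun i => B i i) (2 * l) fun i => by
    have : |2 * l * B i i| * K ^ 2 ≤ |2 * l| * β * K ^ 2 := by
      rw [abs_mul]; gcongr; exact hdiag i
    nlinarith [show 0 ≤ |2 * l| * β * K ^ 2 by positivity]
  have hF : ∑ i, B i i ^ 2 ≤ frobSq B := Finset.sum_le_sum fun i _ =>
    Finset.single_le_sum (f := fun j => B i j ^ 2) (fun _ _ => sq_nonneg _) (Finset.mem_univ i)
  have hF0 := frobSq_nonneg B
  have e1 : Real.exp ((2 * l) ^ 2 * K ^ 2 * ∑ i, B i i ^ 2) ≤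
      Real.exp (128 * l ^ 2 * K ^ 2 * frobSq B) := by
    refine Real.exp_le_exp.2 ?_
    have := mul_le_mul_of_nonneg_left hF (show 0 ≤ l ^ 2 * K ^ 2 by positivity)
    nlinarith [mul_nonneg (show 0 ≤ l ^ 2 * K ^ 2 by positivity) hF0]
  have e2 : Real.exp (32 * (2 * l) ^ 2 * K ^ 2 * frobSq B) =
      Real.exp (128 * l ^ 2 * K ^ 2 * frobSq B) := by ring_nf
  calc _ ≤ ∫ x, (Real.exp (2 * l * ∑ i, B i i * (x i ^ 2 - 1)) +
          Real.exp (2 * l * offDiagForm B x)) / 2 ∂(Measure.pi ν) := by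
        refine integral_mono (integrable_pi_of_continuous h ?_)
          (integrable_pi_of_continuous h (by fun_prop)) fun x => ?_
        · simp only [Matrix.mulVec, dotProduct]; fun_prop
        have ht : x ⬝ᵥ B.mulVec x - B.trace = ∑ i, B i i * (x i ^ 2 - 1) + offDiagForm B x := by
          rw [dotProduct_mulVec_eq_diag_add_offDiagForm, Matrix.trace]
          simp only [mul_sub, Finset.sum_sub_distrib, mul_one, Matrix.diag]
          ring
        rw [ht]
        set d := ∑ i, B i i * (x i ^ 2 - 1)
        set o := offDiagForm B x
        have := convexOn_exp.2 (Set.mem_univ (2 * l * d)) (Set.mem_univ (2 * l * o))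
          (show (0 : ℝ) ≤ 1 / 2 by norm_num) (show (0 : ℝ) ≤ 1 / 2 by norm_num) (by norm_num)
        simp only [smul_eq_mul] at this
        calc _ = Real.exp (1 / 2 * (2 * l * d) + 1 / 2 * (2 * l * o)) := by ring_nf
          _ ≤ _ := this
          _ = _ := by ring
    _ = (∫ x, Real.exp (2 * l * ∑ i, B i i * (x i ^ 2 - 1)) ∂(Measure.pi ν) +
          ∫ x, Real.exp (2 * l * offDiagForm B x) ∂(Measure.pi ν)) / 2 := by
        rw [integral_div, integral_add (integrable_pi_of_continuous h (by fun_prop))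
            (integrable_pi_of_continuous h (by fun_prop))]
    _ ≤ _ := by linarith

/-- **Hanson–Wright inequality** with the scale `K ‖B‖_F + K² ‖B‖`. The dependence on `K` is what
the unit variance allows: the variance of the form is at most of order `K² ‖B‖_F²`, rather than
`K⁴ ‖B‖_F²`. -/
theorem measureReal_quadForm_le (h : ∀ i, IsBoundedStandard (ν i) K)
    (hK : 0 < K) {B : Matrix ι ι ℝ} (hs : B.IsSymm) {β : ℝ} (hβ : 0 < β)
    (hB : ∀ v, sqNormMulVec B v ≤ β ^ 2 * ∑ i, v i ^ 2) {F : ℝ} (hF : 0 ≤ F)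
    (hBF : frobSq B ≤ F ^ 2) (T : ℝ) :
    (Measure.pi ν).real {x | 32 * T * (K * F + K ^ 2 * β) ≤ |x ⬝ᵥ B.mulVec x - B.trace|} ≤
      3 * Real.exp (-T) := by
  have := fun i => (h i).isProb
  set R := K * F + K ^ 2 * β with hR
  have hR0 : 0 < R := by positivity
  have hcont : Continuous fun x : ι → ℝ => x ⬝ᵥ B.mulVec x - B.trace := by
    simp only [Matrix.mulVec, dotProduct]; fun_prop
  -- one half of the two-sided bound, for either sign of the exponent
  have one : ∀ σ : ℝ, |σ| = 1 →
      (Measure.pi ν).real {x | 32 * T * R ≤ σ * (x ⬝ᵥ B.mulVec x - B.trace)} ≤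
        3 / 2 * Real.exp (-T) := by
    intro σ hσ
    have hσ2 : σ ^ 2 = 1 := by rw [← sq_abs, hσ, one_pow]
    have hl : |σ / (32 * R)| * (32 * K ^ 2 * β) ≤ 1 := by
      rw [abs_div, hσ, abs_of_pos (show 0 < 32 * R by positivity), one_div, inv_mul_le_one₀ (by positivity)]
      have : 0 ≤ K * F := by positivity
      rw [hR]; linarith
    have hE := integral_exp_quadForm_le h hK hs hβ hB hl
    have hM := mul_meas_ge_le_integral_of_nonneg (μ := Measure.pi ν)
      (f := fun x => Real.exp (σ / (32 * R) * (x ⬝ᵥ B.mulVec x - B.trace)))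
      (Eventually.of_forall fun x => (Real.exp_pos _).le)
      (integrable_pi_of_continuous h (by fun_prop)) (Real.exp T)
    have hset : {x : ι → ℝ | Real.exp T ≤ Real.exp (σ / (32 * R) * (x ⬝ᵥ B.mulVec x - B.trace))} =
        {x | 32 * T * R ≤ σ * (x ⬝ᵥ B.mulVec x - B.trace)} := by
      ext x
      simp only [Set.mem_ofPred_eq, Real.exp_le_exp]
      rw [div_mul_eq_mul_div, le_div_iff₀ (by positivity)]
      constructor <;> intro h <;> linarith
    rw [hset] at hM
    have h2 : Real.exp (128 * (σ / (32 * R)) ^ 2 * K ^ 2 * frobSq B) ≤ 3 / 2 := by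
      have h3 : 128 * (σ / (32 * R)) ^ 2 * K ^ 2 * frobSq B ≤ 1 / 8 := by
        rw [div_pow, hσ2]
        have h4 : K ^ 2 * frobSq B ≤ R ^ 2 := by
          calc K ^ 2 * frobSq B ≤ K ^ 2 * F ^ 2 := by gcongr
            _ = (K * F) ^ 2 := by ring
            _ ≤ R ^ 2 := by
              refine pow_le_pow_left₀ (by positivity) ?_ 2
              rw [hR]; have : 0 ≤ K ^ 2 * β := by positivity
              linarith
        calc _ = 1 / 8 * (K ^ 2 * frobSq B) / R ^ 2 := by field_simp; ring
          _ ≤ 1 / 8 := by rw [div_le_iff₀ (by positivity)]; linarith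
      refine (Real.exp_le_exp.2 h3).trans ?_
      have := (abs_le.1 (Real.abs_exp_sub_one_sub_id_le (x := 1 / 8) (by norm_num [abs_le]))).2
      linarith
    rw [Real.exp_neg]
    have hT := Real.exp_pos T
    rw [← div_eq_mul_inv, le_div_iff₀ hT, mul_comm]
    linarith
  have hsub : {x : ι → ℝ | 32 * T * R ≤ |x ⬝ᵥ B.mulVec x - B.trace|} ⊆
      {x | 32 * T * R ≤ 1 * (x ⬝ᵥ B.mulVec x - B.trace)} ∪
      {x | 32 * T * R ≤ (-1) * (x ⬝ᵥ B.mulVec x - B.trace)} := by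
    intro x hx
    simp only [Set.mem_ofPred_eq, Set.mem_union] at hx ⊢
    rcases le_abs.1 hx with h1 | h1
    · left; linarith
    · right; linarith
  calc _ ≤ _ := measureReal_mono hsub
    _ ≤ _ := measureReal_union_le _ _
    _ ≤ 3 / 2 * Real.exp (-T) + 3 / 2 * Real.exp (-T) :=
        add_le_add (one 1 (by simp)) (one (-1) (by simp))
    _ = _ := by ring

end QuadraticForms

/-! ### Resolvents of real symmetric matrices -/

section Resolvent

variable {ι : Type*} [Fintype ι] [DecidableEq ι]

/-- The shifted matrix `S - z`, over `ℂ`. -/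
noncomputable def shifted (S : Matrix ι ι ℝ) (z : ℂ) : Matrix ι ι ℂ :=
  S.map (fun t : ℝ => (t : ℂ)) - z • (1 : Matrix ι ι ℂ)

/-- The resolvent `(S - z)⁻¹` of a real matrix at a complex number. -/
noncomputable def realResolvent (S : Matrix ι ι ℝ) (z : ℂ) : Matrix ι ι ℂ := (shifted S z)⁻¹

/-- The vector `(S - z)⁻¹ v`. -/
noncomputable def resolventVec (S : Matrix ι ι ℝ) (z : ℂ) (v : ι → ℝ) : ι → ℂ :=
  (realResolvent S z).mulVec fun i => (v i : ℂ)

/-- The quadratic form `vᵀ (S - z)⁻¹ v`. -/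
noncomputable def resolventForm (S : Matrix ι ι ℝ) (z : ℂ) (v : ι → ℝ) : ℂ :=
  (fun i => (v i : ℂ)) ⬝ᵥ resolventVec S z v

variable {S : Matrix ι ι ℝ} {z : ℂ}

/-- The energy identity behind all resolvent bounds. -/
theorem im_star_shifted_dotProduct (hS : S.IsSymm) (w : ι → ℂ) :
    (star ((shifted S z).mulVec w) ⬝ᵥ w).im = z.im * ∑ i, ‖w i‖ ^ 2 := by
  have h1 : star ((shifted S z).mulVec w) ⬝ᵥ w =
      (∑ i, ∑ j, (S i j : ℂ) * star (w j) * w i) - star z * ∑ i, star (w i) * w i := by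
    rw [shifted, Matrix.sub_mulVec, Matrix.smul_mulVec, Matrix.one_mulVec, star_sub, sub_dotProduct]
    congr 1
    · simp only [dotProduct, Matrix.mulVec, Pi.star_apply, star_sum, Matrix.map_apply,
        Finset.sum_mul, star_mul']
      refine Finset.sum_congr rfl fun i _ => Finset.sum_congr rfl fun j _ => ?_
      simp
    · simp only [dotProduct, Pi.star_apply, Pi.smul_apply, smul_eq_mul, Finset.mul_sum,
        star_mul']
      exact Finset.sum_congr rfl fun i _ => by ring
  have h2 : (∑ i, ∑ j, (S i j : ℂ) * star (w j) * w i).im = 0 := by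
    rw [← Complex.conj_eq_iff_im, map_sum]
    simp only [map_sum, map_mul]
    rw [Finset.sum_comm]
    refine Finset.sum_congr rfl fun i _ => Finset.sum_congr rfl fun j _ => ?_
    rw [hS.apply i j]
    simp
    ring
  have h3 : ∑ i, star (w i) * w i = ((∑ i, ‖w i‖ ^ 2 : ℝ) : ℂ) := by
    push_cast
    refine Finset.sum_congr rfl fun i _ => ?_
    simp [Complex.conj_mul']
  rw [h1, h3, Complex.sub_im, h2, Complex.im_mul_ofReal]
  simp

theorem isUnit_shifted (hS : S.IsSymm) (hz : 0 < z.im) : IsUnit (shifted S z) := by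
  rw [← Matrix.mulVec_injective_iff_isUnit]
  intro w w' hw
  have h0 : (shifted S z).mulVec (w - w') = 0 := by
    rw [Matrix.mulVec_sub]; exact sub_eq_zero.2 hw
  have h1 := im_star_shifted_dotProduct (z := z) hS (w - w')
  rw [h0] at h1
  simp only [star_zero, zero_dotProduct, Complex.zero_im] at h1
  have h2 : ∑ i, ‖(w - w') i‖ ^ 2 = 0 := by
    rcases mul_eq_zero.1 h1.symm with h | h
    · exact absurd h hz.ne'
    · exact h
  rw [Finset.sum_eq_zero_iff_of_nonneg fun _ _ => sq_nonneg _] at h2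
  funext i
  have := h2 i (Finset.mem_univ i)
  simpa [sub_eq_zero] using this

theorem shifted_mul_realResolvent (hS : S.IsSymm) (hz : 0 < z.im) :
    shifted S z * realResolvent S z = 1 :=
  Matrix.mul_nonsing_inv _ ((Matrix.isUnit_iff_isUnit_det _).1 (isUnit_shifted hS hz))

theorem realResolvent_mul_shifted (hS : S.IsSymm) (hz : 0 < z.im) :
    realResolvent S z * shifted S z = 1 :=
  Matrix.nonsing_inv_mul _ ((Matrix.isUnit_iff_isUnit_det _).1 (isUnit_shifted hS hz))

theorem realResolvent_isSymm (hS : S.IsSymm) (z : ℂ) : (realResolvent S z).IsSymm := by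
  have h : (shifted S z).IsSymm := by
    ext i j
    by_cases hij : i = j
    · subst hij; simp
    · simp [shifted, hS.apply i j, hij, Ne.symm hij]
  rw [Matrix.IsSymm, realResolvent, Matrix.transpose_nonsing_inv, h.eq]

theorem im_resolventForm (hS : S.IsSymm) (hz : 0 < z.im) (v : ι → ℝ) :
    (resolventForm S z v).im = z.im * ∑ i, ‖resolventVec S z v i‖ ^ 2 := by
  rw [← im_star_shifted_dotProduct hS, resolventVec, Matrix.mulVec_mulVec,
    shifted_mul_realResolvent hS hz, Matrix.one_mulVec, resolventForm, resolventVec]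
  congr 2
  funext i
  simp

theorem sum_norm_resolventVec_le (hS : S.IsSymm) (hz : 0 < z.im) (v : ι → ℝ) :
    ∑ i, ‖resolventVec S z v i‖ ^ 2 ≤ (1 / z.im) ^ 2 * ∑ i, v i ^ 2 := by
  set N := ∑ i, ‖resolventVec S z v i‖ ^ 2 with hN
  have hN0 : 0 ≤ N := Finset.sum_nonneg fun _ _ => sq_nonneg _
  have h1 := im_resolventForm hS hz v
  have h2 : (resolventForm S z v).im = ∑ i, v i * (resolventVec S z v i).im := by
    simp [resolventForm, dotProduct]
  have h3 := Finset.sum_mul_sq_le_sq_mul_sq Finset.univ v fun i => (resolventVec S z v i).im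
  have h4 : ∑ i, (resolventVec S z v i).im ^ 2 ≤ N := Finset.sum_le_sum fun i _ =>
    sq_le_sq' (by linarith [(abs_le.1 (Complex.abs_im_le_norm (resolventVec S z v i))).1])
      (abs_le.1 (Complex.abs_im_le_norm _)).2
  rw [← h2, h1, ← hN] at h3
  have hv0 : 0 ≤ ∑ i, v i ^ 2 := Finset.sum_nonneg fun _ _ => sq_nonneg _
  have h5 : (z.im * N) ^ 2 ≤ (∑ i, v i ^ 2) * N := h3.trans (mul_le_mul_of_nonneg_left h4 hv0)
  rcases hN0.eq_or_lt with h | h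
  · rw [← h]; positivity
  · have h6 : z.im ^ 2 * N ≤ ∑ i, v i ^ 2 := by
      refine le_of_mul_le_mul_right ?_ h
      linarith
    rw [one_div, inv_pow, ← div_eq_inv_mul, le_div_iff₀ (by positivity)]
    linarith

theorem norm_sum_mul_le (v w : ι → ℂ) {a b : ℝ} (ha : 0 ≤ a) (hb : 0 ≤ b)
    (hv : ∑ i, ‖v i‖ ^ 2 ≤ a ^ 2) (hw : ∑ i, ‖w i‖ ^ 2 ≤ b ^ 2) : ‖v ⬝ᵥ w‖ ≤ a * b := by
  have h1 : ‖v ⬝ᵥ w‖ ≤ ∑ i, ‖v i‖ * ‖w i‖ := by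
    refine (norm_sum_le _ _).trans (le_of_eq ?_)
    simp
  have h2 := Finset.sum_mul_sq_le_sq_mul_sq Finset.univ (fun i => ‖v i‖) fun i => ‖w i‖
  refine h1.trans (abs_le_of_sq_le_sq' ?_ (by positivity)).2
  rw [mul_pow]
  exact h2.trans (mul_le_mul hv hw (Finset.sum_nonneg fun _ _ => sq_nonneg _) (sq_nonneg _))

theorem norm_resolventForm_le (hS : S.IsSymm) (hz : 0 < z.im) (v : ι → ℝ) :
    ‖resolventForm S z v‖ ≤ (1 / z.im) * ∑ i, v i ^ 2 := by
  have hv0 : 0 ≤ ∑ i, v i ^ 2 := Finset.sum_nonneg fun _ _ => sq_nonneg _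
  have h := norm_sum_mul_le (fun i => (v i : ℂ)) (resolventVec S z v)
    (a := √(∑ i, v i ^ 2)) (b := 1 / z.im * √(∑ i, v i ^ 2)) (by positivity) (by positivity)
    (by simp [Real.sq_sqrt hv0]) (by
      rw [mul_pow, Real.sq_sqrt hv0]; exact sum_norm_resolventVec_le hS hz v)
  refine h.trans (le_of_eq ?_)
  rw [mul_left_comm, Real.mul_self_sqrt hv0]

theorem dotProduct_realResolvent_mulVec (hS : S.IsSymm) (v : ι → ℝ) (w : ι → ℂ) :
    (fun i => (v i : ℂ)) ⬝ᵥ (realResolvent S z).mulVec w = resolventVec S z v ⬝ᵥ w := by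
  rw [Matrix.dotProduct_mulVec, ← Matrix.mulVec_transpose, (realResolvent_isSymm hS z).eq,
    resolventVec]

theorem norm_resolventForm_sub_le (hS : S.IsSymm) {z' : ℂ} (hz : 0 < z.im) (hz' : 0 < z'.im)
    (v : ι → ℝ) : ‖resolventForm S z v - resolventForm S z' v‖ ≤
      ‖z - z'‖ * ((1 / z.im) * (1 / z'.im) * ∑ i, v i ^ 2) := by
  have hv0 : 0 ≤ ∑ i, v i ^ 2 := Finset.sum_nonneg fun _ _ => sq_nonneg _
  have h1 : realResolvent S z - realResolvent S z' =
      (z - z') • (realResolvent S z * realResolvent S z') := by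
    calc _ = realResolvent S z * (shifted S z' - shifted S z) * realResolvent S z' := by
          rw [mul_sub, sub_mul, realResolvent_mul_shifted hS hz, mul_assoc,
            shifted_mul_realResolvent hS hz', one_mul, mul_one]
      _ = _ := by
          have : shifted S z' - shifted S z = (z - z') • (1 : Matrix ι ι ℂ) := by
            rw [shifted, shifted, sub_smul]; abel
          rw [this]; simp
  have h2 : resolventForm S z v - resolventForm S z' v =
      (z - z') * (resolventVec S z v ⬝ᵥ resolventVec S z' v) := by
    rw [resolventForm, resolventForm, ← dotProduct_sub, resolventVec, resolventVec,
      ← Matrix.sub_mulVec, h1, Matrix.smul_mulVec, dotProduct_smul, ← Matrix.mulVec_mulVec,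
      dotProduct_realResolvent_mulVec hS, smul_eq_mul]
    rfl
  rw [h2, norm_mul]
  refine mul_le_mul_of_nonneg_left ?_ (norm_nonneg _)
  refine (norm_sum_mul_le _ _ (a := 1 / z.im * √(∑ i, v i ^ 2))
    (b := 1 / z'.im * √(∑ i, v i ^ 2)) (by positivity) (by positivity) ?_ ?_).trans
    (le_of_eq ?_)
  · rw [mul_pow, Real.sq_sqrt hv0]; exact sum_norm_resolventVec_le hS hz v
  · rw [mul_pow, Real.sq_sqrt hv0]; exact sum_norm_resolventVec_le hS hz' v
  · rw [mul_mul_mul_comm, Real.mul_self_sqrt hv0]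

theorem resolventForm_single (S : Matrix ι ι ℝ) (z : ℂ) (j : ι) :
    resolventForm S z (Pi.single j 1) = realResolvent S z j j := by
  have : (fun i => ((Pi.single j 1 : ι → ℝ) i : ℂ)) = Pi.single j 1 := by
    funext i
    by_cases h : i = j
    · subst h; simp
    · simp [h]
  rw [resolventForm, resolventVec, this, Matrix.mulVec_single_one, single_dotProduct, one_mul]
  rfl

theorem trace_realResolvent (S : Matrix ι ι ℝ) (z : ℂ) :
    (realResolvent S z).trace = ∑ j, resolventForm S z (Pi.single j 1) := by
  simp_rw [resolventForm_single]; rfl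

theorem sum_single_sq (j : ι) : ∑ i, (Pi.single j 1 : ι → ℝ) i ^ 2 = 1 := by
  rw [Finset.sum_eq_single j]
  · simp
  · intro i _ hi; simp [hi]
  · simp

theorem norm_trace_realResolvent_le (hS : S.IsSymm) (hz : 0 < z.im) :
    ‖(realResolvent S z).trace‖ ≤ Fintype.card ι / z.im := by
  rw [trace_realResolvent]
  calc _ ≤ ∑ j : ι, 1 / z.im := (norm_sum_le _ _).trans (Finset.sum_le_sum fun j _ => by
        simpa [sum_single_sq] using norm_resolventForm_le hS hz (Pi.single j 1))
    _ = _ := by simp [div_eq_mul_inv]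

theorem norm_trace_realResolvent_sub_le (hS : S.IsSymm) {z' : ℂ} (hz : 0 < z.im)
    (hz' : 0 < z'.im) : ‖(realResolvent S z).trace - (realResolvent S z').trace‖ ≤
      Fintype.card ι * (‖z - z'‖ * ((1 / z.im) * (1 / z'.im))) := by
  rw [trace_realResolvent, trace_realResolvent, ← Finset.sum_sub_distrib]
  calc _ ≤ ∑ j : ι, ‖z - z'‖ * ((1 / z.im) * (1 / z'.im)) :=
        (norm_sum_le _ _).trans (Finset.sum_le_sum fun j _ => by
          simpa [sum_single_sq] using norm_resolventForm_sub_le hS hz hz' (Pi.single j 1))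
    _ = _ := by simp

/-- The Ward identity. -/
theorem im_trace_realResolvent (hS : S.IsSymm) (hz : 0 < z.im) :
    (realResolvent S z).trace.im = z.im * ∑ i, ∑ j, ‖realResolvent S z i j‖ ^ 2 := by
  rw [trace_realResolvent, Complex.im_sum, Finset.sum_comm, Finset.mul_sum]
  refine Finset.sum_congr rfl fun j _ => ?_
  rw [im_resolventForm hS hz]
  congr 1
  refine Finset.sum_congr rfl fun i _ => ?_
  have : (fun i => ((Pi.single j 1 : ι → ℝ) i : ℂ)) = Pi.single j 1 := by
    funext i
    by_cases h : i = j
    · subst h; simp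
    · simp [h]
  rw [resolventVec, this, Matrix.mulVec_single_one]
  rfl

section RankOne

variable {y : ι → ℝ}

theorem isSymm_add_vecMulVec (hS : S.IsSymm) (y : ι → ℝ) :
    (S + Matrix.vecMulVec y y).IsSymm := by
  ext i j
  simp [hS.apply i j, Matrix.vecMulVec_apply, mul_comm]

theorem resolventVec_rankOne (hS : S.IsSymm) (hz : 0 < z.im) (y : ι → ℝ) :
    resolventVec (S + Matrix.vecMulVec y y) z y =
      (1 - resolventForm (S + Matrix.vecMulVec y y) z y) • resolventVec S z y ∧
    realResolvent S z - realResolvent (S + Matrix.vecMulVec y y) z =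
      Matrix.vecMulVec (resolventVec S z y) (resolventVec (S + Matrix.vecMulVec y y) z y) := by
  set S' := S + Matrix.vecMulVec y y with hS'
  have hs' : S'.IsSymm := isSymm_add_vecMulVec hS y
  let yc : ι → ℂ := fun i => (y i : ℂ)
  have hsub : shifted S' z - shifted S z = Matrix.vecMulVec yc yc := by
    ext i j
    simp [shifted, hS', Matrix.vecMulVec_apply, yc]
  have h1 : realResolvent S z - realResolvent S' z =
      realResolvent S z * Matrix.vecMulVec yc yc * realResolvent S' z := by
    rw [← hsub, mul_sub, sub_mul, realResolvent_mul_shifted hS hz, mul_assoc,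
      shifted_mul_realResolvent hs' hz, one_mul, mul_one]
  have h2 : realResolvent S z - realResolvent S' z =
      Matrix.vecMulVec (resolventVec S z y) (resolventVec S' z y) := by
    rw [h1, Matrix.mul_vecMulVec, Matrix.vecMulVec_mul, ← Matrix.mulVec_transpose,
      (realResolvent_isSymm hs' z).eq]
    rfl
  refine ⟨?_, h2⟩
  have h3 : resolventVec S z y - resolventVec S' z y =
      resolventForm S' z y • resolventVec S z y := by
    rw [resolventVec, resolventVec, ← Matrix.sub_mulVec, h2, Matrix.vecMulVec_mulVec,
      resolventForm, dotProduct_comm, op_smul_eq_smul]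
    rfl
  rw [sub_smul, one_smul, ← h3, sub_sub_cancel]

/-- The Sherman–Morrison formula for the quadratic form. -/
theorem resolventForm_rankOne (hS : S.IsSymm) (hz : 0 < z.im) (y : ι → ℝ) :
    (1 - resolventForm (S + Matrix.vecMulVec y y) z y) * (1 + resolventForm S z y) = 1 := by
  have h := (resolventVec_rankOne hS hz y).1
  have h2 : resolventForm (S + Matrix.vecMulVec y y) z y =
      (1 - resolventForm (S + Matrix.vecMulVec y y) z y) * resolventForm S z y := by
    conv_lhs => rw [resolventForm, h, dotProduct_smul, smul_eq_mul]
    rfl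
  linear_combination -h2

theorem one_add_resolventForm_ne_zero (hS : S.IsSymm) (hz : 0 < z.im) (y : ι → ℝ) :
    1 + resolventForm S z y ≠ 0 := fun h => by
  have := resolventForm_rankOne hS hz y
  rw [h] at this
  simp at this

/-- A rank-one perturbation changes the trace of the resolvent by at most `1 / Im z`, whatever the
size of the perturbation. -/
theorem norm_trace_realResolvent_rankOne_le (hS : S.IsSymm) (hz : 0 < z.im) (y : ι → ℝ) :
    ‖(realResolvent S z).trace - (realResolvent (S + Matrix.vecMulVec y y) z).trace‖ ≤
      1 / z.im := by
  obtain ⟨h1, h2⟩ := resolventVec_rankOne hS hz y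
  have h3 := resolventForm_rankOne hS hz y
  have h4 := one_add_resolventForm_ne_zero hS hz y
  rw [← Matrix.trace_sub, h2, Matrix.trace_vecMulVec, h1, dotProduct_smul, smul_eq_mul, norm_mul,
    eq_div_of_mul_eq h4 h3]
  have h5 : ‖resolventVec S z y ⬝ᵥ resolventVec S z y‖ ≤ (resolventForm S z y).im / z.im := by
    rw [im_resolventForm hS hz, mul_div_cancel_left₀ _ hz.ne']
    refine (norm_sum_le _ _).trans (le_of_eq ?_)
    simp [sq]
  have h6 : (resolventForm S z y).im ≤ ‖1 + resolventForm S z y‖ := by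
    have := (abs_le.1 (Complex.abs_im_le_norm (1 + resolventForm S z y))).2
    simpa using this
  have h7 : 0 < ‖1 + resolventForm S z y‖ := norm_pos_iff.2 h4
  rw [norm_div, norm_one, one_div, inv_mul_le_iff₀ h7]
  refine h5.trans ?_
  rw [div_eq_mul_one_div]
  gcongr

end RankOne

end Resolvent

/-! ### Gram matrices and their minors -/

section Gram

variable {α ι : Type*} [Fintype α] [DecidableEq α] [Fintype ι] [DecidableEq ι]

theorem isSymm_gram (Y : Matrix α ι ℝ) : (Y.transpose * Y).IsSymm := by
  rw [Matrix.IsSymm, Matrix.transpose_mul, Matrix.transpose_transpose]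

theorem isSymm_coGram (Y : Matrix α ι ℝ) : (Y * Y.transpose).IsSymm := by
  rw [Matrix.IsSymm, Matrix.transpose_mul, Matrix.transpose_transpose]

/-- `YᵀY` without the contribution of row `i`. -/
noncomputable def minorGram (Y : Matrix α ι ℝ) (i : α) : Matrix ι ι ℝ :=
  (Matrix.updateRow Y i 0).transpose * Matrix.updateRow Y i 0

theorem minorGram_isSymm (Y : Matrix α ι ℝ) (i : α) : (minorGram Y i).IsSymm :=
  isSymm_gram _

theorem minorGram_add_vecMulVec (Y : Matrix α ι ℝ) (i : α) :
    minorGram Y i + Matrix.vecMulVec (Y i) (Y i) = Y.transpose * Y := by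
  ext k l
  simp only [minorGram, Matrix.add_apply, Matrix.mul_apply, Matrix.transpose_apply,
    Matrix.vecMulVec_apply]
  rw [← Finset.add_sum_erase _ (fun a => Y a k * Y a l) (Finset.mem_univ i),
    ← Finset.add_sum_erase _ _ (Finset.mem_univ i), add_comm]
  simp only [Matrix.updateRow_self, Pi.zero_apply, zero_mul, zero_add]
  congr 1
  refine Finset.sum_congr rfl fun a ha => ?_
  rw [Matrix.updateRow_ne (Finset.ne_of_mem_erase ha)]

variable {z : ℂ}

/-- The complexification of a real matrix. -/
noncomputable def toComplex {β γ : Type*} (Y : Matrix β γ ℝ) : Matrix β γ ℂ :=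
  Y.map fun t : ℝ => (t : ℂ)

theorem toComplex_one {β : Type*} [DecidableEq β] : toComplex (1 : Matrix β β ℝ) = 1 := by
  ext i j
  by_cases h : i = j <;> simp [toComplex, Matrix.one_apply, h]

theorem toComplex_mul {β γ ε : Type*} [Fintype γ] (A : Matrix β γ ℝ) (B : Matrix γ ε ℝ) :
    toComplex (A * B) = toComplex A * toComplex B := by
  ext i j; simp [toComplex, Matrix.mul_apply]

theorem toComplex_mul_realResolvent {S : Matrix ι ι ℝ} (hS : S.IsSymm) (hz : 0 < z.im) :
    toComplex S * realResolvent S z = 1 + z • realResolvent S z := by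
  have h := shifted_mul_realResolvent hS hz
  rw [shifted, sub_mul, smul_mul_assoc, one_mul, sub_eq_iff_eq_add] at h
  exact h

/-- The trace of `YᵀY (YᵀY - z)⁻¹`, computed row by row and from the resolvent equation. -/
theorem sum_resolventForm_rows (Y : Matrix α ι ℝ) (hz : 0 < z.im) :
    ∑ a, resolventForm (Y.transpose * Y) z (Y a) =
      Fintype.card ι + z * (realResolvent (Y.transpose * Y) z).trace := by
  set S := Y.transpose * Y with hSd
  have hS : S.IsSymm := isSymm_gram Y
  have h1 : (toComplex S * realResolvent S z).trace =
      Fintype.card ι + z * (realResolvent S z).trace := by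
    rw [toComplex_mul_realResolvent hS hz, Matrix.trace_add, Matrix.trace_smul, Matrix.trace_one,
      smul_eq_mul]
  have h2 : (toComplex S * realResolvent S z).trace =
      (toComplex Y * realResolvent S z * toComplex Y.transpose).trace := by
    rw [Matrix.trace_mul_comm _ (toComplex Y.transpose), ← Matrix.mul_assoc, ← toComplex_mul]
  rw [← h1, h2]
  refine Finset.sum_congr rfl fun a _ => ?_
  rw [resolventForm, resolventVec, Matrix.dotProduct_mulVec]
  rfl

/-- `Y Yᵀ` and `Yᵀ Y` have the same nonzero spectrum, stated for the traces of their resolvents. -/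
theorem card_add_trace_realResolvent (Y : Matrix α ι ℝ) (hz : 0 < z.im) :
    Fintype.card α + z * (realResolvent (Y * Y.transpose) z).trace =
      Fintype.card ι + z * (realResolvent (Y.transpose * Y) z).trace := by
  set S := Y.transpose * Y with hSd
  set W := Y * Y.transpose with hWd
  have hS : S.IsSymm := isSymm_gram Y
  have hW : W.IsSymm := isSymm_coGram Y
  have h1 : (toComplex S * realResolvent S z).trace =
      Fintype.card ι + z * (realResolvent S z).trace := by
    rw [toComplex_mul_realResolvent hS hz, Matrix.trace_add, Matrix.trace_smul, Matrix.trace_one,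
      smul_eq_mul]
  have h2 : (toComplex W * realResolvent W z).trace =
      Fintype.card α + z * (realResolvent W z).trace := by
    rw [toComplex_mul_realResolvent hW hz, Matrix.trace_add, Matrix.trace_smul, Matrix.trace_one,
      smul_eq_mul]
  -- the two resolvents are intertwined by `Yᵀ`
  have h3 : toComplex Y.transpose * shifted W z = shifted S z * toComplex Y.transpose := by
    have e1 : toComplex Y.transpose * toComplex W = toComplex S * toComplex Y.transpose := by
      rw [← toComplex_mul, ← toComplex_mul, hWd, hSd, Matrix.mul_assoc]
    rw [shifted, shifted, Matrix.mul_sub, Matrix.sub_mul]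
    change toComplex Y.transpose * toComplex W - _ = toComplex S * toComplex Y.transpose - _
    rw [e1]; simp
  have h4 : realResolvent S z * toComplex Y.transpose = toComplex Y.transpose * realResolvent W z := by
    calc _ = realResolvent S z * (toComplex Y.transpose * (shifted W z * realResolvent W z)) := by
          rw [shifted_mul_realResolvent hW hz, Matrix.mul_one]
      _ = realResolvent S z * shifted S z * (toComplex Y.transpose * realResolvent W z) := by
          rw [← Matrix.mul_assoc (toComplex Y.transpose), h3]
          simp only [Matrix.mul_assoc]
      _ = _ := by rw [realResolvent_mul_shifted hS hz, Matrix.one_mul]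
  rw [← h1, ← h2]
  calc _ = (toComplex Y * (toComplex Y.transpose * realResolvent W z)).trace := by
        rw [← Matrix.mul_assoc, ← toComplex_mul]
    _ = (realResolvent S z * (toComplex Y.transpose * toComplex Y)).trace := by
        rw [← h4, Matrix.trace_mul_comm, Matrix.mul_assoc]
    _ = _ := by rw [← toComplex_mul, Matrix.trace_mul_comm]

theorem trace_realResolvent_eq_sum_eigenvalues {W : Matrix α α ℝ} (hW : W.IsHermitian)
    (hz : 0 < z.im) :
    (realResolvent W z).trace = ∑ i, 1 / ((hW.eigenvalues i : ℂ) - z) := by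
  have hne : ∀ i, (hW.eigenvalues i : ℂ) - z ≠ 0 := fun i h => by
    have := congrArg Complex.im h
    simp at this
    exact hz.ne' this
  let U : Matrix α α ℝ := hW.eigenvectorUnitary
  have hU : U * star U = 1 := Unitary.coe_mul_star_self hW.eigenvectorUnitary
  have hU' : star U * U = 1 := Unitary.coe_star_mul_self hW.eigenvectorUnitary
  have hWU : W = U * Matrix.diagonal hW.eigenvalues * star U := by
    have := hW.spectral_theorem
    rw [Unitary.conjStarAlgAut_apply] at this
    exact this
  let D : Matrix α α ℂ := Matrix.diagonal fun i => 1 / ((hW.eigenvalues i : ℂ) - z)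
  have hUc : toComplex U * toComplex (star U) = 1 := by
    rw [← toComplex_mul, hU]; exact toComplex_one
  have hUc' : toComplex (star U) * toComplex U = 1 := by
    rw [← toComplex_mul, hU']; exact toComplex_one
  have hsh : shifted W z = toComplex U * Matrix.diagonal (fun i => (hW.eigenvalues i : ℂ) - z) *
      toComplex (star U) := by
    have e1 : Matrix.diagonal (fun i => (hW.eigenvalues i : ℂ) - z) =
        toComplex (Matrix.diagonal hW.eigenvalues) - z • 1 := by
      ext i j
      by_cases h : i = j
      · subst h; simp [toComplex]
      · simp [toComplex, h]
    rw [e1, mul_sub, sub_mul, ← toComplex_mul, ← toComplex_mul, ← hWU]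
    simp only [mul_smul_comm, mul_one, smul_mul_assoc, hUc]
    rfl
  have hinv : realResolvent W z = toComplex U * D * toComplex (star U) := by
    refine Matrix.inv_eq_right_inv ?_
    rw [hsh]
    calc _ = toComplex U * (Matrix.diagonal (fun i => (hW.eigenvalues i : ℂ) - z) *
          (toComplex (star U) * toComplex U) * D) * toComplex (star U) := by
          simp only [Matrix.mul_assoc]
      _ = 1 := by
          rw [hUc', mul_one, Matrix.diagonal_mul_diagonal]
          have : (fun i => ((hW.eigenvalues i : ℂ) - z) * (1 / ((hW.eigenvalues i : ℂ) - z))) =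
              fun _ => 1 := by
            funext i; exact mul_one_div_cancel (hne i)
          rw [this, Matrix.diagonal_one, mul_one, hUc]
  rw [hinv, Matrix.trace_mul_comm, ← mul_assoc, hUc', one_mul, Matrix.trace_diagonal]

end Gram

/-! ### Measurability of resolvents -/

section MeasurableInverse

variable {E ι : Type*} [MeasurableSpace E] [Fintype ι] [DecidableEq ι]

theorem measurable_det {A : E → Matrix ι ι ℂ} (hA : ∀ i j, Measurable fun e => A e i j) :
    Measurable fun e => (A e).det := by
  simp only [Matrix.det_apply]
  refine Finset.measurable_sum _ fun σ _ => Measurable.const_smul ?_ _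
  exact Finset.measurable_prod _ fun i _ => hA _ _

theorem measurable_inv_apply {A : E → Matrix ι ι ℂ} (hA : ∀ i j, Measurable fun e => A e i j)
    (i j : ι) : Measurable fun e => (A e)⁻¹ i j := by
  simp only [Matrix.inv_def, Ring.inverse_eq_inv, Matrix.smul_apply, smul_eq_mul,
    Matrix.adjugate_apply]
  refine (measurable_det hA).inv.mul (measurable_det fun k l => ?_)
  by_cases h : k = j
  · subst h; simp
  · simpa [h] using hA k l

theorem measurable_realResolvent_apply {S : E → Matrix ι ι ℝ}
    (hS : ∀ i j, Measurable fun e => S e i j) (z : ℂ) (i j : ι) :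
    Measurable fun e => realResolvent (S e) z i j := by
  refine measurable_inv_apply (fun k l => ?_) i j
  simp only [shifted, Matrix.sub_apply, Matrix.map_apply]
  exact (Complex.measurable_ofReal.comp (hS k l)).sub_const _

end MeasurableInverse

/-! ### Quadratic forms with independent random coefficients -/

section RandomForms

variable {E ι Ω : Type*} [MeasurableSpace E] [Fintype ι] [DecidableEq ι] [MeasurableSpace Ω]
  {μ : Measure Ω} [IsProbabilityMeasure μ] {ν : ι → Measure ℝ} {K : ℝ}

/-- The Hanson–Wright inequality for a quadratic form with random coefficients independent of the
vector. -/
theorem measureReal_random_quadForm_le (h : ∀ i, IsBoundedStandard (ν i) K) (hK : 0 < K)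
    {V : Ω → ι → ℝ} {Z : Ω → E} (hV : Measurable V) (hZ : Measurable Z) (hVZ : IndepFun V Z μ)
    (hlaw : μ.map V = Measure.pi ν) {B : E → Matrix ι ι ℝ}
    (hBm : ∀ i j, Measurable fun e => B e i j) (hs : ∀ e, (B e).IsSymm) {β : ℝ} (hβ : 0 < β)
    (hB : ∀ e v, sqNormMulVec (B e) v ≤ β ^ 2 * ∑ i, v i ^ 2) {F : E → ℝ} (hFm : Measurable F)
    (hF : ∀ e, 0 ≤ F e) (hBF : ∀ e, frobSq (B e) ≤ F e ^ 2) (T : ℝ) :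
    μ.real {ω | 32 * T * (K * F (Z ω) + K ^ 2 * β) ≤
      |V ω ⬝ᵥ (B (Z ω)).mulVec (V ω) - (B (Z ω)).trace|} ≤ 3 * Real.exp (-T) := by
  have := fun i => (h i).isProb
  set A : Set ((ι → ℝ) × E) := {u | 32 * T * (K * F u.2 + K ^ 2 * β) ≤
      |u.1 ⬝ᵥ (B u.2).mulVec u.1 - (B u.2).trace|} with hA
  have hAm : MeasurableSet A := by
    refine measurableSet_le (by fun_prop) (Measurable.comp (g := fun t : ℝ => |t|)
      measurable_norm (Measurable.sub ?_ ?_))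
    · simp only [Matrix.mulVec, dotProduct]
      refine Finset.measurable_sum _ fun i _ => Measurable.mul (by fun_prop)
        (Finset.measurable_sum _ fun j _ => Measurable.mul ((hBm i j).comp measurable_snd)
          (by fun_prop))
    · exact Finset.measurable_sum _ fun i _ => (hBm i i).comp measurable_snd
  have hpair : μ.map (fun ω => (V ω, Z ω)) = (Measure.pi ν).prod (μ.map Z) := by
    rw [← hlaw]; exact (indepFun_iff_map_prod_eq_prod_map_map hV.aemeasurable hZ.aemeasurable).1 hVZ
  have hZp : IsProbabilityMeasure (μ.map Z) := Measure.isProbabilityMeasure_map hZ.aemeasurable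
  have h1 : μ {ω | 32 * T * (K * F (Z ω) + K ^ 2 * β) ≤
      |V ω ⬝ᵥ (B (Z ω)).mulVec (V ω) - (B (Z ω)).trace|} ≤ ENNReal.ofReal (3 * Real.exp (-T)) := by
    calc _ = (μ.map (fun ω => (V ω, Z ω))) A := by
          rw [Measure.map_apply (hV.prodMk hZ) hAm]; rfl
      _ = ∫⁻ e, (Measure.pi ν) ((fun v => (v, e)) ⁻¹' A) ∂(μ.map Z) := by
          rw [hpair, Measure.prod_apply_symm hAm]
      _ ≤ ∫⁻ _, ENNReal.ofReal (3 * Real.exp (-T)) ∂(μ.map Z) := by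
          refine lintegral_mono fun e => ?_
          have := measureReal_quadForm_le h hK (hs e) hβ (hB e) (hF e) (hBF e) T
          rw [Measure.real, ← ENNReal.le_ofReal_iff_toReal_le (measure_ne_top _ _)
            (by positivity)] at this
          exact this
      _ = _ := by simp
  exact ENNReal.toReal_le_of_le_ofReal (by positivity) h1

end RandomForms

/-! ### Operator and Frobenius norms of resolvents -/

section ResolventForms

variable {ι : Type*} [Fintype ι] [DecidableEq ι] {S : Matrix ι ι ℝ} {z : ℂ}

theorem resolventForm_re_im (S : Matrix ι ι ℝ) (z : ℂ) (v : ι → ℝ) :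
    (resolventForm S z v).re = v ⬝ᵥ ((realResolvent S z).map Complex.re).mulVec v ∧
    (resolventForm S z v).im = v ⬝ᵥ ((realResolvent S z).map Complex.im).mulVec v := by
  constructor <;> simp [resolventForm, resolventVec, dotProduct, Matrix.mulVec]

theorem sqNormMulVec_re_le (hS : S.IsSymm) (hz : 0 < z.im) (v : ι → ℝ) :
    sqNormMulVec ((realResolvent S z).map Complex.re) v ≤ (1 / z.im) ^ 2 * ∑ i, v i ^ 2 := by
  refine le_trans (Finset.sum_le_sum fun i _ => ?_) (sum_norm_resolventVec_le hS hz v)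
  have : ((realResolvent S z).map Complex.re).mulVec v i = (resolventVec S z v i).re := by
    simp [resolventVec, dotProduct, Matrix.mulVec]
  rw [this, ← sq_abs]
  exact pow_le_pow_left₀ (abs_nonneg _) (Complex.abs_re_le_norm _) 2

theorem sqNormMulVec_im_le (hS : S.IsSymm) (hz : 0 < z.im) (v : ι → ℝ) :
    sqNormMulVec ((realResolvent S z).map Complex.im) v ≤ (1 / z.im) ^ 2 * ∑ i, v i ^ 2 := by
  refine le_trans (Finset.sum_le_sum fun i _ => ?_) (sum_norm_resolventVec_le hS hz v)
  have : ((realResolvent S z).map Complex.im).mulVec v i = (resolventVec S z v i).im := by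
    simp [resolventVec, dotProduct, Matrix.mulVec]
  rw [this, ← sq_abs]
  exact pow_le_pow_left₀ (abs_nonneg _) (Complex.abs_im_le_norm _) 2

theorem im_trace_realResolvent_nonneg (hS : S.IsSymm) (hz : 0 < z.im) :
    0 ≤ (realResolvent S z).trace.im := by
  rw [im_trace_realResolvent hS hz]; positivity

theorem frobSq_re_im_le (hS : S.IsSymm) (hz : 0 < z.im) :
    frobSq ((realResolvent S z).map Complex.re) ≤
      √((realResolvent S z).trace.im / z.im) ^ 2 ∧
    frobSq ((realResolvent S z).map Complex.im) ≤
      √((realResolvent S z).trace.im / z.im) ^ 2 := by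
  rw [Real.sq_sqrt (div_nonneg (im_trace_realResolvent_nonneg hS hz) hz.le),
    im_trace_realResolvent hS hz, mul_div_cancel_left₀ _ hz.ne']
  constructor
  · refine Finset.sum_le_sum fun i _ => Finset.sum_le_sum fun j _ => ?_
    rw [Matrix.map_apply, ← sq_abs]
    exact pow_le_pow_left₀ (abs_nonneg _) (Complex.abs_re_le_norm _) 2
  · refine Finset.sum_le_sum fun i _ => Finset.sum_le_sum fun j _ => ?_
    rw [Matrix.map_apply, ← sq_abs]
    exact pow_le_pow_left₀ (abs_nonneg _) (Complex.abs_im_le_norm _) 2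

end ResolventForms

/-! ### Concentration in the rows of the data matrix -/

section Rows

variable {p n : ℕ} {Ω : Type*} [MeasurableSpace Ω] {μ : Measure Ω} [IsProbabilityMeasure μ]
  {x : Fin p → Fin n → Ω → ℝ} {K : ℝ}

theorem normalizedRows_updateRow_zero (X : Matrix (Fin p) (Fin n) ℝ) (i : Fin p) :
    normalizedRows (Matrix.updateRow X i 0) = Matrix.updateRow (normalizedRows X) i 0 := by
  ext a j
  by_cases h : a = i
  · subst h; simp [normalizedRows]
  · simp [normalizedRows, Matrix.updateRow_ne h]

/-- The law of an entry of the data matrix. -/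
theorem isBoundedStandard_map {f : Ω → ℝ} (hf : Measurable f) (h0 : ∫ ω, f ω ∂μ = 0)
    (h1 : variance f μ = 1) (hb : ∀ᵐ ω ∂μ, |f ω| ≤ K) : IsBoundedStandard (μ.map f) K where
  isProb := Measure.isProbabilityMeasure_map hf.aemeasurable
  bound := (ae_map_iff hf.aemeasurable (measurableSet_le (by fun_prop) (by fun_prop))).2 hb
  mean := by rw [integral_map hf.aemeasurable (by fun_prop)]; exact h0
  second := by
    rw [integral_map hf.aemeasurable (by fun_prop)]
    rw [variance_of_integral_eq_zero hf.aemeasurable h0] at h1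
    exact h1

/-- The data matrix with its `i`-th row replaced by zero is independent of the `i`-th row. -/
theorem indepFun_row (hm : ∀ i j, Measurable (x i j))
    (hind : iIndepFun (fun ij : Fin p × Fin n => x ij.1 ij.2) μ) (i : Fin p) :
    IndepFun (fun ω j => x i j ω)
      (fun ω => (fun a => if a = i then 0 else fun j => x a j ω : Fin p → Fin n → ℝ)) μ := by
  classical
  have h := hind.indepFun_finset (Finset.univ.filter fun ij => ij.1 = i)
    (Finset.univ.filter fun ij => ij.1 ≠ i) (Finset.disjoint_filter_filter_not _ _ _)
    fun ij => hm ij.1 ij.2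
  let φ : ((Finset.univ.filter fun ij : Fin p × Fin n => ij.1 = i) → ℝ) → Fin n → ℝ :=
    fun t j => t ⟨(i, j), by simp⟩
  let ψ : ((Finset.univ.filter fun ij : Fin p × Fin n => ij.1 ≠ i) → ℝ) → Fin p → Fin n → ℝ :=
    fun t a j => if ha : a = i then 0 else t ⟨(a, j), by simp [ha]⟩
  have hφ : Measurable φ := by
    refine measurable_pi_lambda _ fun j => measurable_pi_apply _
  have hψ : Measurable ψ := by
    refine measurable_pi_lambda _ fun a => measurable_pi_lambda _ fun j => ?_
    by_cases ha : a = i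
    · simp [ψ, ha]
    · simp only [ψ, ha, dite_false]; exact measurable_pi_apply _
  have h2 := h.comp hφ hψ
  have e : (fun ω => (fun a => if a = i then 0 else fun j => x a j ω : Fin p → Fin n → ℝ)) =
      ψ ∘ fun ω t => x t.1.1 t.1.2 ω := by
    funext ω a j
    by_cases ha : a = i <;> simp [ψ, ha]
  rw [e]
  exact h2

/-- The row-wise concentration event: the quadratic form of the resolvent of the minor in the
`i`-th data row is close to the trace, and the length of the row is close to its mean. -/
def RowConcentrated (X : Matrix (Fin p) (Fin n) ℝ) (K T : ℝ) (z : ℂ) (i : Fin p) : Prop :=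
  ‖resolventForm (minorGram (normalizedRows X) i) z (X i) -
      (realResolvent (minorGram (normalizedRows X) i) z).trace‖ ≤
    64 * T * (K * √((realResolvent (minorGram (normalizedRows X) i) z).trace.im / z.im) +
      K ^ 2 / z.im) ∧
  |∑ j, X i j ^ 2 - n| ≤ 32 * T * (K * √n + K ^ 2)

/-- The three applications of the Hanson–Wright inequality are to the real and imaginary parts of
the resolvent and to the identity matrix, which gives the length of the row. -/
theorem measureReal_not_rowConcentrated_le (hK : 0 < K) (hm : ∀ i j, Measurable (x i j))
    (hind : iIndepFun (fun ij : Fin p × Fin n => x ij.1 ij.2) μ)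
    (h0 : ∀ i j, ∫ ω, x i j ω ∂μ = 0) (h1 : ∀ i j, variance (x i j) μ = 1)
    (hb : ∀ i j, ∀ᵐ ω ∂μ, |x i j ω| ≤ K) (T : ℝ) {z : ℂ} (hz : 0 < z.im) (i : Fin p) :
    μ.real {ω | ¬ RowConcentrated (Matrix.of fun i j => x i j ω) K T z i} ≤
      9 * Real.exp (-T) := by
  have hst : ∀ j, IsBoundedStandard (μ.map (x i j)) K := fun j =>
    isBoundedStandard_map (hm i j) (h0 i j) (h1 i j) (hb i j)
  let V : Ω → Fin n → ℝ := fun ω j => x i j ω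
  let Z : Ω → Fin p → Fin n → ℝ := fun ω a => if a = i then 0 else fun j => x a j ω
  have hV : Measurable V := measurable_pi_lambda _ fun j => hm i j
  have hZ : Measurable Z := by
    refine measurable_pi_lambda _ fun a => ?_
    by_cases ha : a = i
    · simp only [Z, ha, if_true]; exact measurable_const
    · simp only [Z, ha, if_false]; exact measurable_pi_lambda _ fun j => hm a j
  have hVZ : IndepFun V Z μ := indepFun_row hm hind i
  have hlaw : μ.map V = Measure.pi fun j => μ.map (x i j) := by
    have hi : iIndepFun (fun j => x i j) μ :=
      hind.precomp (g := fun j : Fin n => (i, j)) fun a b hab => by simpa using hab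
    exact (iIndepFun_iff_map_fun_eq_pi_map fun j => (hm i j).aemeasurable).1 hi
  let S : (Fin p → Fin n → ℝ) → Matrix (Fin n) (Fin n) ℝ := fun e =>
    (normalizedRows (Matrix.of e)).transpose * normalizedRows (Matrix.of e)
  have hSs : ∀ e, (S e).IsSymm := fun e => isSymm_gram _
  have hSm : ∀ k l, Measurable fun e => S e k l := by
    intro k l
    simp only [S, Matrix.mul_apply, Matrix.transpose_apply, normalizedRows, Matrix.of_apply]
    fun_prop
  have hRm := fun k l => measurable_realResolvent_apply hSm z k l
  have hSZ : ∀ ω, S (Z ω) = minorGram (normalizedRows (Matrix.of fun i j => x i j ω)) i := by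
    intro ω
    have : Matrix.of (Z ω) = Matrix.updateRow (Matrix.of fun i j => x i j ω) i 0 := by
      ext a j
      by_cases ha : a = i
      · subst ha; simp [Z]
      · simp [Z, ha]
    simp only [S, minorGram, this, normalizedRows_updateRow_zero]
  let F : (Fin p → Fin n → ℝ) → ℝ := fun e => √((realResolvent (S e) z).trace.im / z.im)
  have hFm : Measurable F := by
    refine Measurable.sqrt (Measurable.div_const (Complex.measurable_im.comp ?_) _)
    exact Finset.measurable_sum _ fun k _ => hRm k k
  have c1 := measureReal_random_quadForm_le (μ := μ) hst hK hV hZ hVZ hlaw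
    (B := fun e => (realResolvent (S e) z).map Complex.re)
    (fun k l => Complex.measurable_re.comp (hRm k l))
    (fun e => by rw [Matrix.IsSymm, ← Matrix.transpose_map, (realResolvent_isSymm (hSs e) z).eq])
    (one_div_pos.2 hz) (fun e => sqNormMulVec_re_le (hSs e) hz) hFm (fun e => Real.sqrt_nonneg _)
    (fun e => (frobSq_re_im_le (hSs e) hz).1) T
  have c2 := measureReal_random_quadForm_le (μ := μ) hst hK hV hZ hVZ hlaw
    (B := fun e => (realResolvent (S e) z).map Complex.im)
    (fun k l => Complex.measurable_im.comp (hRm k l))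
    (fun e => by rw [Matrix.IsSymm, ← Matrix.transpose_map, (realResolvent_isSymm (hSs e) z).eq])
    (one_div_pos.2 hz) (fun e => sqNormMulVec_im_le (hSs e) hz) hFm (fun e => Real.sqrt_nonneg _)
    (fun e => (frobSq_re_im_le (hSs e) hz).2) T
  have c3 := measureReal_random_quadForm_le (μ := μ) hst hK hV hZ hVZ hlaw
    (B := fun _ => (1 : Matrix (Fin n) (Fin n) ℝ)) (fun k l => measurable_const)
    (fun e => Matrix.isSymm_one) one_pos
    (fun e v => by simp [sqNormMulVec]) (F := fun _ => √n)
    measurable_const (fun e => Real.sqrt_nonneg _)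
    (fun e => by
      rw [Real.sq_sqrt (Nat.cast_nonneg n)]
      refine le_of_eq ?_
      simp [frobSq, Matrix.one_apply]) T
  set A1 := {ω | 32 * T * (K * F (Z ω) + K ^ 2 * (1 / z.im)) ≤
      |V ω ⬝ᵥ ((realResolvent (S (Z ω)) z).map Complex.re).mulVec (V ω) -
        ((realResolvent (S (Z ω)) z).map Complex.re).trace|}
  set A2 := {ω | 32 * T * (K * F (Z ω) + K ^ 2 * (1 / z.im)) ≤
      |V ω ⬝ᵥ ((realResolvent (S (Z ω)) z).map Complex.im).mulVec (V ω) -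
        ((realResolvent (S (Z ω)) z).map Complex.im).trace|}
  set A3 := {ω | 32 * T * (K * √n + K ^ 2 * 1) ≤
      |V ω ⬝ᵥ (1 : Matrix (Fin n) (Fin n) ℝ).mulVec (V ω) -
        (1 : Matrix (Fin n) (Fin n) ℝ).trace|}
  have hsub : {ω | ¬ RowConcentrated (Matrix.of fun i j => x i j ω) K T z i} ⊆ A1 ∪ A2 ∪ A3 := by
    intro ω hω
    by_contra hcon
    simp only [Set.mem_union, not_or] at hcon
    obtain ⟨⟨n1, n2⟩, n3⟩ := hcon
    simp only [A1, A2, A3, Set.mem_ofPred_eq, not_le] at n1 n2 n3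
    refine hω ⟨?_, ?_⟩
    · rw [← hSZ ω]
      refine (Complex.norm_le_abs_re_add_abs_im _).trans ?_
      rw [Complex.sub_re, Complex.sub_im, (resolventForm_re_im _ _ _).1,
        (resolventForm_re_im _ _ _).2]
      have t1 : ((realResolvent (S (Z ω)) z).map Complex.re).trace =
          (realResolvent (S (Z ω)) z).trace.re := by simp [Matrix.trace]
      have t2 : ((realResolvent (S (Z ω)) z).map Complex.im).trace =
          (realResolvent (S (Z ω)) z).trace.im := by simp [Matrix.trace]
      rw [t1] at n1
      rw [t2] at n2
      have e3 : K ^ 2 / z.im = K ^ 2 * (1 / z.im) := by ring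
      rw [e3]
      have := add_le_add n1.le n2.le
      refine this.trans (le_of_eq ?_)
      simp only [F]
      ring
    · have e1 : V ω ⬝ᵥ (1 : Matrix (Fin n) (Fin n) ℝ).mulVec (V ω) = ∑ j, x i j ω ^ 2 := by
        simp [dotProduct, V, sq]
      rw [e1, Matrix.trace_one, Fintype.card_fin, mul_one] at n3
      exact n3.le
  calc _ ≤ μ.real (A1 ∪ A2 ∪ A3) := measureReal_mono hsub
    _ ≤ μ.real (A1 ∪ A2) + μ.real A3 := measureReal_union_le _ _
    _ ≤ μ.real A1 + μ.real A2 + μ.real A3 := by gcongr; exact measureReal_union_le _ _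
    _ ≤ 3 * Real.exp (-T) + 3 * Real.exp (-T) + 3 * Real.exp (-T) := by gcongr
    _ = _ := by ring

end Rows

/-! ### The self-consistent equation -/

section SelfConsistent

variable {p n : ℕ}

/-- The normalised trace `m(z)` of the resolvent of the companion matrix `YᵀY`, where `Y` is the
row-normalised data matrix. -/
noncomputable def companionTransform (X : Matrix (Fin p) (Fin n) ℝ) (z : ℂ) : ℂ :=
  (realResolvent ((normalizedRows X).transpose * normalizedRows X) z).trace / n

/-- The quadratic form `y_iᵀ (Y_(i)ᵀ Y_(i) - z)⁻¹ y_i` of the `i`-th normalised row in the resolvent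
of the companion matrix of the other rows. -/
noncomputable def rowForm (X : Matrix (Fin p) (Fin n) ℝ) (z : ℂ) (i : Fin p) : ℂ :=
  resolventForm (minorGram (normalizedRows X) i) z (normalizedRows X i)

variable (X : Matrix (Fin p) (Fin n) ℝ) {z z' : ℂ}

theorem one_add_rowForm_ne_zero (hz : 0 < z.im) (i : Fin p) : 1 + rowForm X z i ≠ 0 :=
  one_add_resolventForm_ne_zero (minorGram_isSymm _ i) hz _

/-- The exact identity which becomes the self-consistent equation once `rowForm` is replaced by
`companionTransform`. -/
theorem one_add_mul_companionTransform (hn : 0 < n) (hz : 0 < z.im) :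
    1 + z * companionTransform X z = (∑ i, (1 - 1 / (1 + rowForm X z i))) / n := by
  have hn' : (n : ℂ) ≠ 0 := by exact_mod_cast hn.ne'
  have h := sum_resolventForm_rows (normalizedRows X) hz
  rw [Fintype.card_fin] at h
  rw [eq_div_iff hn', companionTransform]
  have e : (1 + z * ((realResolvent ((normalizedRows X).transpose * normalizedRows X) z).trace / n))
      * n = n + z * (realResolvent ((normalizedRows X).transpose * normalizedRows X) z).trace := by
    field_simp
  rw [e, ← h]
  refine Finset.sum_congr rfl fun i _ => ?_
  have h1 := resolventForm_rankOne (minorGram_isSymm (normalizedRows X) i) hz (normalizedRows X i)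
  have h2 := one_add_rowForm_ne_zero X hz i
  rw [minorGram_add_vecMulVec] at h1
  rw [← eq_div_of_mul_eq h2 h1]
  ring

theorem sum_normalizedRows_sq_le (i : Fin p) : ∑ j, normalizedRows X i j ^ 2 ≤ 1 := by
  simp only [normalizedRows, Matrix.of_apply, div_pow]
  have h0 : 0 ≤ ∑ l, X i l ^ 2 := Finset.sum_nonneg fun _ _ => sq_nonneg _
  rw [Real.sq_sqrt h0, ← Finset.sum_div]
  exact div_self_le_one _

theorem im_companionTransform_nonneg (hz : 0 < z.im) : 0 ≤ (companionTransform X z).im := by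
  rw [companionTransform, Complex.div_natCast_im]
  exact div_nonneg (im_trace_realResolvent_nonneg (isSymm_gram _) hz)
    (Nat.cast_nonneg n)

theorem norm_companionTransform_le (hn : 0 < n) (hz : 0 < z.im) :
    ‖companionTransform X z‖ ≤ 1 / z.im := by
  have hn' : (0 : ℝ) < n := by exact_mod_cast hn
  have h := norm_trace_realResolvent_le (isSymm_gram (normalizedRows X)) hz
  rw [Fintype.card_fin] at h
  rw [companionTransform, norm_div, Complex.norm_natCast, div_le_iff₀ hn']
  exact h.trans (le_of_eq (by ring))

theorem norm_companionTransform_sub_le (hn : 0 < n) (hz : 0 < z.im) (hz' : 0 < z'.im) :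
    ‖companionTransform X z - companionTransform X z'‖ ≤
      ‖z - z'‖ * ((1 / z.im) * (1 / z'.im)) := by
  have hn' : (0 : ℝ) < n := by exact_mod_cast hn
  have h := norm_trace_realResolvent_sub_le
    (isSymm_gram (normalizedRows X)) hz hz'
  rw [Fintype.card_fin] at h
  rw [companionTransform, companionTransform, ← sub_div, norm_div, Complex.norm_natCast,
    div_le_iff₀ hn']
  exact h.trans (le_of_eq (by ring))

theorem norm_rowForm_sub_le (hz : 0 < z.im) (hz' : 0 < z'.im) (i : Fin p) :
    ‖rowForm X z i - rowForm X z' i‖ ≤ ‖z - z'‖ * ((1 / z.im) * (1 / z'.im)) := by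
  refine (norm_resolventForm_sub_le (minorGram_isSymm (normalizedRows X) i) hz hz' _).trans ?_
  refine mul_le_mul_of_nonneg_left ?_ (norm_nonneg _)
  exact mul_le_of_le_one_right (by positivity) (sum_normalizedRows_sq_le X i)

theorem resolventForm_smul {ι : Type*} [Fintype ι] [DecidableEq ι] (S : Matrix ι ι ℝ) (z : ℂ)
    (c : ℝ) (v : ι → ℝ) : resolventForm S z (c • v) = (c : ℂ) ^ 2 * resolventForm S z v := by
  have : (fun i => ((c • v) i : ℂ)) = (c : ℂ) • fun i => (v i : ℂ) := by
    funext i; simp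
  rw [resolventForm, resolventVec, this, Matrix.mulVec_smul, dotProduct_smul, smul_dotProduct,
    resolventForm, resolventVec, smul_eq_mul, smul_eq_mul]
  ring

/-- The normalisation of row `i` enters its row form only through the squared length of the row. -/
theorem rowForm_eq (z : ℂ) (i : Fin p) : rowForm X z i =
    resolventForm (minorGram (normalizedRows X) i) z (X i) / ((∑ j, X i j ^ 2 : ℝ) : ℂ) := by
  have h0 : 0 ≤ ∑ l, X i l ^ 2 := Finset.sum_nonneg fun _ _ => sq_nonneg _
  have h1 : normalizedRows X i = (√(∑ l, X i l ^ 2))⁻¹ • X i := by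
    funext j
    simp [normalizedRows, div_eq_inv_mul]
  rw [rowForm, h1, resolventForm_smul, ← Complex.ofReal_pow, inv_pow, Real.sq_sqrt h0]
  push_cast
  ring

theorem norm_trace_minor_sub_le (hn : 0 < n) (hz : 0 < z.im) (i : Fin p) :
    ‖(realResolvent (minorGram (normalizedRows X) i) z).trace - n * companionTransform X z‖ ≤
      1 / z.im := by
  have hn' : (n : ℂ) ≠ 0 := by exact_mod_cast hn.ne'
  have h := norm_trace_realResolvent_rankOne_le (minorGram_isSymm (normalizedRows X) i) hz
    (normalizedRows X i)
  rw [minorGram_add_vecMulVec] at h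
  rwa [companionTransform, mul_div_cancel₀ _ hn']

set_option maxHeartbeats 1000000 in
/-- On the concentration event every row form is close to `m(z)`, with a relative error of
order `T K / √(n η)`. -/
theorem norm_rowForm_sub_companionTransform_le {K T : ℝ} (hK : 1 ≤ K) (hT : 1 ≤ T) (hn : 0 < n)
    (hz : 0 < z.im) (hz2 : z.im ≤ 2) {i : Fin p} (h : RowConcentrated X K T z i)
    (hg : 400 * T * (K / √(n * z.im)) ≤ 1) :
    ‖rowForm X z i - companionTransform X z‖ ≤
      400 * T * (K / √(n * z.im)) * (1 + ‖companionTransform X z‖) := by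
  have hn' : (0 : ℝ) < n := by exact_mod_cast hn
  set η := z.im with hη
  set g := K / √(n * η) with hgdef
  set m := companionTransform X z with hm
  set A := (realResolvent (minorGram (normalizedRows X) i) z).trace with hA
  set Q := resolventForm (minorGram (normalizedRows X) i) z (X i) with hQ
  set L := ∑ j, X i j ^ 2 with hL
  obtain ⟨h1, h2⟩ := h
  rw [← hA, ← hQ] at h1
  have hg0 : 0 < g := by positivity
  have hg2 : g ^ 2 = K ^ 2 / (n * η) := by rw [hgdef, div_pow, Real.sq_sqrt (by positivity)]
  have hg1 : g ≤ 1 := by nlinarith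
  have hgg : g ^ 2 ≤ g := by nlinarith
  have hTg : g ≤ T * g := by nlinarith
  have hK2 : K ≤ K ^ 2 := by nlinarith
  -- every error term divided by `n`, in terms of `g`
  have b1 : K ^ 2 / η = n * g ^ 2 := by rw [hg2]; field_simp
  have b2 : 1 / η ≤ n * g ^ 2 := by
    rw [← b1]; gcongr; nlinarith
  have b3 : K / η ≤ n * g ^ 2 := by rw [← b1]; gcongr
  have sq2 : √(n * η) ≤ 2 * √n := by
    rw [Real.sqrt_le_left (by positivity), mul_pow, Real.sq_sqrt hn'.le]
    nlinarith
  have sqn : √(n : ℝ) ^ 2 = n := Real.sq_sqrt hn'.le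
  have b4 : K * √n ≤ n * (2 * g) := by
    have : K = g * √(n * η) := by rw [hgdef]; field_simp
    calc K * √n = g * √(n * η) * √n := by rw [← this]
      _ ≤ g * (2 * √n) * √n := by gcongr
      _ = 2 * g * √(n : ℝ) ^ 2 := by ring
      _ = _ := by rw [sqn]; ring
  have b5 : K ^ 2 ≤ n * (2 * g ^ 2) := by
    have : K ^ 2 = n * g ^ 2 * η := by rw [← b1]; field_simp
    rw [this]
    have : 0 ≤ n * g ^ 2 := by positivity
    nlinarith
  have hAm := norm_trace_minor_sub_le X hn hz i
  rw [← hA, ← hm, ← hη] at hAm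
  have hmnn : 0 ≤ ‖m‖ := norm_nonneg m
  have hAim : A.im ≤ n * ‖m‖ + 1 / η := by
    have e1 : A.im ≤ ‖A‖ := (abs_le.1 (Complex.abs_im_le_norm A)).2
    have e2 : ‖A‖ ≤ ‖A - n * m‖ + ‖(n : ℂ) * m‖ := by
      have := norm_add_le (A - n * m) (n * m)
      simpa using this
    rw [norm_mul, Complex.norm_natCast] at e2
    linarith
  have b6 : K * √(A.im / η) ≤ n * (g * (1 + ‖m‖)) + n * g ^ 2 := by
    have e1 : A.im / η ≤ ((1 + ‖m‖) * √(n / η) + 1 / η) ^ 2 := by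
      have s1 : √(n / η) ^ 2 = n / η := Real.sq_sqrt (by positivity)
      have s2 : A.im / η ≤ n / η * ‖m‖ + (1 / η) ^ 2 := by
        rw [div_le_iff₀ hz]
        calc A.im ≤ _ := hAim
          _ = _ := by field_simp
      have s3 : n / η * ‖m‖ ≤ n / η * (1 + ‖m‖) ^ 2 :=
        mul_le_mul_of_nonneg_left (by nlinarith) (by positivity)
      have s4 : 0 ≤ 2 * ((1 + ‖m‖) * √(n / η)) * (1 / η) := by positivity
      nlinarith
    have e2 : √(A.im / η) ≤ (1 + ‖m‖) * √(n / η) + 1 / η :=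
      (Real.sqrt_le_left (by positivity)).2 e1
    have e3 : K * √(n / η) = n * g := by
      rw [hgdef, Real.sqrt_div' _ hz.le, Real.sqrt_mul hn'.le]
      have : √(n : ℝ) ≠ 0 := (Real.sqrt_pos.2 hn').ne'
      have : √η ≠ 0 := (Real.sqrt_pos.2 hz).ne'
      field_simp
      rw [sqn]
    calc K * √(A.im / η) ≤ K * ((1 + ‖m‖) * √(n / η) + 1 / η) := by gcongr
      _ = (1 + ‖m‖) * (K * √(n / η)) + K / η := by ring
      _ ≤ (1 + ‖m‖) * (n * g) + n * g ^ 2 := by rw [e3]; gcongr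
      _ = _ := by ring
  have hLn : |L - n| ≤ n * (128 * (T * g)) := by
    refine h2.trans ?_
    have : n * g ^ 2 ≤ n * g := mul_le_mul_of_nonneg_left hgg hn'.le
    have : K * √n + K ^ 2 ≤ n * (4 * g) := by linarith
    calc 32 * T * (K * √n + K ^ 2) ≤ 32 * T * (n * (4 * g)) := by gcongr
      _ = _ := by ring
  have hLge : n / 2 ≤ L := by
    have h3 := (abs_le.1 hLn).1
    have h4 : n * (400 * T * g) ≤ n * 1 := mul_le_mul_of_nonneg_left hg hn'.le
    linarith
  have hL0 : 0 < L := by linarith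
  have hnum : ‖Q - L * m‖ ≤ n * (200 * (T * g) * (1 + ‖m‖)) := by
    have e1 : Q - L * m = (Q - A) + (A - n * m) + ((n - L : ℝ) : ℂ) * m := by push_cast; ring
    have e2 : ‖((n - L : ℝ) : ℂ) * m‖ ≤ n * (128 * (T * g)) * ‖m‖ := by
      rw [norm_mul, Complex.norm_real, Real.norm_eq_abs, abs_sub_comm]
      gcongr
    have e3 : 64 * T * (K * √(A.im / η) + K ^ 2 / η) ≤
        64 * T * (n * (g * (1 + ‖m‖)) + n * g ^ 2 + n * g ^ 2) := by
      rw [b1]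
      gcongr
    have e4 : 64 * T * (n * (g * (1 + ‖m‖)) + n * g ^ 2 + n * g ^ 2) ≤
        n * (T * g * (64 * (1 + ‖m‖) + 128)) := by
      have : T * n * g ^ 2 ≤ T * n * g := mul_le_mul_of_nonneg_left hgg (by positivity)
      linarith
    have e5 : n * g ^ 2 ≤ n * (T * g) := by gcongr; linarith
    calc _ ≤ ‖Q - A‖ + ‖A - n * m‖ + ‖((n - L : ℝ) : ℂ) * m‖ := by
          rw [e1]; exact norm_add₃_le
      _ ≤ n * (T * g * (64 * (1 + ‖m‖) + 128)) + n * (T * g) + n * (128 * (T * g)) * ‖m‖ := by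
          linarith
      _ ≤ _ := by
          have : 0 ≤ n * (T * g) * ‖m‖ := by positivity
          have : 0 ≤ n * (T * g) := by positivity
          linarith
  rw [rowForm_eq, ← hQ, ← hL]
  have hLc : (L : ℂ) ≠ 0 := by exact_mod_cast hL0.ne'
  have e1 : Q / (L : ℂ) - m = (Q - L * m) / L := by field_simp
  rw [e1, norm_div, Complex.norm_real, Real.norm_eq_abs, abs_of_pos hL0, div_le_iff₀ hL0]
  refine hnum.trans ?_
  have : 200 * (T * g) * (1 + ‖m‖) * (2 * L) ≥ 200 * (T * g) * (1 + ‖m‖) * n :=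
    mul_le_mul_of_nonneg_left (by linarith) (by positivity)
  linarith

/-- If the row forms are relatively close to `m(z)` then `m(z)` is bounded: were it large, all
`1 / (1 + q_i)` would be bounded, and so would `1 + z m(z)`. -/
theorem norm_companionTransform_le_of_rowForm {e : ℝ} (he : e ≤ 1 / 8) (hn : 0 < n)
    (hpn : p ≤ n) (hz : 0 < z.im)
    (h : ∀ i, ‖rowForm X z i - companionTransform X z‖ ≤ e * (1 + ‖companionTransform X z‖)) :
    ‖companionTransform X z‖ ≤ 4 + 3 / ‖z‖ := by
  set m := companionTransform X z with hm
  have hn' : (0 : ℝ) < n := by exact_mod_cast hn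
  have hz0 : 0 < ‖z‖ := norm_pos_iff.2 fun h0 => by rw [h0] at hz; simp at hz
  by_contra hcon
  push Not at hcon
  have hm4 : 4 ≤ ‖m‖ := by
    have : 0 ≤ 3 / ‖z‖ := by positivity
    linarith
  -- for `|m| ≥ 4` and a relative error of `1 / 8`, every `1 + q_i` has modulus at least `1`
  have hterm : ∀ i, ‖1 - 1 / (1 + rowForm X z i)‖ ≤ 2 := by
    intro i
    have h1 : ‖m‖ ≤ ‖rowForm X z i - m‖ + ‖1 + rowForm X z i‖ + 1 := by
      have e1 : m = -(rowForm X z i - m) + (1 + rowForm X z i) + (-1) := by ring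
      calc ‖m‖ = ‖-(rowForm X z i - m) + (1 + rowForm X z i) + (-1)‖ := by rw [← e1]
        _ ≤ _ := norm_add₃_le
        _ = _ := by rw [norm_neg, norm_neg, norm_one]
    have h2 := h i
    have h3 : 1 ≤ ‖1 + rowForm X z i‖ := by nlinarith
    calc _ ≤ ‖(1 : ℂ)‖ + ‖1 / (1 + rowForm X z i)‖ := norm_sub_le _ _
      _ ≤ 1 + 1 := by
          rw [norm_one, norm_div, norm_one]
          gcongr
          rw [div_le_one (by linarith)]
          exact h3
      _ = 2 := by norm_num
  have h1 : ‖1 + z * m‖ ≤ 2 := by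
    rw [hm, one_add_mul_companionTransform X hn hz, norm_div, Complex.norm_natCast,
      div_le_iff₀ hn']
    calc _ ≤ ∑ _i : Fin p, (2 : ℝ) := norm_sum_le_of_le _ fun i _ => hterm i
      _ = p * 2 := by simp
      _ ≤ 2 * n := by
        have : (p : ℝ) ≤ n := by exact_mod_cast hpn
        linarith
  have h2 : ‖z‖ * ‖m‖ ≤ 3 := by
    rw [← norm_mul]
    have := norm_sub_le (1 + z * m) 1
    rw [add_sub_cancel_left, norm_one] at this
    linarith
  have h3 : ‖m‖ ≤ 3 / ‖z‖ := by rw [le_div_iff₀ hz0]; linarith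
  linarith

end SelfConsistent

/-! ### Stability of the self-consistent equation -/

section Stability

variable {p n : ℕ} (X : Matrix (Fin p) (Fin n) ℝ) {z : ℂ} {ε : ℝ}

/-- Averaging `1 / (1 + q_i)` gives `1 / (1 + m)` up to a relative error of order `ε / |1 + m|`. -/
theorem norm_avg_inv_sub_le (hp : 0 < p)
    (h : ∀ i, ‖rowForm X z i - companionTransform X z‖ ≤ ε)
    (hd : 0 < ‖1 + companionTransform X z‖) (hε : 4 * ε ≤ ‖1 + companionTransform X z‖) :
    ‖(∑ i, 1 / (1 + rowForm X z i)) / p - 1 / (1 + companionTransform X z)‖ ≤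
      4 / 3 * ε / ‖1 + companionTransform X z‖ ^ 2 := by
  set m := companionTransform X z with hm
  set d := ‖1 + m‖ with hdd
  have hp' : (0 : ℝ) < p := by exact_mod_cast hp
  have hpc : (p : ℂ) ≠ 0 := by exact_mod_cast hp.ne'
  have hm0 : 1 + m ≠ 0 := norm_pos_iff.1 hd
  have hterm : ∀ i, ‖1 / (1 + rowForm X z i) - 1 / (1 + m)‖ ≤ 4 / 3 * ε / d ^ 2 := by
    intro i
    have h1 : 3 / 4 * d ≤ ‖1 + rowForm X z i‖ := by
      have e1 : 1 + m = (1 + rowForm X z i) - (rowForm X z i - m) := by ring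
      have := norm_sub_le (1 + rowForm X z i) (rowForm X z i - m)
      rw [← e1, ← hdd] at this
      have := h i
      linarith
    have h2 : 0 < ‖1 + rowForm X z i‖ := by linarith [h1, hd]
    have h3 : 1 + rowForm X z i ≠ 0 := norm_pos_iff.1 h2
    have e2 : 1 / (1 + rowForm X z i) - 1 / (1 + m) =
        -(rowForm X z i - m) / ((1 + rowForm X z i) * (1 + m)) := by
      field_simp; ring
    rw [e2, norm_div, norm_neg, norm_mul, ← hdd]
    have hε0 : 0 ≤ ε := (norm_nonneg _).trans (h i)
    calc _ ≤ ε / (3 / 4 * d * d) := by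
          gcongr
          exact h i
      _ = _ := by field_simp
  have e : (∑ i, 1 / (1 + rowForm X z i)) / p - 1 / (1 + m) =
      (∑ i, (1 / (1 + rowForm X z i) - 1 / (1 + m))) / p := by
    rw [Finset.sum_sub_distrib]
    simp only [Finset.sum_const, Finset.card_univ, Fintype.card_fin, nsmul_eq_mul]
    field_simp
  rw [e, norm_div, Complex.norm_natCast, div_le_iff₀ hp']
  calc _ ≤ ∑ _i : Fin p, 4 / 3 * ε / d ^ 2 := norm_sum_le_of_le _ fun i _ => hterm i
    _ = _ := by simp; ring

/-- `one_add_mul_companionTransform` solved for the average of `1 / (1 + q_i)`. -/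
theorem mul_avg_inv_eq (hn : 0 < n) (hp : 0 < p) (hz : 0 < z.im) :
    ((p : ℂ) / n) * ((∑ i, 1 / (1 + rowForm X z i)) / p) =
      (p : ℂ) / n - 1 - z * companionTransform X z := by
  have h := one_add_mul_companionTransform X hn hz
  have hn' : (n : ℂ) ≠ 0 := by exact_mod_cast hn.ne'
  have hp' : (p : ℂ) ≠ 0 := by exact_mod_cast hp.ne'
  rw [Finset.sum_sub_distrib] at h
  simp only [Finset.sum_const, Finset.card_univ, Fintype.card_fin, nsmul_eq_mul, mul_one] at h
  have e : (p : ℂ) / n * ((∑ i, 1 / (1 + rowForm X z i)) / p) =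
      (∑ i, 1 / (1 + rowForm X z i)) / n := by field_simp
  rw [sub_div] at h
  rw [e]
  linear_combination h

/-- The value `m(z) = -1`, at which the self-consistent equation degenerates, is either very close
or far away. -/
theorem not_mem_gap (hn : 0 < n) (hp : 0 < p) (hpn : p ≤ n) (hz : 0 < z.im) {Z : ℝ} (hZ : 1 ≤ Z)
    (hzZ : ‖z‖ ≤ Z) (h : ∀ i, ‖rowForm X z i - companionTransform X z‖ ≤ ε)
    (hε : 4 * ε ≤ ‖1 + companionTransform X z‖) :
    ‖1 + companionTransform X z‖ ≠ (p / n : ℝ) / (2 * (1 + 2 * Z)) := by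
  intro hd
  set m := companionTransform X z with hm
  set c : ℝ := p / n with hc
  have hn' : (0 : ℝ) < n := by exact_mod_cast hn
  have hp' : (0 : ℝ) < p := by exact_mod_cast hp
  have hc0 : 0 < c := by positivity
  have hc1 : c ≤ 1 := by
    rw [hc, div_le_one hn']; exact_mod_cast hpn
  set d := ‖1 + m‖ with hdd
  have hd0 : 0 < d := by rw [hd]; positivity
  have hd1 : d ≤ 1 := by
    rw [hd, div_le_one (by positivity)]; linarith
  have h1 := norm_avg_inv_sub_le X hp h hd0 hε
  rw [← hm, ← hdd] at h1
  set a := (∑ i, 1 / (1 + rowForm X z i)) / p with ha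
  have h2 : 1 / d ≤ ‖a‖ + 1 / 3 / d := by
    have e1 : ‖1 / (1 + m)‖ = 1 / d := by rw [norm_div, norm_one]
    have e2 : ‖1 / (1 + m)‖ ≤ ‖a‖ + ‖a - 1 / (1 + m)‖ := by
      have := norm_sub_le a (a - 1 / (1 + m))
      rwa [sub_sub_cancel] at this
    have e3 : 4 / 3 * ε / d ^ 2 ≤ 1 / 3 / d := by
      rw [div_le_div_iff₀ (by positivity) hd0]
      nlinarith
    linarith
  have h3 : c * ‖a‖ ≤ 1 + 2 * Z := by
    have e1 := mul_avg_inv_eq X hn hp hz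
    have e0 : ‖(p : ℂ) / n‖ = c := by
      rw [norm_div, Complex.norm_natCast, Complex.norm_natCast]
    have e2 : c * ‖a‖ = ‖((p : ℂ) / n) * a‖ := by rw [norm_mul, e0]
    have hm2 : ‖m‖ ≤ 2 := by
      have := norm_sub_le (1 + m) 1
      rw [add_sub_cancel_left, norm_one] at this
      linarith
    have e3 : ‖(p : ℂ) / n - 1‖ ≤ 1 := by
      have : (p : ℂ) / n - 1 = ((c - 1 : ℝ) : ℂ) := by rw [hc]; push_cast; ring
      rw [this, Complex.norm_real, Real.norm_eq_abs, abs_le]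
      constructor <;> linarith
    rw [e2, ha, e1, ← hm]
    calc _ ≤ ‖(p : ℂ) / n - 1‖ + ‖z * m‖ := norm_sub_le _ _
      _ ≤ 1 + Z * 2 := by rw [norm_mul]; gcongr
      _ = _ := by ring
  have h4 : c * (2 / 3) ≤ (1 + 2 * Z) * d := by
    have : 2 / 3 ≤ ‖a‖ * d := by
      have e4 : 2 / 3 / d ≤ ‖a‖ := by
        have : 2 / 3 / d = 1 / d - 1 / 3 / d := by ring
        linarith
      rwa [div_le_iff₀ hd0] at e4
    calc c * (2 / 3) ≤ c * (‖a‖ * d) := by gcongr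
      _ = c * ‖a‖ * d := by ring
      _ ≤ _ := by gcongr
  have h5 : (1 + 2 * Z) * d = c / 2 := by rw [hd]; field_simp
  linarith

/-- The quadratic equation satisfied by `m(z)` up to a small error. -/
theorem norm_quadratic_companionTransform_le (hn : 0 < n) (hp : 0 < p) (hpn : p ≤ n)
    (hz : 0 < z.im) {d₀ : ℝ} (hd₀ : 0 < d₀) (hε0 : 0 ≤ ε) (hε : 4 * ε ≤ d₀)
    (h : ∀ i, ‖rowForm X z i - companionTransform X z‖ ≤ ε)
    (hd : d₀ ≤ ‖1 + companionTransform X z‖) :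
    ‖z * companionTransform X z ^ 2 + (z + 1 - p / n) * companionTransform X z + 1‖ ≤
      4 / 3 * ε / d₀ := by
  set m := companionTransform X z with hm
  have hn' : (0 : ℝ) < n := by exact_mod_cast hn
  have hc1 : (p / n : ℝ) ≤ 1 := by
    rw [div_le_one hn']; exact_mod_cast hpn
  have hd0 : 0 < ‖1 + m‖ := hd₀.trans_le hd
  have hm0 : 1 + m ≠ 0 := norm_pos_iff.1 hd0
  have h1 := norm_avg_inv_sub_le X hp h hd0 (hε.trans hd)
  rw [← hm] at h1
  have h2 := mul_avg_inv_eq X hn hp hz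
  rw [← hm] at h2
  set a := (∑ i, 1 / (1 + rowForm X z i)) / p with ha
  have e : z * m ^ 2 + (z + 1 - p / n) * m + 1 =
      -(((p : ℂ) / n) * (a - 1 / (1 + m)) * (1 + m)) := by
    have : (a - 1 / (1 + m)) * (1 + m) = a * (1 + m) - 1 := by field_simp
    rw [mul_assoc, this, mul_sub, ← mul_assoc, h2]
    ring
  rw [e, norm_neg, norm_mul, norm_mul, norm_div, Complex.norm_natCast, Complex.norm_natCast]
  calc _ ≤ 1 * (4 / 3 * ε / ‖1 + m‖ ^ 2) * ‖1 + m‖ := by gcongr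
    _ = 4 / 3 * ε / ‖1 + m‖ := by field_simp
    _ ≤ _ := by gcongr

/-- If the row forms are close to `m(z)` on a rectangle then `m(z)` stays away from `-1` there:
it does so at height `2`, and on the way down the continuous function `|1 + m|` cannot jump over the
gap. -/
theorem le_norm_one_add_companionTransform (hn : 0 < n) (hp : 0 < p) (hpn : p ≤ n) {E η₀ Z : ℝ}
    (hη₀ : 0 < η₀) (hη₂ : η₀ ≤ 2) (hZ : 1 ≤ Z)
    (hzZ : ∀ η ∈ Set.Icc η₀ 2, ‖(⟨E, η⟩ : ℂ)‖ ≤ Z)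
    (h : ∀ η ∈ Set.Icc η₀ 2, ∀ i,
      ‖rowForm X ⟨E, η⟩ i - companionTransform X ⟨E, η⟩‖ ≤ ε)
    (hε : 4 * ε ≤ (p / n : ℝ) / (2 * (1 + 2 * Z))) :
    (p / n : ℝ) / (2 * (1 + 2 * Z)) ≤ ‖1 + companionTransform X ⟨E, η₀⟩‖ := by
  set d₀ : ℝ := (p / n : ℝ) / (2 * (1 + 2 * Z)) with hd₀
  have hn' : (0 : ℝ) < n := by exact_mod_cast hn
  have hc1 : (p / n : ℝ) ≤ 1 := by
    rw [div_le_one hn']; exact_mod_cast hpn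
  by_contra hcon
  push Not at hcon
  have hcont : ContinuousOn (fun η : ℝ => ‖1 + companionTransform X ⟨E, η⟩‖) (Set.Icc η₀ 2) := by
    refine ContinuousOn.norm (continuousOn_const.add ?_)
    have : LipschitzOnWith (Real.toNNReal ((1 / η₀) * (1 / η₀)))
        (fun η : ℝ => companionTransform X ⟨E, η⟩) (Set.Icc η₀ 2) := by
      refine LipschitzOnWith.of_dist_le_mul fun s hs t ht => ?_
      have hs0 : 0 < s := hη₀.trans_le hs.1
      have ht0 : 0 < t := hη₀.trans_le ht.1
      rw [dist_eq_norm, Real.coe_toNNReal _ (by positivity), Real.dist_eq]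
      refine (norm_companionTransform_sub_le X (z := ⟨E, s⟩) (z' := ⟨E, t⟩) hn hs0 ht0).trans ?_
      have e : (⟨E, s⟩ : ℂ) - ⟨E, t⟩ = ((s - t : ℝ) : ℂ) * Complex.I := by
        apply Complex.ext <;> simp
      rw [e, norm_mul, Complex.norm_I, Complex.norm_real, Real.norm_eq_abs, mul_one, mul_comm]
      gcongr
      · exact hs.1
      · exact ht.1
    exact this.continuousOn
  -- at height `2` the trivial bound gives `|m| ≤ 1 / 2`
  have htop : d₀ ≤ ‖1 + companionTransform X ⟨E, 2⟩‖ := by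
    have h1 := norm_companionTransform_le X (z := ⟨E, 2⟩) hn (by norm_num)
    have h2 := norm_sub_le (1 + companionTransform X ⟨E, 2⟩) (companionTransform X ⟨E, 2⟩)
    rw [add_sub_cancel_right, norm_one] at h2
    have h3 : d₀ ≤ 1 / 6 := by
      rw [hd₀, div_le_iff₀ (by positivity)]; linarith
    simp only at h1
    linarith
  obtain ⟨η, hη, hval⟩ := intermediate_value_Icc hη₂ hcont ⟨hcon.le, htop⟩
  have hη0 : 0 < η := hη₀.trans_le hη.1
  refine not_mem_gap X (z := ⟨E, η⟩) hn hp hpn hη0 hZ (hzZ η hη) (h η hη) ?_ hval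
  exact hε.trans hval.ge

end Stability

/-! ### Roots of the Marchenko–Pastur quadratic polynomial -/

section QuadraticRoot

/-- A point of the closed upper half-plane at which the Marchenko–Pastur quadratic polynomial is
small has nearly the imaginary part of the density. No information on the real part is needed: in
the bulk the two roots are complex conjugate, and outside it they are real. -/
theorem abs_im_sub_mpDensity_le {y E κ : ℝ} (hy : 0 < y) (hE : 0 < E) {w : ℂ} (hw : 0 ≤ w.im)
    (h : ‖(E : ℂ) * w ^ 2 + (E + 1 - y) * w + 1‖ ≤ κ) :
    |w.im - Real.pi * y * mpDensity y E| ≤ √(κ / E) := by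
  set s : ℝ := √y with hs
  have hs2 : s ^ 2 = y := Real.sq_sqrt hy.le
  have hs0 : 0 < s := Real.sqrt_pos.2 hy
  have hprod : (mpUpper y - E) * (E - mpLower y) = 4 * E - (E + 1 - y) ^ 2 := by
    rw [mpUpper, mpLower, ← hs]; rw [← hs2]; ring
  set u : ℝ := w.re + (E + 1 - y) / (2 * E) with hu
  set v : ℝ := w.im with hv
  -- completing the square
  have hsq : ∀ D : ℂ, D ^ 2 = (((E + 1 - y) ^ 2 - 4 * E) / (4 * E ^ 2) : ℝ) →
      ‖(⟨u, v⟩ : ℂ) - D‖ * ‖(⟨u, v⟩ : ℂ) + D‖ ≤ κ / E := by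
    intro D hD
    have hEc : (E : ℂ) ≠ 0 := by exact_mod_cast hE.ne'
    have e0 : (⟨u, v⟩ : ℂ) = w + (((E + 1 - y) / (2 * E) : ℝ) : ℂ) := by
      apply Complex.ext
      · rw [Complex.add_re, Complex.ofReal_re]
      · rw [Complex.add_im, Complex.ofReal_im, add_zero]
    have e1 : ((⟨u, v⟩ : ℂ) - D) * ((⟨u, v⟩ : ℂ) + D) =
        ((E : ℂ) * w ^ 2 + (E + 1 - y) * w + 1) / E := by
      have : ((⟨u, v⟩ : ℂ) - D) * ((⟨u, v⟩ : ℂ) + D) = (⟨u, v⟩ : ℂ) ^ 2 - D ^ 2 := by ring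
      rw [this, hD, e0]
      push_cast
      field_simp
      ring
    rw [← norm_mul, e1, norm_div, Complex.norm_real, Real.norm_eq_abs, abs_of_pos hE]
    gcongr
  by_cases hmem : E ∈ Set.Icc (mpLower y) (mpUpper y)
  -- in the bulk the roots have imaginary parts `±r`, and `v + r ≥ |v - r|`
  · set P := (mpUpper y - E) * (E - mpLower y) with hP
    have hP0 : 0 ≤ P := mul_nonneg (sub_nonneg.2 hmem.2) (sub_nonneg.2 hmem.1)
    set r : ℝ := √P / (2 * E) with hr
    have hr0 : 0 ≤ r := by positivity
    have hdens : Real.pi * y * mpDensity y E = r := by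
      rw [mpDensity, Set.indicator_of_mem hmem, ← hP, hr]
      have := Real.pi_pos.ne'
      field_simp
    have hr2 : r ^ 2 = P / (4 * E ^ 2) := by
      rw [hr, div_pow, Real.sq_sqrt hP0]; ring
    have h1 := hsq ((r : ℂ) * Complex.I) (by
      rw [mul_pow, Complex.I_sq, ← Complex.ofReal_pow, hr2, hprod]
      push_cast; ring)
    have i1 : |v - r| ≤ ‖(⟨u, v⟩ : ℂ) - (r : ℂ) * Complex.I‖ := by
      have := Complex.abs_im_le_norm ((⟨u, v⟩ : ℂ) - (r : ℂ) * Complex.I)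
      simpa using this
    have i2 : |v + r| ≤ ‖(⟨u, v⟩ : ℂ) + (r : ℂ) * Complex.I‖ := by
      have := Complex.abs_im_le_norm ((⟨u, v⟩ : ℂ) + (r : ℂ) * Complex.I)
      simpa using this
    have i3 : |v - r| ≤ |v + r| := by
      rw [abs_of_nonneg (add_nonneg hw hr0), abs_le]
      constructor <;> linarith
    rw [hdens]
    refine Real.le_sqrt_of_sq_le ?_
    calc |v - r| ^ 2 = |v - r| * |v - r| := sq _
      _ ≤ ‖(⟨u, v⟩ : ℂ) - (r : ℂ) * Complex.I‖ * ‖(⟨u, v⟩ : ℂ) + (r : ℂ) * Complex.I‖ :=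
          mul_le_mul i1 (i3.trans i2) (abs_nonneg _) (norm_nonneg _)
      _ ≤ _ := h1
  -- outside the bulk both roots are real, at distance at least `v` from the point
  · have hdens : mpDensity y E = 0 := Set.indicator_of_notMem hmem _
    have hab : mpLower y ≤ mpUpper y := by
      rw [mpLower, mpUpper, ← hs]; nlinarith
    have hP0 : 0 ≤ (E + 1 - y) ^ 2 - 4 * E := by
      have : (mpUpper y - E) * (E - mpLower y) ≤ 0 := by
        rw [Set.mem_Icc, not_and_or, not_le, not_le] at hmem
        rcases hmem with h1 | h1
        · exact mul_nonpos_of_nonneg_of_nonpos (by linarith) (by linarith)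
        · exact mul_nonpos_of_nonpos_of_nonneg (by linarith) (by linarith)
      linarith
    set r : ℝ := √(((E + 1 - y) ^ 2 - 4 * E) / (4 * E ^ 2)) with hr
    have h1 := hsq (r : ℂ) (by
      rw [← Complex.ofReal_pow, hr, Real.sq_sqrt (by positivity)])
    have i1 : |v| ≤ ‖(⟨u, v⟩ : ℂ) - (r : ℂ)‖ := by
      have := Complex.abs_im_le_norm ((⟨u, v⟩ : ℂ) - (r : ℂ))
      simpa using this
    have i2 : |v| ≤ ‖(⟨u, v⟩ : ℂ) + (r : ℂ)‖ := by
      have := Complex.abs_im_le_norm ((⟨u, v⟩ : ℂ) + (r : ℂ))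
      simpa using this
    rw [hdens, mul_zero, sub_zero]
    refine Real.le_sqrt_of_sq_le ?_
    rw [sq]
    exact (mul_le_mul i1 i2 (abs_nonneg _) (norm_nonneg _)).trans h1

end QuadraticRoot

/-! ### The Marchenko–Pastur density -/

section Density

variable {y : ℝ}

theorem mpLower_pos (hy1 : y < 1) : 0 < mpLower y := by
  have : √y < 1 := by rw [Real.sqrt_lt' one_pos]; simpa using hy1
  exact pow_pos (sub_pos.2 this) 2

theorem mpUpper_le_four (hy1 : y < 1) : mpUpper y ≤ 4 := by
  have h : √y ≤ 1 := Real.sqrt_le_one.2 hy1.le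
  have h0 := Real.sqrt_nonneg y
  rw [mpUpper]; nlinarith

theorem one_le_mpUpper (y : ℝ) : 1 ≤ mpUpper y := by
  have h0 := Real.sqrt_nonneg y
  rw [mpUpper]; nlinarith

theorem mpLower_le_one (hy : 0 < y) (hy1 : y < 1) : mpLower y ≤ 1 := by
  have h : √y ≤ 1 := Real.sqrt_le_one.2 hy1.le
  have h0 := Real.sqrt_nonneg y
  rw [mpLower]; nlinarith

theorem mpDensity_nonneg (hy : 0 < y) {t : ℝ} (ht : 0 < t) : 0 ≤ mpDensity y t := by
  rw [mpDensity, Set.indicator_apply]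
  split_ifs
  · have := Real.pi_pos; positivity
  · exact le_rfl

theorem pi_mul_mpDensity_le (hy : 0 < y) (hy1 : y < 1) {E₀ t : ℝ} (hE₀ : 0 < E₀) (ht : E₀ ≤ t) :
    Real.pi * mpDensity y t ≤ 2 / (E₀ * y) := by
  have ht0 := hE₀.trans_le ht
  rw [mpDensity, Set.indicator_apply]
  split_ifs with h
  · have h1 : √((mpUpper y - t) * (t - mpLower y)) ≤ 4 := by
      rw [Real.sqrt_le_left (by norm_num)]
      have := mpUpper_le_four hy1
      have := mpLower_pos hy1
      nlinarith [h.1, h.2]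
    have hpi := Real.pi_pos
    calc Real.pi * (1 / (2 * Real.pi * t * y) * √((mpUpper y - t) * (t - mpLower y)))
        = √((mpUpper y - t) * (t - mpLower y)) / (2 * (t * y)) := by field_simp
      _ ≤ 4 / (2 * (E₀ * y)) := by gcongr
      _ = _ := by ring
  · rw [mul_zero]; positivity

theorem integrable_mpDensity (hy : 0 < y) (hy1 : y < 1) : Integrable (mpDensity y) := by
  have h : ContinuousOn (fun x => 1 / (2 * Real.pi * x * y) *
      √((mpUpper y - x) * (x - mpLower y))) (Set.Icc (mpLower y) (mpUpper y)) := by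
    refine ContinuousOn.mul (ContinuousOn.div continuousOn_const (by fun_prop) ?_) (by fun_prop)
    intro x hx
    have : 0 < x := (mpLower_pos hy1).trans_le hx.1
    have := Real.pi_pos
    positivity
  exact (h.integrableOn_compact isCompact_Icc).integrable_indicator measurableSet_Icc

end Density

/-! ### The smoothed spectral density -/

section SpectralDensity

variable {p n : ℕ} (X : Matrix (Fin p) (Fin n) ℝ)

/-- The sum over the points `ev i` of the Poisson kernels of width `η`, without the factor `π⁻¹`:
`π` times the smoothed counting measure. -/
noncomputable def poissonSum {α : Type*} [Fintype α] (ev : α → ℝ) (η E : ℝ) : ℝ :=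
  ∑ i, η / ((ev i - E) ^ 2 + η ^ 2)

theorem im_trace_realResolvent_eq_poissonSum {α : Type*} [Fintype α] [DecidableEq α]
    {W : Matrix α α ℝ} (hW : W.IsHermitian) {E η : ℝ} (hη : 0 < η) :
    (realResolvent W ⟨E, η⟩).trace.im = poissonSum hW.eigenvalues η E := by
  rw [trace_realResolvent_eq_sum_eigenvalues hW (z := ⟨E, η⟩) hη, Complex.im_sum, poissonSum]
  refine Finset.sum_congr rfl fun i _ => ?_
  rw [one_div, Complex.inv_im, Complex.normSq_apply]
  simp
  ring

/-- The smoothed spectral density of `YYᵀ` in terms of `m(z)`; the last term removes the `n - p`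
additional zero eigenvalues of `YᵀY`. -/
theorem poissonSum_eigenvalues_eq (hn : 0 < n) {E η : ℝ} (hη : 0 < η) :
    poissonSum (sampleCorrelation_isHermitian X).eigenvalues η E =
      n * (companionTransform X ⟨E, η⟩).im - (n - p) * (η / (E ^ 2 + η ^ 2)) := by
  have hn' : (n : ℂ) ≠ 0 := by exact_mod_cast hn.ne'
  have hz : 0 < (⟨E, η⟩ : ℂ).im := hη
  have hz0 : (⟨E, η⟩ : ℂ) ≠ 0 := fun h => by
    have := congrArg Complex.im h
    simp at this; exact hη.ne' this
  rw [← im_trace_realResolvent_eq_poissonSum _ hη]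
  have h := card_add_trace_realResolvent (normalizedRows X) hz
  rw [Fintype.card_fin, Fintype.card_fin] at h
  have h2 : (realResolvent (sampleCorrelation X) ⟨E, η⟩).trace =
      n * companionTransform X ⟨E, η⟩ + ((n - p : ℝ) : ℂ) * (⟨E, η⟩ : ℂ)⁻¹ := by
    rw [companionTransform, mul_div_cancel₀ _ hn', sampleCorrelation]
    push_cast
    field_simp
    linear_combination h
  rw [h2, Complex.add_im, Complex.im_ofReal_mul, Complex.inv_im, Complex.normSq_apply,
    ← Complex.ofReal_natCast, Complex.im_ofReal_mul]
  ring

set_option maxHeartbeats 1000000 in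
/-- **Local law for the smoothed spectral density.** If all row forms are close to `m(z)` on a
rectangle, the smoothed spectral density on the bottom side is close to the Marchenko–Pastur
density; the square root accounts for the spectral edges. -/
theorem exists_abs_poissonSum_sub_le {y : ℝ} (hy : 0 < y) (hy1 : y < 1) {E₀ Z M : ℝ} (hE₀ : 0 < E₀)
    (hZ : 1 ≤ Z) (hM : 0 ≤ M) :
    ∃ C : ℝ, 0 < C ∧ ∀ (p n : ℕ) (X : Matrix (Fin p) (Fin n) ℝ) (E₁ η ε : ℝ),
      0 < n → 0 < p → p ≤ n → y / 2 ≤ (p / n : ℝ) → 0 < η → η ≤ 2 → 0 ≤ ε →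
      4 * ε ≤ y / (4 * (1 + 2 * Z)) → ε + η + |(p / n : ℝ) - y| ≤ 1 →
      (∀ z : ℂ, z.re ∈ Set.Icc E₀ E₁ → z.im ∈ Set.Icc η 2 → ‖z‖ ≤ Z ∧
        ‖companionTransform X z‖ ≤ M ∧ ∀ i, ‖rowForm X z i - companionTransform X z‖ ≤ ε) →
      ∀ E ∈ Set.Icc E₀ E₁,
        |poissonSum (sampleCorrelation_isHermitian X).eigenvalues η E -
            p * (Real.pi * mpDensity y E)| ≤
          p * (C * √(ε + η + |(p / n : ℝ) - y|)) := by
  set d₁ : ℝ := y / (4 * (1 + 2 * Z)) with hd₁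
  have hd₁0 : 0 < d₁ := by positivity
  set C₁ : ℝ := 4 / 3 / d₁ + (M ^ 2 + M) with hC₁
  have hC₁0 : 0 < C₁ := by positivity
  refine ⟨2 / y * (√(C₁ / E₀) + 2 / (E₀ * y) + 1 / E₀ ^ 2), by positivity, ?_⟩
  intro p n X E₁ η ε hn hp hpn hcy hη hη2 hε hεd hθ hrow E hE
  have hn' : (0 : ℝ) < n := by exact_mod_cast hn
  have hp' : (0 : ℝ) < p := by exact_mod_cast hp
  have hE0 : 0 < E := hE₀.trans_le hE.1
  set c : ℝ := p / n with hc
  have hc0 : 0 < c := by positivity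
  have hc1 : c ≤ 1 := by rw [hc, div_le_one hn']; exact_mod_cast hpn
  -- `d₀` is the lower bound for `|1 + m|`, and `d₁` bounds it below independently of `p` and `n`
  set d₀ : ℝ := c / (2 * (1 + 2 * Z)) with hd₀
  have hd : d₁ ≤ d₀ := by
    rw [hd₀, hd₁, div_le_div_iff₀ (by positivity) (by positivity)]
    nlinarith
  set θ := ε + η + |c - y| with hθd
  have hθ0 : 0 < θ := by positivity
  have hr := hrow ⟨E, η⟩ hE ⟨le_rfl, hη2⟩
  have hgap : d₀ ≤ ‖1 + companionTransform X ⟨E, η⟩‖ :=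
    le_norm_one_add_companionTransform X hn hp hpn hη hη2 hZ
      (fun t ht => (hrow ⟨E, t⟩ hE ht).1) (fun t ht => (hrow ⟨E, t⟩ hE ht).2.2) (hεd.trans hd)
  have hquad := norm_quadratic_companionTransform_le X (z := ⟨E, η⟩) hn hp hpn hη
    (hd₁0.trans_le hd) hε (hεd.trans hd) hr.2.2 hgap
  set m := companionTransform X ⟨E, η⟩ with hm
  have hmM : ‖m‖ ≤ M := hr.2.1
  -- replace `z` by `E` and `p / n` by `y` in the quadratic equation
  have hκ : ‖(E : ℂ) * m ^ 2 + (E + 1 - y) * m + 1‖ ≤ C₁ * θ := by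
    have e1 : (E : ℂ) * m ^ 2 + (E + 1 - y) * m + 1 =
        ((⟨E, η⟩ : ℂ) * m ^ 2 + ((⟨E, η⟩ : ℂ) + 1 - p / n) * m + 1) +
        (-((η : ℂ) * Complex.I * (m ^ 2 + m))) + ((c - y : ℝ) : ℂ) * m := by
      have : (⟨E, η⟩ : ℂ) = E + η * Complex.I := by apply Complex.ext <;> simp
      rw [this, hc]; push_cast; ring
    have e2 : ‖(η : ℂ) * Complex.I * (m ^ 2 + m)‖ ≤ η * (M ^ 2 + M) := by
      rw [norm_mul, norm_mul, Complex.norm_I, Complex.norm_real, Real.norm_eq_abs, abs_of_pos hη,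
        mul_one]
      gcongr
      refine (norm_add_le _ _).trans ?_
      rw [norm_pow]; gcongr
    have e3 : ‖((c - y : ℝ) : ℂ) * m‖ ≤ |c - y| * M := by
      rw [norm_mul, Complex.norm_real, Real.norm_eq_abs]; gcongr
    have e4 : 4 / 3 * ε / d₀ ≤ 4 / 3 / d₁ * ε := by
      calc 4 / 3 * ε / d₀ ≤ 4 / 3 * ε / d₁ := by gcongr
        _ = _ := by ring
    calc _ ≤ 4 / 3 / d₁ * ε + η * (M ^ 2 + M) + |c - y| * M := by
          rw [e1]
          refine norm_add₃_le.trans ?_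
          rw [norm_neg]
          exact add_le_add (add_le_add (hquad.trans e4) e2) e3
      _ ≤ _ := by
          rw [hC₁, hθd]
          have h1 : 0 ≤ 4 / 3 / d₁ := by positivity
          have h2 : 0 ≤ |c - y| := abs_nonneg _
          have h3 := mul_nonneg h1 hη.le
          have h4 := mul_nonneg h1 h2
          have h5 := mul_nonneg hε (sq_nonneg M)
          have h6 := mul_nonneg hε hM
          have h7 := mul_nonneg h2 (sq_nonneg M)
          linarith
  have him := abs_im_sub_mpDensity_le hy hE0
    (im_companionTransform_nonneg X (z := ⟨E, η⟩) hη) hκ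
  rw [← hm] at him
  have hsq : √(C₁ * θ / E) ≤ √(C₁ / E₀) * √θ := by
    rw [← Real.sqrt_mul (by positivity)]
    refine Real.sqrt_le_sqrt ?_
    rw [div_mul_eq_mul_div]
    gcongr
    exact hE.1
  have hθs : θ ≤ √θ := by
    rw [Real.le_sqrt hθ0.le hθ0.le]
    nlinarith
  rw [poissonSum_eigenvalues_eq X hn hη, ← hm]
  set R := Real.pi * mpDensity y E with hR
  have hRnn : 0 ≤ R := mul_nonneg Real.pi_pos.le (mpDensity_nonneg hy hE0)
  have hRle : R ≤ 2 / (E₀ * y) := pi_mul_mpDensity_le hy hy1 hE₀ hE.1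
  have hnc : (n : ℝ) = p / c := by rw [hc]; field_simp
  have hexp : n * m.im - (n - p) * (η / (E ^ 2 + η ^ 2)) - p * R =
      p * (1 / c * ((m.im - Real.pi * y * mpDensity y E) - (1 - c) * (η / (E ^ 2 + η ^ 2)) -
        (c - y) * R)) := by
    rw [hnc, hR]; field_simp; ring
  rw [hexp, abs_mul, abs_of_pos hp', abs_mul, abs_of_pos (show 0 < 1 / c by positivity)]
  refine mul_le_mul_of_nonneg_left ?_ hp'.le
  have h1c : 1 / c ≤ 2 / y := by
    rw [div_le_div_iff₀ hc0 hy]; linarith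
  have t2 : |(1 - c) * (η / (E ^ 2 + η ^ 2))| ≤ 1 / E₀ ^ 2 * √θ := by
    rw [abs_mul, abs_of_nonneg (sub_nonneg.2 hc1), abs_of_pos (by positivity)]
    have hEE : E₀ ^ 2 ≤ E ^ 2 + η ^ 2 := by
      have := pow_le_pow_left₀ hE₀.le hE.1 2
      have := sq_nonneg η
      linarith
    have hc01 : 1 - c ≤ 1 := by linarith
    calc (1 - c) * (η / (E ^ 2 + η ^ 2)) ≤ 1 * (η / E₀ ^ 2) := by gcongr
      _ = 1 / E₀ ^ 2 * η := by ring
      _ ≤ _ := by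
        gcongr
        refine le_trans ?_ hθs
        rw [hθd]; linarith [abs_nonneg (c - y)]
  have t3 : |(c - y) * R| ≤ 2 / (E₀ * y) * √θ := by
    rw [abs_mul, abs_of_nonneg hRnn, mul_comm]
    gcongr
    refine le_trans ?_ hθs
    rw [hθd]; linarith
  calc _ ≤ 2 / y * (√(C₁ / E₀) * √θ + 1 / E₀ ^ 2 * √θ + 2 / (E₀ * y) * √θ) := by
        gcongr
        refine (abs_sub _ _).trans (add_le_add ((abs_sub _ _).trans (add_le_add ?_ t2)) t3)
        exact him.trans hsq
    _ = _ := by ring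

end SpectralDensity

/-! ### Counting points from a smoothed density -/

section Counting

/-- The weight `η / (|u| + η)`, which bounds the error of the Poisson smoothing of a half-line at
distance `u` from its endpoint. -/
noncomputable def edgeWeight (η u : ℝ) : ℝ := η / (|u| + η)

theorem continuous_edgeWeight {η : ℝ} (hη : 0 < η) : Continuous (edgeWeight η) := by
  unfold edgeWeight
  exact continuous_const.div (by fun_prop) fun u => by positivity

theorem continuous_poissonKernel {η : ℝ} (hη : 0 < η) (x : ℝ) :
    Continuous fun E : ℝ => η / ((x - E) ^ 2 + η ^ 2) :=
  continuous_const.div (by fun_prop) fun u => by positivity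

theorem integral_edgeWeight {η r : ℝ} (hη : 0 < η) (hr : 0 ≤ r) :
    ∫ t in (-r)..r, edgeWeight η t = 2 * η * Real.log (1 + r / η) := by
  have hint : ∀ a b, IntervalIntegrable (edgeWeight η) volume a b := fun a b =>
    (continuous_edgeWeight hη).intervalIntegrable a b
  have h1 : ∫ t in (0 : ℝ)..r, edgeWeight η t = η * Real.log (1 + r / η) := by
    have e1 : ∫ t in (0 : ℝ)..r, edgeWeight η t = ∫ t in (0 : ℝ)..r, η * (t + η)⁻¹ := by
      refine intervalIntegral.integral_congr fun t ht => ?_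
      rw [Set.uIcc_of_le hr] at ht
      simp only [edgeWeight, abs_of_nonneg ht.1]
      rw [div_eq_mul_inv]
    rw [e1, intervalIntegral.integral_const_mul,
      intervalIntegral.integral_comp_add_right (fun t => t⁻¹), zero_add,
      integral_inv_of_pos hη (by linarith)]
    congr 2
    field_simp
    ring
  have h2 : ∫ t in (-r)..0, edgeWeight η t = ∫ t in (0 : ℝ)..r, edgeWeight η t := by
    have := intervalIntegral.integral_comp_neg (a := 0) (b := r) (edgeWeight η)
    rw [neg_zero] at this
    rw [← this]
    refine intervalIntegral.integral_congr fun t _ => ?_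
    simp [edgeWeight]
  rw [← intervalIntegral.integral_add_adjacent_intervals (hint _ 0) (hint 0 _), h2, h1]
  ring

/-- The edge weight is reproduced, up to a factor, by convolving it with the Poisson kernel. -/
theorem edgeWeight_le {η r : ℝ} (hη : 0 < η) (hr : 2 * η ≤ r) (x : ℝ) :
    edgeWeight η x ≤
      2 * (∫ t in (-r)..r, edgeWeight η t * (η / ((x - t) ^ 2 + η ^ 2))) + 2 * η / r := by
  have hr0 : 0 < r := by linarith
  have hcont : Continuous fun t => edgeWeight η t * (η / ((x - t) ^ 2 + η ^ 2)) :=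
    (continuous_edgeWeight hη).mul (continuous_poissonKernel hη x)
  have hnn : ∀ t, 0 ≤ edgeWeight η t * (η / ((x - t) ^ 2 + η ^ 2)) := fun t => by
    unfold edgeWeight; positivity
  by_cases hx : r / 2 ≤ |x|
  · have h1 : edgeWeight η x ≤ 2 * η / r := by
      rw [edgeWeight, div_le_div_iff₀ (by positivity) hr0]
      nlinarith
    have h2 : 0 ≤ ∫ t in (-r)..r, edgeWeight η t * (η / ((x - t) ^ 2 + η ^ 2)) :=
      intervalIntegral.integral_nonneg (by linarith) fun t _ => hnn t
    linarith
  · push Not at hx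
    have hx' := abs_lt.1 hx
    have h1 : ∫ t in (x - η)..(x + η), edgeWeight η t * (η / ((x - t) ^ 2 + η ^ 2)) ≤
        ∫ t in (-r)..r, edgeWeight η t * (η / ((x - t) ^ 2 + η ^ 2)) := by
      refine intervalIntegral.integral_mono_interval (by linarith) (by linarith) (by linarith)
        (Eventually.of_forall hnn) (hcont.intervalIntegrable _ _)
    have h2 : ∫ t in (x - η)..(x + η), edgeWeight η x / 2 * (1 / (2 * η)) ≤
        ∫ t in (x - η)..(x + η), edgeWeight η t * (η / ((x - t) ^ 2 + η ^ 2)) := by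
      refine intervalIntegral.integral_mono_on (by linarith) (by simp)
        (hcont.intervalIntegrable _ _) fun t ht => ?_
      have ht2 : (x - t) ^ 2 ≤ η ^ 2 := by nlinarith [ht.1, ht.2]
      refine mul_le_mul ?_ ?_ (by positivity) (by unfold edgeWeight; positivity)
      · have hta : |t| ≤ |x| + η := by
          have h3 : |t - x| ≤ η := abs_le.2 ⟨by linarith [ht.1], by linarith [ht.2]⟩
          have h4 := abs_add_le (t - x) x
          rw [sub_add_cancel] at h4
          linarith
        rw [edgeWeight, edgeWeight, div_div, div_le_div_iff_of_pos_left hη (by positivity) (by positivity)]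
        linarith [abs_nonneg x]
      · rw [div_le_div_iff₀ (by positivity) (by positivity)]
        nlinarith
    rw [intervalIntegral.integral_const, smul_eq_mul] at h2
    have h3 : (x + η - (x - η)) * (edgeWeight η x / 2 * (1 / (2 * η))) = edgeWeight η x / 2 := by
      field_simp; ring
    rw [h3] at h2
    have : 0 ≤ 2 * η / r := by positivity
    linarith

/-- The Poisson mass beyond distance `u` is at most the edge weight at `u`. -/
theorem pi_div_two_sub_arctan_le {η u : ℝ} (hη : 0 < η) (hu : 0 ≤ u) :
    Real.pi / 2 - Real.arctan (u / η) ≤ Real.pi * edgeWeight η u := by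
  have hpi := Real.pi_gt_three
  rw [edgeWeight, abs_of_nonneg hu]
  by_cases h : u ≤ η
  · have h1 : 0 ≤ Real.arctan (u / η) := Real.arctan_nonneg.2 (by positivity)
    have h2 : 1 / 2 ≤ η / (u + η) := by
      rw [div_le_div_iff₀ (by norm_num) (by positivity)]; linarith
    nlinarith
  · push Not at h
    have hu0 : 0 < u := hη.trans h
    have h1 := Real.arctan_inv_of_pos (show 0 < u / η by positivity)
    have h2 : Real.arctan (u / η)⁻¹ ≤ (u / η)⁻¹ := by
      have h3 : 0 ≤ Real.arctan (u / η)⁻¹ := Real.arctan_nonneg.2 (by positivity)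
      calc _ ≤ Real.tan (Real.arctan (u / η)⁻¹) := Real.le_tan h3 (Real.arctan_lt_pi_div_two _)
        _ = _ := Real.tan_arctan _
    rw [← h1]
    refine h2.trans ?_
    rw [inv_div, mul_div_assoc', div_le_div_iff₀ hu0 (by positivity)]
    nlinarith [mul_pos hη hu0]

theorem integral_poissonKernel {η : ℝ} (hη : 0 < η) (x s t : ℝ) :
    ∫ E in s..t, η / ((x - E) ^ 2 + η ^ 2) =
      Real.arctan ((t - x) / η) - Real.arctan ((s - x) / η) := by
  refine intervalIntegral.integral_eq_sub_of_hasDerivAt (f := fun E => Real.arctan ((E - x) / η))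
    (fun E _ => ?_) ((continuous_poissonKernel hη x).intervalIntegrable _ _)
  have h := (((hasDerivAt_id E).sub_const x).div_const η).arctan
  have e : η / ((x - E) ^ 2 + η ^ 2) = 1 / (1 + ((E - x) / η) ^ 2) * (1 / η) := by
    field_simp
    ring
  rw [e]
  exact h

/-- The Poisson smoothing of the indicator of an interval. -/
theorem abs_indicator_sub_arctan_le {η : ℝ} (hη : 0 < η) {I : Set ℝ} {s t x : ℝ} (hst : s ≤ t)
    (h1 : x ∈ I → s ≤ x ∧ x ≤ t) (h2 : x ∉ I → x ≤ s ∨ t ≤ x) :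
    |I.indicator 1 x - (Real.arctan ((t - x) / η) - Real.arctan ((s - x) / η)) / Real.pi| ≤
      edgeWeight η (x - s) + edgeWeight η (x - t) := by
  have hpi := Real.pi_pos
  have hsym : ∀ u v : ℝ, edgeWeight η (u - v) = edgeWeight η (v - u) := fun u v => by
    rw [edgeWeight, edgeWeight, abs_sub_comm]
  have hlt := fun u => Real.arctan_lt_pi_div_two u
  have hneg : ∀ u v : ℝ, Real.arctan ((u - v) / η) = -Real.arctan ((v - u) / η) := fun u v => by
    rw [← Real.arctan_neg, ← neg_div, neg_sub]
  have key : ∀ u v : ℝ, 0 ≤ u → 0 ≤ v → ∀ w : ℝ,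
      |w| ≤ (Real.pi / 2 - Real.arctan (u / η)) + (Real.pi / 2 - Real.arctan (v / η)) →
      |w / Real.pi| ≤ edgeWeight η u + edgeWeight η v := by
    intro u v hu hv w hw
    rw [abs_div, abs_of_pos hpi, div_le_iff₀ hpi]
    have := pi_div_two_sub_arctan_le hη hu
    have := pi_div_two_sub_arctan_le hη hv
    linarith
  by_cases hx : x ∈ I
  · obtain ⟨h3, h4⟩ := h1 hx
    rw [Set.indicator_of_mem hx, hsym x t]
    have e : (1 : ℝ → ℝ) x - (Real.arctan ((t - x) / η) - Real.arctan ((s - x) / η)) / Real.pi =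
        ((Real.pi / 2 - Real.arctan ((x - s) / η)) + (Real.pi / 2 - Real.arctan ((t - x) / η))) /
          Real.pi := by
      rw [hneg s x, Pi.one_apply]; field_simp; ring
    rw [e]
    refine key _ _ (by linarith) (by linarith) _ (le_of_eq (abs_of_nonneg ?_))
    linarith [hlt ((x - s) / η), hlt ((t - x) / η)]
  · rw [Set.indicator_of_notMem hx, zero_sub, abs_neg]
    rcases h2 hx with h3 | h3
    · rw [hsym x s, hsym x t]
      refine key _ _ (by linarith) (by linarith) _ (abs_le.2 ⟨?_, ?_⟩) <;>
      linarith [hlt ((s - x) / η), hlt ((t - x) / η)]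
    · rw [hneg s x, hneg t x]
      refine key _ _ (by linarith) (by linarith) _ (abs_le.2 ⟨?_, ?_⟩) <;>
      linarith [hlt ((x - s) / η), hlt ((x - t) / η)]

variable {α : Type*} [Fintype α] {ev : α → ℝ} {η : ℝ}

theorem continuous_poissonSum (hη : 0 < η) : Continuous (poissonSum ev η) := by
  unfold poissonSum
  exact continuous_finsetSum _ fun i _ => continuous_poissonKernel hη _

/-- If the smoothed density is at most `N` near `e`, the total edge weight of the points at `e` is
at most `N η` up to a logarithm. -/
theorem sum_edgeWeight_le (hη : 0 < η) {r N e : ℝ} (hr : 2 * η ≤ r)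
    (hN : ∀ E ∈ Set.Icc (e - r) (e + r), poissonSum ev η E ≤ N) :
    ∑ i, edgeWeight η (ev i - e) ≤
      4 * N * η * Real.log (1 + r / η) + Fintype.card α * (2 * η / r) := by
  have hr0 : 0 < r := by linarith
  have hcont : ∀ x, Continuous fun t => edgeWeight η t * (η / ((x - t) ^ 2 + η ^ 2)) := fun x =>
    (continuous_edgeWeight hη).mul (continuous_poissonKernel hη x)
  calc _ ≤ ∑ i, (2 * (∫ t in (-r)..r, edgeWeight η t * (η / ((ev i - e - t) ^ 2 + η ^ 2))) +
          2 * η / r) := Finset.sum_le_sum fun i _ => edgeWeight_le hη hr _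
    _ = 2 * (∫ t in (-r)..r, edgeWeight η t * poissonSum ev η (e + t)) +
          Fintype.card α * (2 * η / r) := by
        rw [Finset.sum_add_distrib, ← Finset.mul_sum,
          ← intervalIntegral.integral_finsetSum fun i _ => (hcont _).intervalIntegrable _ _]
        congr 1
        · congr 2
          funext t
          rw [← Finset.mul_sum, poissonSum]
          simp only [sub_sub]
        · simp
    _ ≤ 2 * (∫ t in (-r)..r, edgeWeight η t * N) + Fintype.card α * (2 * η / r) := by
        gcongr
        refine intervalIntegral.integral_mono_on (by linarith)
          (Continuous.intervalIntegrable ((continuous_edgeWeight hη).mul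
            ((continuous_poissonSum hη).comp (by fun_prop))) _ _)
          (((continuous_edgeWeight hη).mul continuous_const).intervalIntegrable _ _)
          fun t ht => ?_
        refine mul_le_mul_of_nonneg_left (hN _ ⟨by linarith [ht.1], by linarith [ht.2]⟩) ?_
        unfold edgeWeight; positivity
    _ = _ := by
        rw [intervalIntegral.integral_mul_const, integral_edgeWeight hη hr0.le]
        ring

/-- **From the smoothed density to counting.** If the Poisson-smoothed counting measure of
finitely many points is close to `π ρ` on a neighbourhood of `[A, B]`, the number of points in
every interval in `[A, B]` is close to the integral of `ρ`. -/
theorem abs_card_sub_integral_le (hη : 0 < η) {r θ D P A B : ℝ} (hr : 2 * η ≤ r) (hP : 0 ≤ P)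
    {ρ : ℝ → ℝ} (hρ : Integrable ρ) (hD : ∀ E ∈ Set.Icc (A - r) (B + r), Real.pi * ρ E ≤ D)
    (hθ : ∀ E ∈ Set.Icc (A - r) (B + r), |poissonSum ev η E - P * (Real.pi * ρ E)| ≤ P * θ)
    {I : Set ℝ} (hI : I.OrdConnected) (hIAB : I ⊆ Set.Icc A B) (hne : I.Nonempty) :
    |(Nat.card {i // ev i ∈ I} : ℝ) - P * ∫ t in I, ρ t| ≤
      P * θ * volume.real I + 2 * (4 * (P * (D + θ)) * η * Real.log (1 + r / η) +
        Fintype.card α * (2 * η / r)) := by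
  classical
  have hr0 : 0 < r := by linarith
  have hpi := Real.pi_pos
  have hbb : BddBelow I := ⟨A, fun x hx => (hIAB hx).1⟩
  have hba : BddAbove I := ⟨B, fun x hx => (hIAB hx).2⟩
  set s := sInf I with hs
  set t := sSup I with ht
  have hsA : A ≤ s := le_csInf hne fun x hx => (hIAB hx).1
  have htB : t ≤ B := csSup_le hne fun x hx => (hIAB hx).2
  have hst : s ≤ t := (csInf_le hbb hne.some_mem).trans (le_csSup hba hne.some_mem)
  have hIcc : I ⊆ Set.Icc s t := fun x hx => ⟨csInf_le hbb hx, le_csSup hba hx⟩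
  have hIoo : Set.Ioo s t ⊆ I := by
    intro x hx
    obtain ⟨u, hu, hux⟩ := exists_lt_of_csInf_lt hne hx.1
    obtain ⟨v, hv, hxv⟩ := exists_lt_of_lt_csSup hne hx.2
    exact hI.out hu hv ⟨hux.le, hxv.le⟩
  -- the endpoints of `I` matter for the count, but not for the integral
  have hae : I =ᵐ[volume] Set.Ioc s t := by
    refine (Filter.EventuallyLE.antisymm ?_ ?_)
    · exact (LE.le.eventuallyLE hIcc).trans Ioc_ae_eq_Icc.symm.le
    · exact Ioo_ae_eq_Ioc.symm.le.trans (LE.le.eventuallyLE hIoo)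
  have hvol : volume.real I = t - s := by
    rw [Measure.real, measure_congr hae, Real.volume_Ioc, ENNReal.toReal_ofReal (by linarith)]
  have hint : ∫ u in I, ρ u = ∫ u in s..t, ρ u := by
    rw [intervalIntegral.integral_of_le hst, setIntegral_congr_set hae]
  have hcard : (Nat.card {i // ev i ∈ I} : ℝ) = ∑ i, I.indicator 1 (ev i) := by
    rw [Nat.card_eq_fintype_card, Fintype.card_subtype, Finset.card_filter]
    push_cast
    refine Finset.sum_congr rfl fun i _ => ?_
    rw [Set.indicator_apply, Pi.one_apply]
  have hsmooth : ∑ i, (Real.arctan ((t - ev i) / η) - Real.arctan ((s - ev i) / η)) / Real.pi =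
      (∫ E in s..t, poissonSum ev η E) / Real.pi := by
    rw [← Finset.sum_div]
    congr 1
    unfold poissonSum
    rw [intervalIntegral.integral_finsetSum fun i _ =>
      (continuous_poissonKernel hη _).intervalIntegrable _ _]
    exact Finset.sum_congr rfl fun i _ => (integral_poissonKernel hη _ _ _).symm
  have hbulk : |(∫ E in s..t, poissonSum ev η E) / Real.pi - P * ∫ u in s..t, ρ u| ≤
      P * θ * (t - s) := by
    have e1 : (∫ E in s..t, poissonSum ev η E) / Real.pi - P * ∫ u in s..t, ρ u =
        (∫ E in s..t, (poissonSum ev η E - P * (Real.pi * ρ E))) / Real.pi := by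
      rw [intervalIntegral.integral_sub ((continuous_poissonSum hη).intervalIntegrable _ _)
        ((hρ.intervalIntegrable.const_mul _).const_mul _), intervalIntegral.integral_const_mul,
        intervalIntegral.integral_const_mul]
      field_simp
    have e2 := intervalIntegral.norm_integral_le_of_norm_le_const (a := s) (b := t) (C := P * θ)
      (f := fun E => poissonSum ev η E - P * (Real.pi * ρ E)) fun E hE => by
        rw [Set.uIoc_of_le hst] at hE
        exact hθ E ⟨by linarith [hE.1], by linarith [hE.2]⟩
    rw [abs_of_nonneg (sub_nonneg.2 hst), Real.norm_eq_abs] at e2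
    rw [e1, abs_div, abs_of_pos hpi, div_le_iff₀ hpi]
    have h0 : 0 ≤ P * θ * (t - s) := (abs_nonneg _).trans e2
    nlinarith [Real.pi_gt_three]
  have hN : ∀ E ∈ Set.Icc (A - r) (B + r), poissonSum ev η E ≤ P * (D + θ) := by
    intro E hE
    have h1 := (abs_le.1 (hθ E hE)).2
    have h2 := mul_le_mul_of_nonneg_left (hD E hE) hP
    linarith
  have hws := sum_edgeWeight_le (ev := ev) (e := s) hη hr fun E hE =>
    hN E ⟨by linarith [hE.1], by linarith [hE.2]⟩
  have hwt := sum_edgeWeight_le (ev := ev) (e := t) hη hr fun E hE =>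
    hN E ⟨by linarith [hE.1], by linarith [hE.2]⟩
  have hedge : |∑ i, I.indicator 1 (ev i) - (∫ E in s..t, poissonSum ev η E) / Real.pi| ≤
      ∑ i, edgeWeight η (ev i - s) + ∑ i, edgeWeight η (ev i - t) := by
    rw [← hsmooth, ← Finset.sum_sub_distrib, ← Finset.sum_add_distrib]
    refine (Finset.abs_sum_le_sum_abs _ _).trans (Finset.sum_le_sum fun i _ => ?_)
    refine abs_indicator_sub_arctan_le hη hst (fun h => hIcc h) fun h => ?_
    by_contra hcon
    push Not at hcon
    exact h (hIoo hcon)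
  rw [hcard, hint, hvol]
  calc _ ≤ |∑ i, I.indicator 1 (ev i) - (∫ E in s..t, poissonSum ev η E) / Real.pi| +
        |(∫ E in s..t, poissonSum ev η E) / Real.pi - P * ∫ u in s..t, ρ u| := abs_sub_le _ _ _
    _ ≤ _ := by linarith

end Counting

/-! ### Uniformity in the spectral parameter -/

section Grid

variable {p n : ℕ}

/-- The points of a square grid with mesh `p⁻³` in the upper half-plane. -/
noncomputable def gridPoint (p : ℕ) (E₀ η : ℝ) (jk : ℕ × ℕ) : ℂ :=
  ⟨E₀ + jk.1 * ((p : ℝ) ^ 3)⁻¹, η + jk.2 * ((p : ℝ) ^ 3)⁻¹⟩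

/-- All rows are concentrated at all points of the grid. The `14 p³ + 1` steps of length `p⁻³` in each
direction cover a square of side `14`, which contains the spectral parameters in question because
`2 b ≤ 8`. -/
def GridConcentrated (X : Matrix (Fin p) (Fin n) ℝ) (K T E₀ η : ℝ) : Prop :=
  ∀ j < 14 * p ^ 3 + 1, ∀ k < 14 * p ^ 3 + 1, ∀ i,
    RowConcentrated X K T (gridPoint p E₀ η (j, k)) i

/-- A union bound over at most `(15 p³)²` points of the grid and `p` rows. -/
theorem measureReal_not_gridConcentrated_le {Ω : Type*} [MeasurableSpace Ω] {μ : Measure Ω}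
    [IsProbabilityMeasure μ] {x : Fin p → Fin n → Ω → ℝ} {K : ℝ} (hp : 0 < p) (hK : 0 < K)
    (hm : ∀ i j, Measurable (x i j))
    (hind : iIndepFun (fun ij : Fin p × Fin n => x ij.1 ij.2) μ)
    (h0 : ∀ i j, ∫ ω, x i j ω ∂μ = 0) (h1 : ∀ i j, variance (x i j) μ = 1)
    (hb : ∀ i j, ∀ᵐ ω ∂μ, |x i j ω| ≤ K) (T E₀ : ℝ) {η : ℝ} (hη : 0 < η) :
    μ.real {ω | ¬ GridConcentrated (Matrix.of fun i j => x i j ω) K T E₀ η} ≤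
      2025 * (p : ℝ) ^ 7 * Real.exp (-T) := by
  set N := 14 * p ^ 3 + 1 with hN
  have hp1 : (1 : ℝ) ≤ p := by exact_mod_cast hp
  let B : (ℕ × ℕ) × Fin p → Set Ω := fun u =>
    {ω | ¬ RowConcentrated (Matrix.of fun i j => x i j ω) K T (gridPoint p E₀ η u.1) u.2}
  have hsub : {ω | ¬ GridConcentrated (Matrix.of fun i j => x i j ω) K T E₀ η} ⊆
      ⋃ u ∈ (Finset.range N ×ˢ Finset.range N) ×ˢ (Finset.univ : Finset (Fin p)), B u := by
    intro ω hω
    simp only [Set.mem_ofPred_eq, GridConcentrated, not_forall] at hω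
    obtain ⟨j, hj, k, hk, i, hi⟩ := hω
    simp only [Set.mem_iUnion]
    exact ⟨((j, k), i), by simp [hj, hk, hN], hi⟩
  calc _ ≤ _ := measureReal_mono hsub (measure_ne_top _ _)
    _ ≤ ∑ u ∈ (Finset.range N ×ˢ Finset.range N) ×ˢ (Finset.univ : Finset (Fin p)), μ.real (B u) :=
        measureReal_biUnion_finset_le _ _
    _ ≤ ∑ _u ∈ (Finset.range N ×ˢ Finset.range N) ×ˢ (Finset.univ : Finset (Fin p)),
          9 * Real.exp (-T) := by
        refine Finset.sum_le_sum fun u _ => ?_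
        refine measureReal_not_rowConcentrated_le hK hm hind h0 h1 hb T ?_ u.2
        simp only [gridPoint]
        positivity
    _ = ((N : ℝ) * N * p) * (9 * Real.exp (-T)) := by
        simp [Finset.card_product]
    _ ≤ (15 * (p : ℝ) ^ 3 * (15 * (p : ℝ) ^ 3) * p) * (9 * Real.exp (-T)) := by
        have : (N : ℝ) ≤ 15 * (p : ℝ) ^ 3 := by
          rw [hN]; push_cast
          have := one_le_pow₀ hp1 (n := 3)
          linarith
        gcongr
    _ = _ := by ring

theorem exists_natCast_mul_le {h t : ℝ} {N : ℕ} (hh : 0 < h) (ht : 0 ≤ t) (htN : t < N * h) :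
    ∃ j < N, j * h ≤ t ∧ t ≤ j * h + h := by
  refine ⟨⌊t / h⌋₊, ?_, ?_, ?_⟩
  · rw [Nat.floor_lt (by positivity), div_lt_iff₀ hh]
    exact htN
  · have := Nat.floor_le (show 0 ≤ t / h by positivity)
    rwa [le_div_iff₀ hh] at this
  · have := (Nat.lt_floor_add_one (t / h)).le
    rw [div_le_iff₀ hh] at this
    linarith

/-- Concentration on the grid gives closeness of all row forms to `m(z)` on the whole rectangle, by
Lipschitz continuity of the resolvents. -/
theorem rowForm_close_of_gridConcentrated (X : Matrix (Fin p) (Fin n) ℝ) {K T E₀ E₁ η : ℝ}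
    (hK : 1 ≤ K) (hT : 1 ≤ T) (hn : 0 < n) (hp : 0 < p) (hpn : p ≤ n) (hE₀ : 0 < E₀)
    (hE₁ : E₁ ≤ E₀ + 14) (hη : 1 / p ≤ η)
    (hg : 400 * T * (K / √(n * η)) ≤ 1 / 8) (hG : GridConcentrated X K T E₀ η)
    {z : ℂ} (hre : z.re ∈ Set.Icc E₀ E₁) (him : z.im ∈ Set.Icc η 2) :
    ‖companionTransform X z‖ ≤ 6 + 3 / E₀ ∧ ∀ i, ‖rowForm X z i - companionTransform X z‖ ≤
      400 * T * (K / √(n * η)) * (5 + 3 / E₀) + 4 / p := by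
  have hp' : (0 : ℝ) < p := by exact_mod_cast hp
  have hp1 : (1 : ℝ) ≤ p := by exact_mod_cast hp
  have hn' : (0 : ℝ) < n := by exact_mod_cast hn
  have hη0 : 0 < η := lt_of_lt_of_le (by positivity) hη
  set h : ℝ := ((p : ℝ) ^ 3)⁻¹ with hh
  have hh0 : 0 < h := by positivity
  have hN : ((14 * p ^ 3 + 1 : ℕ) : ℝ) * h = 14 + h := by
    rw [hh]; push_cast; field_simp
  obtain ⟨j, hj, hj1, hj2⟩ := exists_natCast_mul_le (t := z.re - E₀) (N := 14 * p ^ 3 + 1) hh0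
    (by linarith [hre.1]) (by rw [hN]; linarith [hre.2])
  obtain ⟨k, hk, hk1, hk2⟩ := exists_natCast_mul_le (t := z.im - η) (N := 14 * p ^ 3 + 1) hh0
    (by linarith [him.1]) (by rw [hN]; linarith [him.2])
  set w := gridPoint p E₀ η (j, k) with hw
  have hwre : w.re = E₀ + j * h := rfl
  have hwim : w.im = η + k * h := rfl
  have hwim0 : η ≤ w.im := by rw [hwim]; have : 0 ≤ k * h := by positivity
                              linarith
  have hwim1 : w.im ≤ 2 := by rw [hwim]; linarith [him.2]
  have hwpos : 0 < w.im := hη0.trans_le hwim0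
  have hzpos : 0 < z.im := hη0.trans_le him.1
  have hwnorm : E₀ ≤ ‖w‖ := by
    have h1 := (abs_le.1 (Complex.abs_re_le_norm w)).2
    rw [hwre] at h1
    have : 0 ≤ j * h := by positivity
    linarith
  -- mesh `p⁻³` against the Lipschitz constant `η⁻² ≤ p²`
  have hdist : ‖z - w‖ * ((1 / z.im) * (1 / w.im)) ≤ 2 / p := by
    have h1 : ‖z - w‖ ≤ 2 * h := by
      refine (Complex.norm_le_abs_re_add_abs_im _).trans ?_
      have a1 : |(z - w).re| ≤ h := by
        rw [Complex.sub_re, hwre, abs_le]; constructor <;> linarith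
      have a2 : |(z - w).im| ≤ h := by
        rw [Complex.sub_im, hwim, abs_le]; constructor <;> linarith
      linarith
    have h2 : 1 / η ≤ p := by
      rw [div_le_iff₀ hη0]
      rw [div_le_iff₀ hp'] at hη
      linarith
    calc ‖z - w‖ * ((1 / z.im) * (1 / w.im)) ≤ 2 * h * ((1 / η) * (1 / η)) := by
          gcongr
          exact him.1
      _ ≤ 2 * h * (p * p) := by gcongr
      _ = 2 / p := by rw [hh]; field_simp
  set g := 400 * T * (K / √(n * η)) with hgd
  have hgw : 400 * T * (K / √(n * w.im)) ≤ g := by rw [hgd]; gcongr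
  have hq : ∀ i, ‖rowForm X w i - companionTransform X w‖ ≤
      g * (1 + ‖companionTransform X w‖) := fun i =>
    (norm_rowForm_sub_companionTransform_le X hK hT hn hwpos hwim1 (hG j hj k hk i)
      (by linarith)).trans (by gcongr)
  have hmw : ‖companionTransform X w‖ ≤ 4 + 3 / E₀ :=
    (norm_companionTransform_le_of_rowForm X hg hn hpn hwpos hq).trans (by gcongr)
  have hmd := (norm_companionTransform_sub_le X hn hzpos hwpos).trans hdist
  have hg0 : 0 ≤ g := by rw [hgd]; positivity
  constructor
  · have h1 := norm_add_le (companionTransform X z - companionTransform X w)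
      (companionTransform X w)
    rw [sub_add_cancel] at h1
    have h2 : 2 / (p : ℝ) ≤ 2 := div_le_self (by norm_num) hp1
    linarith
  · intro i
    have hqd := (norm_rowForm_sub_le X hzpos hwpos i).trans hdist
    have e : rowForm X z i - companionTransform X z = (rowForm X z i - rowForm X w i) +
        (rowForm X w i - companionTransform X w) +
        (companionTransform X w - companionTransform X z) := by ring
    have h1 : ‖rowForm X w i - companionTransform X w‖ ≤ g * (5 + 3 / E₀) :=
      (hq i).trans (mul_le_mul_of_nonneg_left (by linarith) hg0)
    rw [norm_sub_rev] at hmd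
    have h4 : (4 : ℝ) / p = 2 / p + 2 / p := by ring
    rw [e, h4]
    refine norm_add₃_le.trans ?_
    linarith

set_option maxHeartbeats 1000000 in
/-- **Deterministic local law.** On the grid concentration event, all intervals above the scale
`η log p / δ` obey the local law with accuracy `δ`, provided that the error terms are small
multiples of `δ²`. -/
theorem exists_counting_of_gridConcentrated {y : ℝ} (hy : 0 < y) (hy1 : y < 1) :
    ∃ κ : ℝ, 0 < κ ∧ ∀ (p n : ℕ) (X : Matrix (Fin p) (Fin n) ℝ) (K T δ η : ℝ),
      0 < n → 2 ≤ p → p ≤ n → 1 ≤ K → 1 ≤ T → 0 < δ → δ < 1 / 2 → y / 2 ≤ (p / n : ℝ) →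
      1 / p ≤ η → η ≤ κ * δ ^ 2 → |(p / n : ℝ) - y| ≤ κ * δ ^ 2 →
      T * (K / √(n * η)) ≤ κ * δ ^ 2 → 1 / (p : ℝ) ≤ κ * δ ^ 2 → 1 ≤ Real.log p →
      GridConcentrated X K T (mpLower y / 4) η →
      ∀ I : Set ℝ, I.OrdConnected → I ⊆ Set.Icc (mpLower y / 2) (2 * mpUpper y) →
        η * Real.log p ≤ κ * δ * volume.real I →
        |(eigenvalueCount X I : ℝ) - p * ∫ t in I, mpDensity y t| ≤
          δ * p * volume.real I := by
  -- the margin by which `[a/2, 2b]` is enlarged, so that the density is controlled around endpoints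
  set r : ℝ := mpLower y / 4 with hr
  have ha := mpLower_pos hy1
  have ha1 := mpLower_le_one hy hy1
  have hb4 := mpUpper_le_four hy1
  have hb1 := one_le_mpUpper y
  have hr0 : 0 < r := by positivity
  obtain ⟨C, hC, hmain⟩ := exists_abs_poissonSum_sub_le hy hy1 (E₀ := r) (Z := 14)
    (M := 6 + 3 / r) hr0 (by norm_num) (by positivity)
  set B₁ : ℝ := 400 * (5 + 3 / r) + 4 with hB₁
  set D : ℝ := 2 / (r * y) with hD
  set B₂ : ℝ := 16 * (D + 1) + 4 / r with hB₂
  have hB₁0 : 0 < B₁ := by positivity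
  have hD0 : 0 < D := by positivity
  have hB₂0 : 0 < B₂ := by positivity
  -- each summand of `S = κ⁻¹` serves one of the smallness conditions `s1`–`s6`
  set S : ℝ := 4 * C ^ 2 * (B₁ + 2) + 116 * B₁ / y + 4000 + 1 / r + 2 * B₂ + (B₁ + 2) with hS
  have hS0 : 0 < S := by positivity
  have part : ∀ t : ℝ, t ≤ S → 1 / S * t ≤ 1 := fun t ht => by
    rw [one_div, inv_mul_le_one₀ hS0]; exact ht
  have k1 : 0 ≤ 4 * C ^ 2 * (B₁ + 2) := by positivity
  have k2 : 0 ≤ 116 * B₁ / y := by positivity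
  have k3 : 0 ≤ 1 / r := by positivity
  refine ⟨1 / S, by positivity, ?_⟩
  have s1 := part (4 * C ^ 2 * (B₁ + 2)) (by rw [hS]; linarith)
  have s2 := part (116 * B₁ / y) (by rw [hS]; linarith)
  have s3 := part 4000 (by rw [hS]; linarith)
  have s4 := part (1 / r) (by rw [hS]; linarith)
  have s5 := part (2 * B₂) (by rw [hS]; linarith)
  have s6 := part (B₁ + 2) (by rw [hS]; linarith)
  set κ : ℝ := 1 / S with hκ
  have hκ0 : 0 < κ := by positivity
  clear_value κ
  intro p n X K T δ η hn hp2 hpn hK hT hδ hδ1 hcy hη hηκ hcκ hgκ hpκ hlog hG I hI hIsub hIlen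
  have hp : 0 < p := by omega
  have hp' : (0 : ℝ) < p := by exact_mod_cast hp
  have hη0 : 0 < η := lt_of_lt_of_le (by positivity) hη
  have hδ2 : δ ^ 2 ≤ 1 / 4 := by nlinarith
  have hκδ : κ * δ ^ 2 ≤ κ / 4 := by nlinarith
  have hη2 : η ≤ 2 := by linarith
  set ε : ℝ := 400 * T * (K / √(n * η)) * (5 + 3 / r) + 4 / p with hε
  have hε0 : 0 ≤ ε := by positivity
  have hεκ : ε ≤ κ * δ ^ 2 * B₁ := by
    have h1 : T * (K / √(n * η)) * (400 * (5 + 3 / r)) ≤ κ * δ ^ 2 * (400 * (5 + 3 / r)) := by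
      gcongr
    have h2 : (4 : ℝ) / p = 4 * (1 / p) := by ring
    rw [hε, hB₁, h2]
    linarith
  have hsum : ε + η + |(p / n : ℝ) - y| ≤ κ * δ ^ 2 * (B₁ + 2) := by linarith
  have hrow : ∀ z : ℂ, z.re ∈ Set.Icc r (2 * mpUpper y + r) → z.im ∈ Set.Icc η 2 → ‖z‖ ≤ 14 ∧
      ‖companionTransform X z‖ ≤ 6 + 3 / r ∧
      ∀ i, ‖rowForm X z i - companionTransform X z‖ ≤ ε := by
    intro z hre him
    refine ⟨?_, ?_⟩
    · refine (Complex.norm_le_abs_re_add_abs_im z).trans ?_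
      rw [abs_of_nonneg (hr0.le.trans hre.1), abs_of_nonneg (hη0.le.trans him.1)]
      linarith [hre.2, him.2]
    · exact rowForm_close_of_gridConcentrated X (E₁ := 2 * mpUpper y + r) hK hT hn hp hpn hr0
        (by linarith) hη (by linarith) hG hre him
  have hlaw := hmain p n X (2 * mpUpper y + r) η ε hn hp hpn hcy hη0 hη2 hε0 (by
      have e1 : κ * (116 * B₁ / y) = κ * B₁ * 116 / y := by ring
      rw [e1, div_le_one hy] at s2
      have e2 : κ * δ ^ 2 * B₁ ≤ κ / 4 * B₁ := by gcongr
      rw [le_div_iff₀ (by norm_num)]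
      linarith) (by
      have : κ * δ ^ 2 * (B₁ + 2) ≤ κ / 4 * (B₁ + 2) := by gcongr
      linarith) hrow
  set θ : ℝ := C * √(ε + η + |(p / n : ℝ) - y|) with hθ
  have hθ0 : 0 ≤ θ := by positivity
  have hθδ : θ ≤ δ / 2 := by
    refine abs_le_of_sq_le_sq' ?_ (by positivity) |>.2
    rw [hθ, mul_pow, Real.sq_sqrt (by positivity)]
    calc C ^ 2 * (ε + η + |(p / n : ℝ) - y|) ≤ C ^ 2 * (κ * δ ^ 2 * (B₁ + 2)) := by gcongr
      _ = δ ^ 2 / 4 * (κ * (4 * C ^ 2 * (B₁ + 2))) := by ring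
      _ ≤ δ ^ 2 / 4 * 1 := by gcongr
      _ = _ := by ring
  have hvol : 0 < volume.real I := by
    by_contra hcon
    have h0 : volume.real I = 0 := le_antisymm (not_lt.1 hcon) measureReal_nonneg
    rw [h0, mul_zero] at hIlen
    have : 0 < η * Real.log p := by positivity
    linarith
  have hne : I.Nonempty := by
    rw [Set.nonempty_iff_ne_empty]
    rintro rfl
    simp at hvol
  -- the margin `r` leaves the left end at `r > 0`, away from the singularity at the origin
  have hA : mpLower y / 2 - r = r := by rw [hr]; ring
  have h2η : 2 * η ≤ r := by
    have h1 : κ ≤ r := by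
      rwa [mul_one_div, div_le_one hr0] at s4
    linarith
  have hcount := abs_card_sub_integral_le (ev := (sampleCorrelation_isHermitian X).eigenvalues)
    (P := p) (θ := θ) (D := D) hη0 h2η hp'.le (integrable_mpDensity hy hy1)
    (A := mpLower y / 2) (B := 2 * mpUpper y)
    (fun E hE => by
      rw [hA] at hE
      exact pi_mul_mpDensity_le hy hy1 hr0 hE.1)
    (fun E hE => by
      rw [hA] at hE
      exact hlaw E hE) hI hIsub hne
  rw [Fintype.card_fin] at hcount
  refine hcount.trans ?_
  have hloglog : Real.log (1 + r / η) ≤ 2 * Real.log p := by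
    have h1 : r / η ≤ p := by
      rw [div_le_iff₀ hη0]
      rw [div_le_iff₀ hp'] at hη
      linarith
    have hp2' : (2 : ℝ) ≤ p := by exact_mod_cast hp2
    calc Real.log (1 + r / η) ≤ Real.log ((p : ℝ) ^ 2) := by
          refine Real.log_le_log (by positivity) ?_
          nlinarith
      _ = _ := by rw [Real.log_pow]; push_cast; ring
  have hedge : 2 * (4 * (p * (D + θ)) * η * Real.log (1 + r / η) + p * (2 * η / r)) ≤
      p * (δ / 2 * volume.real I) := by
    calc _ ≤ 2 * (4 * (p * (D + 1)) * η * (2 * Real.log p) + p * (2 * η / r) * Real.log p) := by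
          have : θ ≤ 1 := by linarith
          have : p * (2 * η / r) ≤ p * (2 * η / r) * Real.log p :=
            le_mul_of_one_le_right (by positivity) hlog
          have : 0 ≤ Real.log (1 + r / η) :=
            Real.log_nonneg (le_add_of_nonneg_right (by positivity))
          gcongr
      _ = p * (B₂ * (η * Real.log p)) := by rw [hB₂]; ring
      _ ≤ p * (B₂ * (κ * δ * volume.real I)) := by gcongr
      _ = p * (δ / 2 * volume.real I * (κ * (2 * B₂))) := by ring
      _ ≤ p * (δ / 2 * volume.real I * 1) := by gcongr
      _ = _ := by ring
  have hbulk : p * θ * volume.real I ≤ p * (δ / 2) * volume.real I := by gcongr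
  calc _ ≤ p * (δ / 2) * volume.real I + p * (δ / 2 * volume.real I) := add_le_add hbulk hedge
    _ = _ := by ring

end Grid

/-! ### The choice of scales -/

section Scales

/-- The choice of the spectral resolution `η = K² log⁵ p / (δ⁷ p)` meets all smallness
requirements. Here `l` stands for `log p` and `q` for `p ^ (1 / 20)`. -/
theorem resolution_bounds {P N K δ l q κ A η : ℝ} (hP : 1 ≤ P) (hN : P ≤ N) (hK : 1 ≤ K)
    (hδ : 0 < δ) (hδ1 : δ < 1 / 2) (hl : 1 ≤ l) (hq : 1 ≤ q) (hKq : K ≤ q * δ ^ 2 / l)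
    (hκ : 0 < κ) (hqP : q ^ 5 * l ^ 3 ≤ κ * P) (hA : 0 < A) (hlA : A + 10 ≤ κ * l)
    (hη : η = K ^ 2 * l ^ 5 / (δ ^ 7 * P)) :
    1 / P ≤ η ∧ η ≤ κ * δ ^ 2 ∧ (A + 10) * l * (K / √(N * η)) ≤ κ * δ ^ 2 ∧ 1 / P ≤ κ * δ ^ 2 ∧
      ∀ v, K ^ 2 * l ^ 7 / (δ ^ 9 * P) ≤ v → η * l ≤ κ * δ * v := by
  have hP0 : 0 < P := by linarith
  have hl0 : 0 < l := by linarith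
  have hK0 : 0 < K := by linarith
  have hq0 : 0 < q := by linarith
  have hN0 : 0 < N := by linarith
  have hη0 : 0 < η := by rw [hη]; positivity
  have hδ2 : 1 ≤ q * δ ^ 2 := by
    have h1 : 1 ≤ q * δ ^ 2 / l := hK.trans hKq
    rw [le_div_iff₀ hl0] at h1
    linarith
  have hKl : K * l ≤ q * δ ^ 2 := by rwa [le_div_iff₀ hl0] at hKq
  refine ⟨?_, ?_, ?_, ?_, ?_⟩
  · rw [hη, div_le_div_iff₀ hP0 (by positivity)]
    have h1 : δ ^ 7 ≤ 1 := pow_le_one₀ hδ.le (by linarith)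
    have h2 : 1 ≤ K ^ 2 * l ^ 5 :=
      one_le_mul_of_one_le_of_one_le (one_le_pow₀ hK) (one_le_pow₀ hl)
    calc 1 * (δ ^ 7 * P) ≤ 1 * P := by nlinarith
      _ ≤ _ := by gcongr
  · rw [hη, div_le_iff₀ (by positivity)]
    have h1 : (K * l) ^ 2 ≤ (q * δ ^ 2) ^ 2 := by gcongr
    have h2 : 1 ≤ (q * δ ^ 2) ^ 3 := one_le_pow₀ hδ2
    calc K ^ 2 * l ^ 5 = (K * l) ^ 2 * l ^ 3 := by ring
      _ ≤ (q * δ ^ 2) ^ 2 * l ^ 3 * 1 := by rw [mul_one]; gcongr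
      _ ≤ (q * δ ^ 2) ^ 2 * l ^ 3 * (q * δ ^ 2) ^ 3 := by gcongr
      _ = q ^ 5 * l ^ 3 * δ ^ 9 * δ := by ring
      _ ≤ κ * P * δ ^ 9 * 1 := by gcongr; linarith
      _ = _ := by ring
  · have h1 : K / √(N * η) ≤ δ ^ 2 / l ^ 2 := by
      have h2 : (K / √(N * η)) ^ 2 ≤ (δ ^ 2 / l ^ 2) ^ 2 := by
        rw [div_pow, Real.sq_sqrt (by positivity), hη]
        have e : K ^ 2 / (N * (K ^ 2 * l ^ 5 / (δ ^ 7 * P))) = P / N * (δ ^ 7 / l ^ 5) := by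
          field_simp
        rw [e]
        have h3 : P / N ≤ 1 := by rwa [div_le_one hN0]
        have h4 : δ ^ 7 ≤ δ ^ 4 := pow_le_pow_of_le_one hδ.le (by linarith) (by norm_num)
        have h5 : l ^ 4 ≤ l ^ 5 := pow_le_pow_right₀ hl (by norm_num)
        calc P / N * (δ ^ 7 / l ^ 5) ≤ 1 * (δ ^ 4 / l ^ 4) := by gcongr
          _ = _ := by rw [one_mul, div_pow]; ring_nf
      exact (abs_le_of_sq_le_sq' h2 (by positivity)).2
    calc (A + 10) * l * (K / √(N * η)) ≤ κ * l * l * (δ ^ 2 / l ^ 2) := by gcongr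
      _ = κ * δ ^ 2 := by field_simp
  · rw [div_le_iff₀ hP0]
    have h1 : q ≤ q ^ 5 * l ^ 3 := by
      calc q = q * 1 := (mul_one q).symm
        _ ≤ q * (q ^ 4 * l ^ 3) := by
          gcongr
          exact one_le_mul_of_one_le_of_one_le (one_le_pow₀ hq) (one_le_pow₀ hl)
        _ = _ := by ring
    calc 1 ≤ q * δ ^ 2 := hδ2
      _ ≤ κ * P * δ ^ 2 := by gcongr; exact h1.trans hqP
      _ = _ := by ring
  · intro v hv
    have h1 : η * l ≤ κ * δ * (K ^ 2 * l ^ 7 / (δ ^ 9 * P)) := by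
      have e : κ * δ * (K ^ 2 * l ^ 7 / (δ ^ 9 * P)) = η * l * (κ * l / δ) := by
        rw [hη]; field_simp
      rw [e]
      refine le_mul_of_one_le_right (by positivity) ?_
      rw [one_le_div hδ]
      linarith
    exact h1.trans (by gcongr)

/-- Powers of `log p` are negligible against powers of `p`. -/
theorem eventually_rpow_mul_log_pow_le {κ : ℝ} (hκ : 0 < κ) :
    ∀ᶠ P : ℝ in atTop, (P ^ (1 / 20 : ℝ)) ^ 5 * Real.log P ^ 3 ≤ κ * P := by
  have h := (isLittleO_log_rpow_atTop (show (0 : ℝ) < 1 / 4 by norm_num)).pow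
    (show 0 < 3 by norm_num)
  filter_upwards [h.bound hκ, eventually_ge_atTop 1] with P hP hP1
  have hP0 : 0 < P := by linarith
  have hlog : 0 ≤ Real.log P := Real.log_nonneg hP1
  rw [Real.norm_of_nonneg (by positivity), Real.norm_of_nonneg (by positivity),
    ← Real.rpow_natCast (P ^ (1 / 4 : ℝ)), ← Real.rpow_mul hP0.le] at hP
  rw [← Real.rpow_natCast (P ^ (1 / 20 : ℝ)), ← Real.rpow_mul hP0.le]
  calc _ ≤ P ^ ((1 / 20 : ℝ) * (5 : ℕ)) * (κ * P ^ ((1 / 4 : ℝ) * (3 : ℕ))) := by gcongr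
    _ = κ * (P ^ ((1 / 20 : ℝ) * (5 : ℕ)) * P ^ ((1 / 4 : ℝ) * (3 : ℕ))) := by ring
    _ = κ * P := by
      rw [← Real.rpow_add hP0]
      norm_num

end Scales

/-! ### The local law -/

theorem theorem3p1 :
    ∃ C₁ : ℝ, 0 < C₁ ∧ ∀ C₀ : ℝ, C₁ ≤ C₀ →
      ∀ (y : ℝ), 0 < y → y < 1 →
      -- dimensions
      ∀ (p n : ℕ → ℕ), Tendsto p atTop atTop →
        Tendsto (fun k => (p k : ℝ) / (n k : ℝ)) atTop (𝓝 y) →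
      -- accuracy, constant or varying; the second condition is automatic if `δ` is constant
      ∀ (δ : ℕ → ℝ), (∀ k, 0 < δ k ∧ δ k < 1 / 2) →
        ((fun k => (p k : ℝ) / (n k : ℝ) - y) =o[atTop] fun k => δ k ^ 2) →
      -- bound on the entries
      ∀ (K : ℕ → ℝ),
        (K =o[atTop] fun k => (p k : ℝ) ^ (1 / C₀) * δ k ^ 2 / Real.log (p k)) →
      -- independent entries
      ∀ (Ω : ℕ → Type*) [∀ k, MeasurableSpace (Ω k)]
        (μ : ∀ k, Measure (Ω k)) [∀ k, IsProbabilityMeasure (μ k)]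
        (x : ∀ k, Fin (p k) → Fin (n k) → Ω k → ℝ),
        (∀ k i j, Measurable (x k i j)) →
        (∀ k, iIndepFun (fun ij : Fin (p k) × Fin (n k) => x k ij.1 ij.2) (μ k)) →
        (∀ k i j, ∫ ω, x k i j ω ∂(μ k) = 0) →
        (∀ k i j, variance (x k i j) (μ k) = 1) →
        (∀ k i j, ∀ᵐ ω ∂(μ k), |x k i j ω| ≤ K k) →
        WithOverwhelmingProbability n μ fun k => {ω : Ω k |
          ∀ I : Set ℝ, I.OrdConnected →
            I ⊆ Set.Icc (mpLower y / 2) (2 * mpUpper y) →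
            K k ^ 2 * Real.log (p k) ^ 7 / (δ k ^ 9 * (p k : ℝ)) ≤ volume.real I →
            |(eigenvalueCount (Matrix.of fun i j => x k i j ω) I : ℝ)
                - (p k : ℝ) * ∫ t in I, mpDensity y t| ≤ δ k * (p k : ℝ) * volume.real I} := by
  -- `C₁ = 20` is the exponent for which `resolution_bounds` is stated
  refine ⟨20, by norm_num, ?_⟩
  intro C₀ hC₀ y hy hy1 p n hp hpn δ hδ hδo K hKo Ω _ μ _ x hm hind h0 h1 hb A hA
  obtain ⟨κ, hκ, hcore⟩ := exists_counting_of_gridConcentrated hy hy1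
  have hpR : Tendsto (fun k => (p k : ℝ)) atTop atTop := tendsto_natCast_atTop_atTop.comp hp
  have hlog : Tendsto (fun k => Real.log (p k)) atTop atTop := Real.tendsto_log_atTop.comp hpR
  refine IsBigO.of_bound (2025 * (y / 2) ^ (-A)) ?_
  filter_upwards [hp.eventually_ge_atTop 2, hlog.eventually_ge_atTop 1,
    hlog.eventually_ge_atTop ((A + 10) / κ), hpn.eventually_const_lt (show y / 2 < y by linarith),
    hpn.eventually_lt_const hy1, hδo.bound hκ, hKo.bound one_pos,
    hpR.eventually (eventually_rpow_mul_log_pow_le hκ)] with k hp2 hl hlA hcy hc1 hcδ hKk hqP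
  obtain ⟨hδ0, hδ1⟩ := hδ k
  have hP2 : (2 : ℝ) ≤ p k := by exact_mod_cast hp2
  have hP0 : (0 : ℝ) < p k := by linarith
  have hP1 : (1 : ℝ) ≤ p k := by linarith
  -- `n = 0` would make the ratio `p / n` equal to `0`
  have hn0 : 0 < n k := by
    rcases Nat.eq_zero_or_pos (n k) with h | h
    · rw [h, Nat.cast_zero, div_zero] at hcy
      linarith
    · exact h
  have hN0 : (0 : ℝ) < n k := by exact_mod_cast hn0
  have hPN : (p k : ℝ) ≤ n k := by
    rw [div_lt_one hN0] at hc1; exact hc1.le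
  have hpn' : p k ≤ n k := by exact_mod_cast hPN
  -- the bound `K ≥ 1` is forced by the unit variance
  have hK2 : 1 ≤ K k ^ 2 :=
    (isBoundedStandard_map (hm k ⟨0, by omega⟩ ⟨0, hn0⟩) (h0 k _ _) (h1 k _ _) (hb k _ _)).one_le
  have hKnn : 0 ≤ K k := by
    obtain ⟨ω, hω⟩ := (hb k ⟨0, by omega⟩ ⟨0, hn0⟩).exists
    exact (abs_nonneg _).trans hω
  have hK1 : 1 ≤ K k := by nlinarith
  have hl0 : 0 < Real.log (p k) := by linarith
  have hKq : K k ≤ (p k : ℝ) ^ (1 / 20 : ℝ) * δ k ^ 2 / Real.log (p k) := by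
    rw [one_mul, Real.norm_of_nonneg hKnn, Real.norm_of_nonneg (by positivity)] at hKk
    refine hKk.trans ?_
    gcongr
  have hq1 : 1 ≤ (p k : ℝ) ^ (1 / 20 : ℝ) := Real.one_le_rpow hP1 (by norm_num)
  rw [div_le_iff₀ hκ, mul_comm] at hlA
  set η : ℝ := K k ^ 2 * Real.log (p k) ^ 5 / (δ k ^ 7 * p k) with hη
  obtain ⟨r1, r2, r3, r4, r5⟩ := resolution_bounds hP1 hPN hK1 hδ0 hδ1 hl hq1 hKq hκ hqP hA hlA hη
  have hη0 : 0 < η := by positivity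
  rw [Real.norm_eq_abs, Real.norm_of_nonneg (by positivity)] at hcδ
  -- `exp (-T) = p ^ (-A - 10)` beats the factor `p ^ 7` of the union bound
  set T : ℝ := (A + 10) * Real.log (p k) with hT
  have hT1 : 1 ≤ T := by rw [hT]; nlinarith
  have hprob := measureReal_not_gridConcentrated_le (μ := μ k) (by omega) (by linarith) (hm k)
    (hind k) (h0 k) (h1 k) (hb k) T (mpLower y / 4) hη0
  rw [Real.norm_of_nonneg measureReal_nonneg, Real.norm_of_nonneg (by positivity)]
  refine (measureReal_mono ?_ (measure_ne_top _ _)).trans (hprob.trans ?_)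
  · intro ω hω hG
    refine hω fun I hI hIsub hIlen => ?_
    exact hcore (p k) (n k) _ (K k) T (δ k) η hn0 hp2 hpn' hK1 hT1 hδ0 hδ1 hcy.le r1 r2 hcδ r3 r4
      hl hG I hI hIsub (r5 _ hIlen)
  · have e1 : Real.exp (-T) = (p k : ℝ) ^ (-(A + 10)) := by
      rw [Real.rpow_def_of_pos hP0, hT]; ring_nf
    have e2 : (p k : ℝ) ^ 7 * (p k : ℝ) ^ (-(A + 10)) ≤ (p k : ℝ) ^ (-A) := by
      rw [← Real.rpow_natCast (p k : ℝ) 7, ← Real.rpow_add hP0]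
      refine Real.rpow_le_rpow_of_exponent_le hP1 ?_
      push_cast; linarith
    have e3 : (p k : ℝ) ^ (-A) ≤ (y / 2) ^ (-A) * (n k : ℝ) ^ (-A) := by
      rw [← Real.mul_rpow (by positivity) hN0.le]
      refine Real.rpow_le_rpow_of_nonpos (by positivity) ?_ (by linarith)
      rw [lt_div_iff₀ hN0] at hcy
      exact hcy.le
    rw [e1, mul_assoc, mul_assoc]
    exact mul_le_mul_of_nonneg_left (e2.trans e3) (by norm_num)
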